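/- Let $\lambda$ be the security parameter. In D-DEMOS, an election authority (honest, and destroyed after setup) gives each of $n$ voters a ballot with two parts, each listing, for every one of $m$ options, a random 160-bit vote code (distinct within the ballot) and a uniformly random 64-bit receipt. The receipts and the vote-code encryption key are shared among $N_v$ vote collector (VC) nodes by $(N_v-f_v,N_v)$ verifiable secret sharing; each VC node also holds a salted, binding hash of every vote code. There are $N_b$ bulletin board (BB) nodes, holding the encrypted vote codes and lifted ElGamal commitments to the unit-vector encodings of the options, and $N_t$ trustees, among whom the openings of the commitments are shared with threshold $h_t$, $1\le h_t\le N_t$. An honest voter picks a ballot part at random and posts the vote code of her option to the VC nodes in random order, one after the other and each at most once, considering one reply per node and going on to the next when the reply is wrong or too late, until she obtains the receipt printed next to that code (a valid receipt). An honest VC node endorses (signs) at most one vote code per ballot during voting hours; $N_v-f_v$ signatures form a uniqueness certificate; a node discloses its receipt share for a vote code only with a certificate, and $N_v-f_v$ shares yield the receipt. After the end time, for each ballot, the VC nodes announce the certified vote codes they know, wait for $N_v-f_v$ announcements, run binary consensus (with agreement and validity) on whether the ballot was voted, recover missing certified codes, and submit the set of voted (serial number, vote code) pairs to the BB nodes.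 A BB node accepts a set submitted by $f_v+1$ VC nodes and opens the vote codes; the trustees, having read the same data from $f_b+1$ BB nodes, post shares of the opening of the homomorphic total, and from $h_t$ valid shares each BB node publishes the result. The adversary sees all messages sent by honest parties, may delay, drop, duplicate and reorder them, controls all clocks, statically corrupts nodes and adaptively corrupts voters, chooses the options of the honest voters, and decides the outcome of binary consensus within agreement and validity; channels between nodes, and replies of VC nodes to voters, are authenticated. Assume that the digital signature scheme of the VC nodes is existentially unforgeable under chosen-message attacks by (non-uniform) probabilistic polynomial-time forgers (with several signers, some corrupted), and let $\mathcal A$ be an adversary for which the election experiment runs in (non-uniform) probabilistic polynomial time, that corrupts at most $f_v<N_v/3$ VC nodes, at most $f_b<N_b/2$ BB nodes and at most $N_t-h_t$ of the $N_t$ trustees, where $f_v<2^{64}$ and the prime order $q$ of the commitment group exceeds $n$ and $N_t$. Then there is a negligible function $\mathsf{negl}$ such that for every $\lambda$ the probability that some honest voter obtains a valid receipt, and yet her vote is missing from the vote set or from the election result published by some honest BB node, is at most $$\frac{n\,f_v}{2^{64}-f_v}+\mathsf{negl}(\lambda).$$ All election parameters ($n,m,N_v,f_v,N_b,f_b,N_t,h_t$,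 the end time and the waiting time of the voters) may depend on $\lambda$. -/

import Mathlib

open scoped BigOperators

namespace DDemos

/-! ### Bit strings and polynomial time -/

abbrev Bits := List Bool

/-- Self-delimiting code of a bit string. -/
def delimit (w : Bits) : Bits := w.flatMap (fun b => [true, b]) ++ [false]

/-- Self-delimiting code of a list of bit strings. -/
def delimitAll (ws : List Bits) : Bits := ws.flatMap (fun w => true :: delimit w) ++ [false]

/-- A function on bit strings computed by a Turing machine in polynomial time. -/
def PolyTimeFun (f : Bits → Bits) : Prop :=
  Nonempty (Turing.TM2ComputableInPolyTime (id : Bits → Bits) (id : Bits → Bits) f)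

/-- Negligible functions of the security parameter. -/
def Negligible (ν : ℕ → ℝ) : Prop :=
  Asymptotics.SuperpolynomialDecay Filter.atTop (fun k : ℕ => (k : ℝ)) ν

/-! ### Digital signatures and their unforgeability -/

/-- A digital signature scheme; key generation and signing are randomised by uniform bits. -/
structure SignatureScheme where
  keyLen : ℕ → ℕ
  signLen : ℕ → ℕ
  /-- `gen k r` is the pair (public key, secret key). -/
  gen : (k : ℕ) → (Fin (keyLen k) → Bool) → Bits × Bits
  sign : (k : ℕ) → (sk msg : Bits) → (Fin (signLen k) → Bool) → Bits
  verify : (k : ℕ) → (pk msg sig : Bits) → Bool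
  correct : ∀ k r msg s, verify k (gen k r).1 msg (sign k (gen k r).2 msg s) = true

/-- Requests to a signing module that holds the key pairs of `U` signers. -/
inductive SigQuery (U : ℕ) : Type
  | pubKey (i : Fin U)
  | secKey (i : Fin U)
  | sign (i : Fin U) (msg : Bits)

/-- Computations that may address requests to the signing module. -/
inductive SigComp (U : ℕ) (α : Type) : Type
  | ret (a : α)
  | ask (q : SigQuery U) (next : Bits → SigComp U α)

namespace SigComp

def bind {U : ℕ} {α β : Type} : SigComp U α → (α → SigComp U β) → SigComp U β
  | ret a, f => f a
  | ask q next, f => ask q (fun r => (next r).bind f)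

instance (U : ℕ) : Monad (SigComp U) where
  pure := ret
  bind := bind

def query {U : ℕ} (q : SigQuery U) : SigComp U Bits := ask q ret

/-- Ask one request for each `i : Fin n` for which there is one. -/
def askFin {U : ℕ} : (n : ℕ) → (Fin n → Option (SigQuery U)) → SigComp U (Fin n → Option Bits)
  | 0, _ => ret Fin.elim0
  | n + 1, qs =>
    let rest (x : Option Bits) : SigComp U (Fin (n + 1) → Option Bits) :=
      (askFin n (fun i => qs i.succ)).bind fun f => ret (Fin.cons x f)
    match qs 0 with
    | none => rest none
    | some q => ask q fun r => rest (some r)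

/-- What the computation does after the given replies: its next request or its result. -/
def next {U : ℕ} {α : Type} : SigComp U α → List Bits → SigQuery U ⊕ α
  | ret a, _ => Sum.inr a
  | ask q _, [] => Sum.inl q
  | ask _ f, r :: rs => (f r).next rs

/-- Run a computation with the key pairs `keys`; the result comes with the list of requests. -/
noncomputable def run {U : ℕ} {α : Type} (S : SignatureScheme) (k : ℕ)
    (keys : Fin U → Bits × Bits) : SigComp U α → PMF (α × List (SigQuery U))
  | ret a => PMF.pure (a, [])
  | ask q f =>
    let reply : PMF Bits := match q with
      | .pubKey i => PMF.pure (keys i).1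
      | .secKey i => PMF.pure (keys i).2
      | .sign i msg =>
        (PMF.uniformOfFintype (Fin (S.signLen k) → Bool)).map (S.sign k (keys i).2 msg)
    reply.bind fun r => ((f r).run S k keys).map fun x => (x.1, q :: x.2)

end SigComp

/-- `U` independently generated key pairs. -/
noncomputable def SignatureScheme.keyDist (S : SignatureScheme) (k U : ℕ) :
    PMF (Fin U → Bits × Bits) :=
  (PMF.uniformOfFintype (Fin U → Fin (S.keyLen k) → Bool)).map fun r i => S.gen k (r i)

/-- A forger: for each security parameter, a randomised computation with access to the signing
module, which returns a list of candidate forgeries (signer, message, signature). -/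
structure Forger where
  users : ℕ → ℕ
  Coins : ℕ → Type
  dist : (k : ℕ) → PMF (Coins k)
  prog : (k : ℕ) → Coins k → SigComp (users k) (List (Fin (users k) × Bits × Bits))

/-- Bit-string form of the next move of a forger. -/
def encodeMove {U : ℕ} : SigQuery U ⊕ List (Fin U × Bits × Bits) → Bits
  | .inl (.pubKey i) => delimitAll [[false, false], Nat.bits i]
  | .inl (.secKey i) => delimitAll [[false, true], Nat.bits i]
  | .inl (.sign i msg) => delimitAll [[true, false], Nat.bits i, msg]
  | .inr l => delimitAll ([true, true] :: l.flatMap fun x => [Nat.bits x.1, x.2.1, x.2.2])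

/-- (Non-uniform) probabilistic polynomial time: the number of requests is polynomial, the coins
are written on a tape of polynomial length, and one polynomial-time Turing machine computes every
next move from `1^k`, the tape and the replies so far. As the distribution of the tape is
arbitrary, the tape may also hold advice. -/
def Forger.PolyTime (F : Forger) : Prop :=
  ∃ (f : Bits → Bits) (p : Polynomial ℕ) (tape : (k : ℕ) → F.Coins k → Bits),
    PolyTimeFun f ∧
    ∀ (k : ℕ) (ω : F.Coins k), (tape k ω).length ≤ p.eval k ∧
      ∀ replies : List Bits,
        f (delimitAll (List.replicate k true :: tape k ω :: replies)) =
          encodeMove ((F.prog k ω).next replies) ∧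
        (p.eval k ≤ replies.length → ((F.prog k ω).next replies).isRight = true)

/-- Some candidate is a valid signature, of a signer whose secret key was not requested, on a
message that this signer was not asked to sign. -/
def IsForgery {U : ℕ} (S : SignatureScheme) (k : ℕ) (keys : Fin U → Bits × Bits)
    (cands : List (Fin U × Bits × Bits)) (log : List (SigQuery U)) : Prop :=
  ∃ x ∈ cands, SigQuery.secKey x.1 ∉ log ∧ SigQuery.sign x.1 x.2.1 ∉ log ∧
    S.verify k (keys x.1).1 x.2.1 x.2.2 = true

/-- Success probability of a forger in the chosen-message game. -/
noncomputable def forgeProb (S : SignatureScheme) (F : Forger) (k : ℕ) : ℝ :=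
  (((F.dist k).bind fun ω => (S.keyDist k (F.users k)).bind fun keys =>
      ((F.prog k ω).run S k keys).map fun r => (keys, r)).toOuterMeasure
    {x | IsForgery S k x.1 x.2.1 x.2.2}).toReal

/-- Existential unforgeability under chosen-message attacks (several signers, corruptions). -/
def SignatureScheme.Unforgeable (S : SignatureScheme) : Prop :=
  ∀ F : Forger, F.PolyTime → Negligible (forgeProb S F)

/-! ### Secret sharing -/

/-- Verifiable secret sharing with an honest dealer: `t` of the `N` shares determine the secret,
and fewer than `t`, together with the public verification data, carry no information on it.
Nothing is required of `verify` on shares that the dealer has not issued. -/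
structure VSS (Secret : Type) (t N : ℕ) where
  Coins : Type
  Share : Type
  Pub : Type
  [fintypeCoins : Fintype Coins]
  [nonemptyCoins : Nonempty Coins]
  share : Secret → Coins → Fin N → Share
  pub : Secret → Coins → Pub
  verify : Pub → Fin N → Share → Bool
  recon : (Fin N → Option Share) → Secret
  complete : ∀ s r i, verify (pub s r) i (share s r i) = true
  correct : ∀ s r (T : Finset (Fin N)), t ≤ T.card →
    recon (fun i => if i ∈ T then some (share s r i) else none) = s
  secrecy : ∀ T : Finset (Fin N), T.card < t → ∀ s s' : Secret,
    (PMF.uniformOfFintype Coins).map (fun r => (pub s r, fun i : T => share s r i)) =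
      (PMF.uniformOfFintype Coins).map (fun r => (pub s' r, fun i : T => share s' r i))

attribute [instance] VSS.fintypeCoins VSS.nonemptyCoins

/-! ### Election parameters -/

abbrev Code := BitVec 160
abbrev Receipt := BitVec 64
abbrev Salt := BitVec 64
abbrev Key := BitVec 128
abbrev Digest := BitVec 256

/-- Election parameters and the primitives used, for one value of the security parameter. -/
structure Params where
  /-- numbers of voters and of options -/
  n : ℕ
  m : ℕ
  /-- vote collectors, bulletin board nodes, trustees, with their thresholds -/
  Nv : ℕ
  fv : ℕ
  Nb : ℕ
  fb : ℕ
  Nt : ℕ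
  ht : ℕ
  /-- election end time, and the time a voter waits for a receipt before trying another node -/
  Tend : ℕ
  patience : ℕ
  /-- the ballots can carry distinct vote codes -/
  codes_le : 2 * m ≤ 2 ^ 160
  receiptVSS : VSS Receipt (Nv - fv) Nv
  keyVSS : VSS Key (Nv - fv) Nv
  /-- salted hashes of vote codes and of the vote-code encryption key; they are binding -/
  hashCode : Code → Salt → Digest
  hashKey : Key → Salt → Digest
  hashCode_binding : ∀ s, Function.Injective fun c => hashCode c s
  hashKey_binding : ∀ s, Function.Injective fun c => hashKey c s
  /-- symmetric encryption of the vote codes, with an initialisation vector -/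
  enc : Key → BitVec 128 → Code → Bits
  dec : Key → Bits → Code
  dec_enc : ∀ k iv c, dec k (enc k iv c) = c
  /-- a group of prime exponent `q` (written additively) for lifted ElGamal commitments -/
  q : ℕ
  [prime_q : Fact q.Prime]
  G : Type
  [groupG : AddCommGroup G]
  [moduleG : Module (ZMod q) G]
  g : G
  h : G
  g_ne : g ≠ 0
  n_lt_q : n < q
  Nt_lt_q : Nt < q

attribute [instance] Params.prime_q Params.groupG Params.moduleG

variable (P : Params)

instance : Nonempty ((Bool × Fin P.m) ↪ Code) := by
  apply Function.Embedding.nonempty_of_card_le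
  have h : Fintype.card Code = 2 ^ 160 := by
    rw [Fintype.card_congr (BitVec.equivFin (m := 160)).toEquiv, Fintype.card_fin]
  rw [h]
  simpa using P.codes_le

instance : NeZero P.q := ⟨P.prime_q.out.ne_zero⟩

/-- An opening of a commitment: message and randomness. -/
abbrev Opening := ZMod P.q × ZMod P.q

instance : Fintype (Opening P) := instFintypeProd _ _

/-- Lifted ElGamal commitment. -/
def commit (o : Opening P) : P.G × P.G := (o.2 • P.g, o.1 • P.g + o.2 • P.h)

/-! ### The election authority -/

/-- Everything the election authority draws, with the coins of the voters. The serial number of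
the ballot of voter `ℓ` is `ℓ`; a ballot has parts `false` (A) and `true` (B) with one line per
option. Positions in the shuffled lists are numbered by `Fin m`; position `p` of part `X` of ballot
`ℓ` holds the data of option `shuffle ℓ X p`. -/
structure Setup where
  code : Fin P.n → (Bool × Fin P.m) ↪ Code
  receipt : Fin P.n → Bool → Fin P.m → Receipt
  shuffle : Fin P.n → Bool → Equiv.Perm (Fin P.m)
  codeSalt : Fin P.n → Bool → Fin P.m → Salt
  iv : Fin P.n → Bool → Fin P.m → BitVec 128
  receiptCoins : Fin P.n → Bool → Fin P.m → P.receiptVSS.Coins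
  msk : Key
  mskSalt : Salt
  mskCoins : P.keyVSS.Coins
  /-- for each component of the commitment of each option, coefficients of the two polynomials of
  degree `< ht` that share its opening; the constant message coefficient is overwritten below -/
  coeffs : Fin P.n → Bool → Fin P.m → Fin P.m → Fin P.ht → Opening P
  /-- the part a voter picks, and the order in which she tries the vote collectors -/
  part : Fin P.n → Bool
  order : Fin P.n → Equiv.Perm (Fin P.Nv)

noncomputable def setupDist : PMF (Setup P) := do
  let code ← PMF.uniformOfFintype (Fin P.n → (Bool × Fin P.m) ↪ Code)
  let receipt ← PMF.uniformOfFintype (Fin P.n → Bool → Fin P.m → Receipt)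
  let shuffle ← PMF.uniformOfFintype (Fin P.n → Bool → Equiv.Perm (Fin P.m))
  let codeSalt ← PMF.uniformOfFintype (Fin P.n → Bool → Fin P.m → Salt)
  let iv ← PMF.uniformOfFintype (Fin P.n → Bool → Fin P.m → BitVec 128)
  let receiptCoins ← PMF.uniformOfFintype (Fin P.n → Bool → Fin P.m → P.receiptVSS.Coins)
  let msk ← PMF.uniformOfFintype Key
  let mskSalt ← PMF.uniformOfFintype Salt
  let mskCoins ← PMF.uniformOfFintype P.keyVSS.Coins
  let coeffs ← PMF.uniformOfFintype (Fin P.n → Bool → Fin P.m → Fin P.m → Fin P.ht → Opening P)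
  let part ← PMF.uniformOfFintype (Fin P.n → Bool)
  let order ← PMF.uniformOfFintype (Fin P.n → Equiv.Perm (Fin P.Nv))
  return ⟨code, receipt, shuffle, codeSalt, iv, receiptCoins, msk, mskSalt, mskCoins, coeffs,
    part, order⟩

/-- Initialisation data of vote collector `i`, indexed by ballot, part and position. -/
structure VCData where
  digest : Fin P.n → Bool → Fin P.m → Digest
  salt : Fin P.n → Bool → Fin P.m → Salt
  share : Fin P.n → Bool → Fin P.m → P.receiptVSS.Share
  pub : Fin P.n → Bool → Fin P.m → P.receiptVSS.Pub
  mskShare : P.keyVSS.Share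

/-- Initialisation data of the bulletin board, which is public. The commitment of component `j` at
a position is the constant entry of `payload`; the other entries commit to the coefficients of the
polynomials that share its opening. -/
structure BBData where
  mskDigest : Digest
  mskSalt : Salt
  mskPub : P.keyVSS.Pub
  encCode : Fin P.n → Bool → Fin P.m → Bits
  payload : Fin P.n → Bool → Fin P.m → Fin P.m → Fin P.ht → P.G × P.G

/-- Initialisation data of a trustee: its shares of the openings. -/
abbrev TrusteeData := Fin P.n → Bool → Fin P.m → Fin P.m → Opening P

variable {P}

def Setup.vcData (su : Setup P) (i : Fin P.Nv) : VCData P where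
  digest ℓ X p := P.hashCode (su.code ℓ (X, su.shuffle ℓ X p)) (su.codeSalt ℓ X (su.shuffle ℓ X p))
  salt ℓ X p := su.codeSalt ℓ X (su.shuffle ℓ X p)
  share ℓ X p := P.receiptVSS.share (su.receipt ℓ X (su.shuffle ℓ X p))
    (su.receiptCoins ℓ X (su.shuffle ℓ X p)) i
  pub ℓ X p := P.receiptVSS.pub (su.receipt ℓ X (su.shuffle ℓ X p))
    (su.receiptCoins ℓ X (su.shuffle ℓ X p))
  mskShare := P.keyVSS.share su.msk su.mskCoins i

/-- The polynomials sharing component `j` of the encoding of option `o` (a unit vector). -/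
def Setup.poly (su : Setup P) (ℓ : Fin P.n) (X : Bool) (o j : Fin P.m) (d : Fin P.ht) :
    Opening P :=
  (if d.val = 0 then (if j = o then 1 else 0) else (su.coeffs ℓ X o j d).1, (su.coeffs ℓ X o j d).2)

def Setup.bbData (su : Setup P) : BBData P where
  mskDigest := P.hashKey su.msk su.mskSalt
  mskSalt := su.mskSalt
  mskPub := P.keyVSS.pub su.msk su.mskCoins
  encCode ℓ X p := P.enc su.msk (su.iv ℓ X p) (su.code ℓ (X, su.shuffle ℓ X p))
  payload ℓ X p j d := commit P (su.poly ℓ X (su.shuffle ℓ X p) j d)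

def Setup.trusteeData (su : Setup P) (t : Fin P.Nt) : TrusteeData P := fun ℓ X p j =>
  ∑ d : Fin P.ht, ((t.val + 1 : ZMod P.q) ^ d.val) • su.poly ℓ X (su.shuffle ℓ X p) j d

/-! ### Messages and local states -/

variable (P)

/-- A uniqueness certificate: signatures of vote collectors. -/
abbrev UCert := Fin P.Nv → Option Bits

/-- A set of voted (serial number, vote code) pairs. -/
abbrev VoteSet := Finset (Fin P.n × Code)

/-- `client` is any network user outside the system. -/
inductive Party : Type
  | vc (i : Fin P.Nv)
  | bb (b : Fin P.Nb)
  | trustee (t : Fin P.Nt)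
  | voter (ℓ : Fin P.n)
  | client

inductive Msg : Type
  | vote (ℓ : Fin P.n) (c : Code)
  | receipt (ℓ : Fin P.n) (r : Receipt)
  | endorse (ℓ : Fin P.n) (c : Code)
  | endorsement (ℓ : Fin P.n) (c : Code) (sig : Bits)
  | voteP (ℓ : Fin P.n) (c : Code) (share : P.receiptVSS.Share) (u : UCert P)
  | announce (ℓ : Fin P.n) (vote : Option (Code × UCert P))
  | recoverRequest (ℓ : Fin P.n)
  | recoverResponse (ℓ : Fin P.n) (c : Code) (u : UCert P)
  | voteSet (V : VoteSet P)
  | keyShare (s : P.keyVSS.Share)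
  | published (V : VoteSet P) (key : Key)
  | tallyShare (T : Fin P.m → Opening P)

structure Envelope where
  src : Party P
  msg : Msg P
  dst : Party P

/-- State of a vote collector for one ballot. `used` is the vote code for which the ballot is
pending or voted, with its certificate; the ballot is voted once `receipt` is known. -/
structure VCBallot where
  clients : List (Code × Party P)
  sigs : Code → UCert P
  endorsed : Option Code
  used : Option (Code × UCert P)
  shares : Fin P.Nv → Option P.receiptVSS.Share
  receipt : Option Receipt
  heard : Finset (Fin P.Nv)
  proposal : Option Bool
  decision : Option Bool

structure VCNode where
  clock : ℕ
  ballot : Fin P.n → VCBallot P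
  submitted : Bool

structure BBNode where
  clock : ℕ
  sets : Fin P.Nv → Option (VoteSet P)
  keyShares : Fin P.Nv → Option P.keyVSS.Share
  final : Option (VoteSet P)
  key : Option Key
  tally : Fin P.Nt → Option (Fin P.m → Opening P)
  result : Option (Fin P.m → ℕ)

structure TrusteeNode where
  views : Fin P.Nb → Option (VoteSet P × Key)
  posted : Bool

/-- `choice` is set when the voter is initialised; `waiting` is the vote collector from which she
awaits a receipt, `tried` the number of those contacted, `since` the time of the last contact. -/
structure Voter where
  corrupted : Bool
  choice : Option (Fin P.m)
  clock : ℕ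
  waiting : Option (Fin P.Nv)
  tried : ℕ
  since : ℕ
  hasReceipt : Bool

/-- Global state; `log` lists all messages sent by honest parties, `injected` those written by the
adversary. -/
structure State where
  clock : ℕ
  vc : Fin P.Nv → VCNode P
  bb : Fin P.Nb → BBNode P
  trustee : Fin P.Nt → TrusteeNode P
  voter : Fin P.n → Voter P
  log : List (Envelope P)
  injected : List (Envelope P)

def State.init : State P where
  clock := 0
  vc _ := ⟨0, fun _ => ⟨[], fun _ _ => none, none, none, fun _ => none, none, ∅, none, none⟩, false⟩
  bb _ := ⟨0, fun _ => none, fun _ => none, none, none, fun _ => none, none⟩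
  trustee _ := ⟨fun _ => none, false⟩
  voter _ := ⟨false, none, 0, none, 0, 0, false⟩
  log := []
  injected := []

variable {P}

def toAllVC (src : Party P) (msg : Msg P) : List (Envelope P) :=
  (List.finRange P.Nv).map fun j => ⟨src, msg, .vc j⟩

def toAllBB (src : Party P) (msg : Msg P) : List (Envelope P) :=
  (List.finRange P.Nb).map fun j => ⟨src, msg, .bb j⟩

/-! ### Vote collectors -/

/-- The message signed by an endorsement. -/
def signedMsg (ℓ : Fin P.n) (c : Code) : Bits :=
  (List.finRange 160).map (fun i => c.getLsbD i.val) ++ Nat.bits ℓ.val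

/-- What a vote collector knows: its data, the public keys, signature verification. -/
structure VCEnv (P : Params) where
  me : Fin P.Nv
  data : VCData P
  pk : Fin P.Nv → Bits
  ver : (pk msg sig : Bits) → Bool

section
open scoped Classical

/-- Number of valid signatures in a certificate for `(ℓ, c)`, and its validity. -/
noncomputable def VCEnv.sigCount (E : VCEnv P) (ℓ : Fin P.n) (c : Code) (u : UCert P) : ℕ :=
  (Finset.univ.filter fun i => ∃ σ, u i = some σ ∧ E.ver (E.pk i) (signedMsg ℓ c) σ = true).card

def VCEnv.validCert (E : VCEnv P) (ℓ : Fin P.n) (c : Code) (u : UCert P) : Prop :=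
  P.Nv - P.fv ≤ E.sigCount ℓ c u

/-- The ballot line (part and position) whose hash matches a vote code. -/
def VCEnv.findLine (E : VCEnv P) (ℓ : Fin P.n) (c : Code) : Option (Bool × Fin P.m) :=
  ([false, true] ×ˢ List.finRange P.m).find? fun x =>
    E.data.digest ℓ x.1 x.2 == P.hashCode c (E.data.salt ℓ x.1 x.2)

def VCNode.setBallot (s : VCNode P) (ℓ : Fin P.n) (b : VCBallot P) : VCNode P :=
  { s with ballot := Function.update s.ballot ℓ b }

/-- VOTE. -/
noncomputable def onVote (E : VCEnv P) (s : VCNode P) (src : Party P) (ℓ : Fin P.n) (c : Code) :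
    VCNode P × List (Envelope P) :=
  let b := s.ballot ℓ
  if s.clock < P.Tend then
    match b.used, b.receipt with
    | none, _ =>
      if (E.findLine ℓ c).isSome then
        (s.setBallot ℓ { b with clients := (c, src) :: b.clients },
          toAllVC (.vc E.me) (.endorse ℓ c))
      else (s, [])
    | some (c', _), some r => (s, if c = c' then [⟨.vc E.me, .receipt ℓ r, src⟩] else [])
    | some _, none => (s, [])
  else (s, [])

/-- ENDORSE from vote collector `j`: endorse at most one vote code per ballot. -/
noncomputable def onEndorse (E : VCEnv P) (s : VCNode P) (j : Fin P.Nv) (ℓ : Fin P.n) (c : Code) :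
    SigComp P.Nv (VCNode P × List (Envelope P)) :=
  let b := s.ballot ℓ
  if s.clock < P.Tend ∧ (b.endorsed = none ∨ b.endorsed = some c) then do
    let σ ← SigComp.query (.sign E.me (signedMsg ℓ c))
    return (s.setBallot ℓ { b with endorsed := some c },
      [⟨.vc E.me, .endorsement ℓ c σ, .vc j⟩])
  else return (s, [])

/-- ENDORSEMENT from vote collector `j`: collect, and on reaching `Nv - fv` signatures form the
certificate and disclose the own receipt share. -/
noncomputable def onEndorsement (E : VCEnv P) (s : VCNode P) (j : Fin P.Nv) (ℓ : Fin P.n)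
    (c : Code) (σ : Bits) : VCNode P × List (Envelope P) :=
  let b := s.ballot ℓ
  if s.clock < P.Tend ∧ b.used = none ∧ (∃ x ∈ b.clients, x.1 = c) ∧
      E.ver (E.pk j) (signedMsg ℓ c) σ = true then
    let u := Function.update (b.sigs c) j (some σ)
    let b := { b with sigs := Function.update b.sigs c u }
    match E.findLine ℓ c with
    | some l =>
      if E.validCert ℓ c u then
        (s.setBallot ℓ { b with used := some (c, u) },
          toAllVC (.vc E.me) (.voteP ℓ c (E.data.share ℓ l.1 l.2) u))
      else (s.setBallot ℓ b, [])
    | none => (s.setBallot ℓ b, [])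
  else (s, [])

/-- Once `Nv - fv` shares are there, reconstruct the receipt and send it to the clients. -/
noncomputable def tryReceipt (E : VCEnv P) (ℓ : Fin P.n) (c : Code) (b : VCBallot P) :
    VCBallot P × List (Envelope P) :=
  if b.receipt = none ∧
      P.Nv - P.fv ≤ (Finset.univ.filter fun j => (b.shares j).isSome = true).card then
    let r := P.receiptVSS.recon b.shares
    ({ b with receipt := some r },
      (b.clients.filter fun x => x.1 = c).map fun x => ⟨.vc E.me, .receipt ℓ r, x.2⟩)
  else (b, [])

/-- VOTE_P from vote collector `j`. -/
noncomputable def onVoteP (E : VCEnv P) (s : VCNode P) (j : Fin P.Nv) (ℓ : Fin P.n) (c : Code)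
    (sh : P.receiptVSS.Share) (u : UCert P) : VCNode P × List (Envelope P) :=
  let b := s.ballot ℓ
  match E.findLine ℓ c with
  | none => (s, [])
  | some l =>
    if s.clock < P.Tend ∧ E.validCert ℓ c u ∧
        P.receiptVSS.verify (E.data.pub ℓ l.1 l.2) j sh = true then
      match b.used with
      | none =>
        let b' := { b with used := some (c, u), shares := Function.update b.shares j (some sh) }
        let r := tryReceipt E ℓ c b'
        (s.setBallot ℓ r.1,
          toAllVC (.vc E.me) (.voteP ℓ c (E.data.share ℓ l.1 l.2) u) ++ r.2)
      | some (c', _) =>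
        if c = c' then
          let r := tryReceipt E ℓ c { b with shares := Function.update b.shares j (some sh) }
          (s.setBallot ℓ r.1, r.2)
        else (s, [])
    else (s, [])

/-- ANNOUNCE from vote collector `j`: adopt a certified vote code; after `Nv - fv` announcements
the opinion for binary consensus is fixed. -/
noncomputable def onAnnounce (E : VCEnv P) (s : VCNode P) (j : Fin P.Nv) (ℓ : Fin P.n)
    (v : Option (Code × UCert P)) : VCNode P :=
  let b := s.ballot ℓ
  if P.Tend ≤ s.clock ∧ b.proposal = none ∧ j ∉ b.heard then
    let heard := insert j b.heard
    let used : Option (Code × UCert P) := match b.used, v with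
      | none, some (c, u) =>
        if (E.findLine ℓ c).isSome ∧ E.validCert ℓ c u then some (c, u) else none
      | old, _ => old
    s.setBallot ℓ { b with
      heard := heard
      used := used
      proposal := if P.Nv - P.fv ≤ heard.card then some used.isSome else none }
  else s

/-- RECOVER-REQUEST from vote collector `j`. -/
noncomputable def onRecoverRequest (E : VCEnv P) (s : VCNode P) (j : Fin P.Nv) (ℓ : Fin P.n) :
    List (Envelope P) :=
  match (s.ballot ℓ).used with
  | some (c, u) =>
    if P.Tend ≤ s.clock then [⟨.vc E.me, .recoverResponse ℓ c u, .vc j⟩] else []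
  | none => []

/-- RECOVER-RESPONSE. -/
noncomputable def onRecoverResponse (E : VCEnv P) (s : VCNode P) (ℓ : Fin P.n) (c : Code)
    (u : UCert P) : VCNode P :=
  let b := s.ballot ℓ
  if b.decision = some true ∧ b.used = none ∧ (E.findLine ℓ c).isSome ∧ E.validCert ℓ c u then
    s.setBallot ℓ { b with used := some (c, u) }
  else s

/-- When every ballot is settled, submit the set of voted tuples and the share of the
vote-code encryption key to all bulletin board nodes. -/
noncomputable def finishVC (E : VCEnv P) (s : VCNode P) : VCNode P × List (Envelope P) :=
  if s.submitted = false ∧ P.Tend ≤ s.clock ∧ ∀ ℓ, (s.ballot ℓ).decision = some false ∨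
      ((s.ballot ℓ).decision = some true ∧ (s.ballot ℓ).used ≠ none) then
    let V : VoteSet P := Finset.univ.filter fun x =>
      (s.ballot x.1).decision = some true ∧ ∃ u, (s.ballot x.1).used = some (x.2, u)
    ({ s with submitted := true },
      toAllBB (.vc E.me) (.voteSet V) ++ toAllBB (.vc E.me) (.keyShare E.data.mskShare))
  else (s, [])

/-- Reaction of an honest vote collector to a message. Channels between nodes are authenticated;
only VOTE is accepted from anyone. -/
noncomputable def vcReceive (E : VCEnv P) (s : VCNode P) (src : Party P) (msg : Msg P) :
    SigComp P.Nv (VCNode P × List (Envelope P)) := do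
  let r : VCNode P × List (Envelope P) ← match src, msg with
    | _, .vote ℓ c => pure (onVote E s src ℓ c)
    | .vc j, .endorse ℓ c => onEndorse E s j ℓ c
    | .vc j, .endorsement ℓ c σ => pure (onEndorsement E s j ℓ c σ)
    | .vc j, .voteP ℓ c sh u => pure (onVoteP E s j ℓ c sh u)
    | .vc j, .announce ℓ v => pure (onAnnounce E s j ℓ v, [])
    | .vc j, .recoverRequest ℓ => pure (s, onRecoverRequest E s j ℓ)
    | .vc _, .recoverResponse ℓ c u => pure (onRecoverResponse E s ℓ c u, [])
    | _, _ => pure (s, [])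
  let f := finishVC E r.1
  return (f.1, r.2 ++ f.2)

/-- The clock of a vote collector advances; at the end time it announces what it knows. -/
def vcTick (E : VCEnv P) (s : VCNode P) : VCNode P × List (Envelope P) :=
  let s := { s with clock := s.clock + 1 }
  (s, if s.clock = P.Tend then
      (List.finRange P.n).flatMap fun ℓ => toAllVC (.vc E.me) (.announce ℓ (s.ballot ℓ).used)
    else [])

/-- Binary consensus on a ballot delivers `d` at a vote collector. -/
noncomputable def vcDecide (E : VCEnv P) (s : VCNode P) (ℓ : Fin P.n) (d : Bool) :
    VCNode P × List (Envelope P) :=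
  let b := s.ballot ℓ
  let f := finishVC E (s.setBallot ℓ { b with decision := some d })
  (f.1, (if d = true ∧ b.used = none then toAllVC (.vc E.me) (.recoverRequest ℓ) else []) ++ f.2)

/-! ### Bulletin board and trustees -/

/-- The position `(ℓ, X, p)` is marked as voted. -/
def Marked (D : BBData P) (V : VoteSet P) (key : Key) (ℓ : Fin P.n) (X : Bool) (p : Fin P.m) :
    Prop :=
  (ℓ, P.dec key (D.encCode ℓ X p)) ∈ V

/-- The tally set: marked positions, ballots with several marked positions being discarded. -/
noncomputable def tallyLines (D : BBData P) (V : VoteSet P) (key : Key) :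
    Finset (Fin P.n × Bool × Fin P.m) :=
  Finset.univ.filter fun x => Marked D V key x.1 x.2.1 x.2.2 ∧
    ∀ X p, Marked D V key x.1 X p → (X, p) = x.2

/-- The share of the opening of the homomorphic total that a trustee computes. -/
noncomputable def totalShare (D : BBData P) (T : TrusteeData P) (V : VoteSet P) (key : Key) :
    Fin P.m → Opening P :=
  fun j => ∑ x ∈ tallyLines D V key, T x.1 x.2.1 x.2.2 j

/-- A trustee's share of the total agrees with the commitments. -/
def ValidTotal (D : BBData P) (V : VoteSet P) (key : Key) (t : Fin P.Nt)
    (T : Fin P.m → Opening P) : Prop :=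
  ∀ j, commit P (T j) = ∑ x ∈ tallyLines D V key, ∑ d : Fin P.ht,
    ((t.val + 1 : ZMod P.q) ^ d.val) • D.payload x.1 x.2.1 x.2.2 j d

/-- A bulletin board node has fixed the vote set and opened the vote codes. -/
def BBNode.view (s : BBNode P) : Option (VoteSet P × Key) :=
  match s.final, s.key with
  | some V, some key => some (V, key)
  | _, _ => none

/-- Reaction of an honest bulletin board node. It accepts a vote set submitted by `fv + 1` vote
collectors, and a key reconstructed from `Nv - fv` valid shares that matches the digest; after that
it answers the reads of the trustees, and from `ht` valid shares of the total it publishes the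
result. -/
noncomputable def bbReceive (D : BBData P) (me : Fin P.Nb) (s : BBNode P) (src : Party P)
    (msg : Msg P) : BBNode P × List (Envelope P) :=
  let s' : BBNode P :=
    if s.clock < P.Tend then s else
    match src, msg with
    | .vc i, .voteSet V =>
      if s.sets i = none then
        let sets := Function.update s.sets i (some V)
        { s with
          sets := sets
          final := if s.final = none ∧
              P.fv + 1 ≤ (Finset.univ.filter fun j => sets j = some V).card
            then some V else s.final }
      else s
    | .vc i, .keyShare sh =>
      if P.keyVSS.verify D.mskPub i sh = true then
        let shares := Function.update s.keyShares i (some sh)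
        let key := P.keyVSS.recon shares
        { s with
          keyShares := shares
          key := if s.key = none ∧ P.hashKey key D.mskSalt = D.mskDigest ∧
              P.Nv - P.fv ≤ (Finset.univ.filter fun j => (shares j).isSome = true).card
            then some key else s.key }
      else s
    | .trustee t, .tallyShare T =>
      match s.view with
      | none => s
      | some (V, key) =>
        if ValidTotal D V key t T ∧ s.result = none then
          let tally := Function.update s.tally t (some T)
          let valid := Finset.univ.filter fun t => (tally t).isSome = true
          { s with
            tally := tally
            result := if P.ht ≤ valid.card then
                some fun j => ((Lagrange.interpolate valid (fun t => (t.val + 1 : ZMod P.q))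
                  (fun t => ((tally t).getD 0 j).1)).eval 0).val
              else none }
        else s
    | _, _ => s
  (s', match s.view, s'.view with
    | none, some (V, key) =>
      (List.finRange P.Nt).map fun t => ⟨.bb me, .published V key, .trustee t⟩
    | _, _ => [])

/-- Reaction of an honest trustee: after `fb + 1` identical readings, post the share of the total. -/
noncomputable def trusteeReceive (D : BBData P) (T : TrusteeData P) (me : Fin P.Nt)
    (s : TrusteeNode P) (src : Party P) (msg : Msg P) : TrusteeNode P × List (Envelope P) :=
  match src, msg with
  | .bb b, .published V key =>
    let views := Function.update s.views b (some (V, key))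
    if s.posted = false ∧
        P.fb + 1 ≤ (Finset.univ.filter fun j => views j = some (V, key)).card then
      (⟨views, true⟩, toAllBB (.trustee me) (.tallyShare (totalShare D T V key)))
    else ({ s with views := views }, [])
  | _, _ => (s, [])

/-! ### Voters -/

/-- Post the vote to the next vote collector; each is contacted at most once. -/
def contactNext (su : Setup P) (ℓ : Fin P.n) (o : Fin P.m) (v : Voter P) :
    Voter P × List (Envelope P) :=
  if h : v.tried < P.Nv then
    if v.clock < P.Tend then
      let i := su.order ℓ ⟨v.tried, h⟩
      ({ v with waiting := some i, tried := v.tried + 1, since := v.clock },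
        [⟨.voter ℓ, .vote ℓ (su.code ℓ (su.part ℓ, o)), .vc i⟩])
    else ({ v with waiting := none }, [])
  else ({ v with waiting := none }, [])

/-- A reply from the vote collector she is waiting for: accept a valid receipt, else go on. -/
noncomputable def voterReceive (su : Setup P) (ℓ : Fin P.n) (v : Voter P) (src : Party P)
    (msg : Msg P) : Voter P × List (Envelope P) :=
  match src, msg, v.choice with
  | .vc i, .receipt ℓ' r, some o =>
    if ℓ' = ℓ ∧ v.waiting = some i then
      if r = su.receipt ℓ (su.part ℓ) o then
        ({ v with waiting := none, hasReceipt := true }, [])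
      else contactNext su ℓ o v
    else (v, [])
  | _, _, _ => (v, [])

/-- The clock of a voter advances; after waiting in vain she turns to another vote collector. -/
def voterTick (su : Setup P) (ℓ : Fin P.n) (v : Voter P) : Voter P × List (Envelope P) :=
  let v := { v with clock := v.clock + 1 }
  match v.choice with
  | some o =>
    if v.waiting.isSome ∧ v.since + P.patience ≤ v.clock then contactNext su ℓ o v else (v, [])
  | none => (v, [])

/-! ### The adversary -/

/-- The sets of corrupted nodes. -/
structure Corruption (P : Params) where
  vc : Finset (Fin P.Nv)
  bb : Finset (Fin P.Nb)
  trustee : Finset (Fin P.Nt)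

/-- What the adversary may do in one move: advance the global clock or the clock of a node, deliver
the `k`-th message sent so far by an honest party (any number of times, or never), write a message
on behalf of a corrupted party, corrupt a voter, start an honest voter with a choice of option, and
let binary consensus on a ballot deliver a value at a vote collector. -/
inductive Action (P : Params) : Type
  | tick
  | tickNode (X : Party P)
  | deliver (k : ℕ)
  | inject (e : Envelope P)
  | corrupt (ℓ : Fin P.n)
  | start (ℓ : Fin P.n) (o : Fin P.m)
  | decide (i : Fin P.Nv) (ℓ : Fin P.n) (d : Bool)

/-- What the adversary learns at the beginning. -/
structure InitView (P : Params) where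
  pk : Fin P.Nv → Bits
  sk : Fin P.Nv → Option Bits
  vcData : Fin P.Nv → Option (VCData P)
  trusteeData : Fin P.Nt → Option (TrusteeData P)
  bbData : BBData P

/-- What the adversary learns in one move: all messages newly sent by honest parties, the contents
of the bulletin board, the consensus opinions, and the secrets of a newly corrupted voter. -/
structure Obs (P : Params) where
  sent : List (Envelope P)
  board : Fin P.Nb → Option (VoteSet P) × Option Key × Option (Fin P.m → ℕ)
  opinions : Fin P.Nv → Fin P.n → Option Bool
  revealed : Option ((Bool → Fin P.m → Code × Receipt) × Bool × Equiv.Perm (Fin P.Nv))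

/-- The party is controlled by the adversary. -/
def Corrupt (C : Corruption P) (st : State P) : Party P → Prop
  | .vc i => i ∈ C.vc
  | .bb b => b ∈ C.bb
  | .trustee t => t ∈ C.trustee
  | .voter ℓ => (st.voter ℓ).corrupted = true
  | .client => True

/-- An election instance. -/
structure Instance (P : Params) where
  su : Setup P
  C : Corruption P
  pk : Fin P.Nv → Bits
  ver : (pk msg sig : Bits) → Bool

def Instance.env (I : Instance P) (i : Fin P.Nv) : VCEnv P := ⟨i, I.su.vcData i, I.pk, I.ver⟩

/-- A message reaches an honest party. -/
noncomputable def receive (I : Instance P) (st : State P) (e : Envelope P) :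
    SigComp P.Nv (State P × List (Envelope P)) :=
  if Corrupt I.C st e.dst then return (st, []) else
  match e.dst with
  | .vc i => do
    let r ← vcReceive (I.env i) (st.vc i) e.src e.msg
    return ({ st with vc := Function.update st.vc i r.1 }, r.2)
  | .bb b =>
    let r := bbReceive I.su.bbData b (st.bb b) e.src e.msg
    return ({ st with bb := Function.update st.bb b r.1 }, r.2)
  | .trustee t =>
    let r := trusteeReceive I.su.bbData (I.su.trusteeData t) t (st.trustee t) e.src e.msg
    return ({ st with trustee := Function.update st.trustee t r.1 }, r.2)
  | .voter ℓ =>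
    let r := voterReceive I.su ℓ (st.voter ℓ) e.src e.msg
    return ({ st with voter := Function.update st.voter ℓ r.1 }, r.2)
  | .client => return (st, [])

/-- The clock of an honest node advances. -/
def tickNode (I : Instance P) (st : State P) : Party P → State P × List (Envelope P)
  | .vc i =>
    let r := vcTick (I.env i) (st.vc i)
    ({ st with vc := Function.update st.vc i r.1 }, r.2)
  | .bb b =>
    ({ st with bb := Function.update st.bb b { st.bb b with clock := (st.bb b).clock + 1 } }, [])
  | .voter ℓ =>
    let r := voterTick I.su ℓ (st.voter ℓ)
    ({ st with voter := Function.update st.voter ℓ r.1 }, r.2)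
  | _ => (st, [])

/-- Binary consensus may deliver `d` on ballot `ℓ` at the honest vote collector `i`: it has entered
and has no result yet; no honest vote collector has obtained the other value (agreement); some
honest vote collector has entered with opinion `d` (validity). -/
def MayDecide (I : Instance P) (st : State P) (i : Fin P.Nv) (ℓ : Fin P.n) (d : Bool) : Prop :=
  i ∉ I.C.vc ∧ ((st.vc i).ballot ℓ).proposal ≠ none ∧ ((st.vc i).ballot ℓ).decision = none ∧
    (∀ j, j ∉ I.C.vc → ((st.vc j).ballot ℓ).decision ≠ some (!d)) ∧
    ∃ j, j ∉ I.C.vc ∧ ((st.vc j).ballot ℓ).proposal = some d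

/-- Effect of a move: new state and messages sent by honest parties. -/
noncomputable def applyAction (I : Instance P) (st : State P) :
    Action P → SigComp P.Nv (State P × List (Envelope P))
  | .tick => return ({ st with clock := st.clock + 1 }, [])
  | .tickNode X => if Corrupt I.C st X then return (st, []) else return tickNode I st X
  | .deliver k =>
    match st.log[k]? with
    | some e => receive I st e
    | none => return (st, [])
  | .inject e =>
    if Corrupt I.C st e.src then receive I { st with injected := st.injected ++ [e] } e
    else return (st, [])
  | .corrupt ℓ =>
    return ({ st with
      voter := Function.update st.voter ℓ { st.voter ℓ with corrupted := true } }, [])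
  | .start ℓ o =>
    if (st.voter ℓ).corrupted = false ∧ (st.voter ℓ).choice = none then
      let r := contactNext I.su ℓ o { st.voter ℓ with choice := some o, clock := st.clock }
      return ({ st with voter := Function.update st.voter ℓ r.1 }, r.2)
    else return (st, [])
  | .decide i ℓ d =>
    if MayDecide I st i ℓ d then
      let r := vcDecide (I.env i) (st.vc i) ℓ d
      return ({ st with vc := Function.update st.vc i r.1 }, r.2)
    else return (st, [])

/-- One move of the adversary. -/
noncomputable def step (I : Instance P) (st : State P) (a : Action P) :
    SigComp P.Nv (State P × Obs P) := do
  let r ← applyAction I st a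
  let st' := { r.1 with log := r.1.log ++ r.2 }
  return (st',
    { sent := r.2
      board := fun b => ((st'.bb b).final, (st'.bb b).key, (st'.bb b).result)
      opinions := fun i ℓ => ((st'.vc i).ballot ℓ).proposal
      revealed := match a with
        | .corrupt ℓ =>
          some (fun X o => (I.su.code ℓ (X, o), I.su.receipt ℓ X o), I.su.part ℓ, I.su.order ℓ)
        | _ => none })

/-- The execution, of `T` moves. -/
noncomputable def play (I : Instance P) (act : List (Obs P) → Action P) :
    (T : ℕ) → State P → List (Obs P) → SigComp P.Nv (State P)
  | 0, st, _ => return st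
  | T + 1, st, past => do
    let r ← step I st (act past)
    play I act T r.1 (past ++ [r.2])

/-- The election experiment. The signing module holds the key pairs of the vote collectors; the
secret keys of the corrupted ones are handed to the adversary. -/
noncomputable def experiment (ver : (pk msg sig : Bits) → Bool) (su : Setup P) (C : Corruption P)
    (act : InitView P → List (Obs P) → Action P) (T : ℕ) : SigComp P.Nv (State P) := do
  let pks ← SigComp.askFin P.Nv fun i => some (.pubKey i)
  let sks ← SigComp.askFin P.Nv fun i => if i ∈ C.vc then some (.secKey i) else none
  let pk : Fin P.Nv → Bits := fun i => (pks i).getD []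
  let view : InitView P :=
    { pk := pk
      sk := sks
      vcData := fun i => if i ∈ C.vc then some (su.vcData i) else none
      trusteeData := fun t => if t ∈ C.trustee then some (su.trusteeData t) else none
      bbData := su.bbData }
  play ⟨su, C, pk, ver⟩ (act view) T (State.init P) []

/-! ### The attack on safety -/

/-- The election result on a bulletin board node counts the vote of voter `ℓ` for option `o`: it
is the count of the options at the positions of the tally set, which contains a position of that
option in the part she used. -/
def TallyIncludes (su : Setup P) (s : BBNode P) (x : Fin P.m → ℕ) (ℓ : Fin P.n) (o : Fin P.m) :
    Prop :=
  ∃ V key, s.view = some (V, key) ∧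
    (∀ j, x j = ((tallyLines su.bbData V key).filter fun y =>
      su.shuffle y.1 y.2.1 y.2.2 = j).card) ∧
    ∃ p, su.shuffle ℓ (su.part ℓ) p = o ∧ (ℓ, su.part ℓ, p) ∈ tallyLines su.bbData V key

/-- Some honest voter holds a valid receipt, and her vote is missing from the vote set or from the
election result published on some honest bulletin board node. -/
def SafetyBroken (su : Setup P) (C : Corruption P) (st : State P) : Prop :=
  ∃ (ℓ : Fin P.n) (o : Fin P.m), (st.voter ℓ).corrupted = false ∧
    (st.voter ℓ).choice = some o ∧ (st.voter ℓ).hasReceipt = true ∧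
    ∃ b, b ∉ C.bb ∧
      ((∃ V, (st.bb b).final = some V ∧ (ℓ, su.code ℓ (su.part ℓ, o)) ∉ V) ∨
        ∃ x, (st.bb b).result = some x ∧ ¬ TallyIncludes su (st.bb b) x ℓ o)

end

/-- The signatures in the certificates written by the adversary. -/
def candidates (st : State P) : List (Fin P.Nv × Bits × Bits) :=
  st.injected.flatMap fun e =>
    let sigs (ℓ : Fin P.n) (c : Code) (u : UCert P) : List (Fin P.Nv × Bits × Bits) :=
      (List.finRange P.Nv).filterMap fun i => (u i).map fun σ => (i, signedMsg ℓ c, σ)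
    match e.msg with
    | .voteP ℓ c _ u => sigs ℓ c u
    | .announce ℓ (some (c, u)) => sigs ℓ c u
    | .recoverResponse ℓ c u => sigs ℓ c u
    | _ => []

/-- An adversary, for each value of the security parameter: its coins, the nodes it corrupts, its
moves as a function of what it has seen, and the number of its moves. -/
structure Adversary (P : ℕ → Params) where
  Coins : ℕ → Type
  dist : (k : ℕ) → PMF (Coins k)
  corruption : (k : ℕ) → Coins k → Corruption (P k)
  act : (k : ℕ) → Coins k → InitView (P k) → List (Obs (P k)) → Action (P k)
  moves : ℕ → ℕ

/-- The election experiment with an adversary, at security parameter `k`. -/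
noncomputable def Adversary.play {P : ℕ → Params} (A : Adversary P) (S : SignatureScheme) (k : ℕ)
    (su : Setup (P k)) (ω : A.Coins k) : SigComp (P k).Nv (State (P k)) :=
  experiment (S.verify k) su (A.corruption k ω) (A.act k ω) (A.moves k)

/-- The experiment as a computation with access to the signing module. -/
noncomputable def Adversary.toForger {P : ℕ → Params} (A : Adversary P) (S : SignatureScheme) :
    Forger where
  users k := (P k).Nv
  Coins k := Setup (P k) × A.Coins k
  dist k := do
    let su ← setupDist (P k)
    let ω ← A.dist k
    return (su, ω)
  prog k x := do
    let st ← A.play S k x.1 x.2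
    return candidates st

/-- The adversary is efficient. As usual for game-based definitions, its running time is that of
the experiment in which it takes part (the work of the honest parties included; key generation
and signing of the vote collectors count as one request each). -/
def Adversary.PolyTime {P : ℕ → Params} (A : Adversary P) (S : SignatureScheme) : Prop :=
  (A.toForger S).PolyTime

/-- Probability that the adversary excludes from the tally the vote of at least one honest voter
who obtained a valid receipt. -/
noncomputable def exclusionProb {P : ℕ → Params} (A : Adversary P) (S : SignatureScheme)
    (k : ℕ) : ℝ :=
  ((do
    let su ← setupDist (P k)
    let ω ← A.dist k
    let keys ← S.keyDist k (P k).Nv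
    let r ← (A.play S k su ω).run S k keys
    return (su, A.corruption k ω, r.1) :
      PMF (Setup (P k) × Corruption (P k) × State (P k))).toOuterMeasure
    {x | SafetyBroken x.1 x.2.1 x.2.2}).toReal

end DDemos

/-! Call the vote collectors that have disclosed a share for the vote code of an honest voter its
disclosers; all of them are honest, since only messages of honest parties are logged. When a voter
holds a valid receipt, the argument splits on whether there are at least `Nv - 2 * fv` disclosers.

Many disclosers. A vote collector discloses only before the end time and with a certificate, so it
never announces afterwards that it knows no code for the ballot. Any `Nv - fv` announcers meet any
`Nv - 2 * fv` disclosers because `3 * fv < Nv`, so no opinion `false` enters consensus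
(`proposal_ne_false`) and by validity the ballot cannot be declared unused. Unless a signature was
forged, two certificates share an honest signer, who endorses one code per ballot, so the certified
code is unique (`cert_unique`). Of the `fv + 1` nodes behind an accepted vote set one is honest, so
the set contains her code and no other code of her ballot (`mem_voteSet_iff`). Commitments are
perfectly binding and homomorphic, so every valid trustee share is a value of one fixed polynomial
of degree below `ht`; its value at `0` is the true count, which does not wrap around modulo `q`
(`interpolated_eq`).

Few disclosers. Together with the corrupted nodes they account for fewer than `Nv - fv` shares, so
secrecy leaves the receipt uniform. An honest vote collector could not have sent it
(`disclosed_of_receipt`), hence a corrupted one guessed it. To bound this probability, compare with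
a run in which the voter rejects every receipt. It agrees with the real run until the first
acceptance, so the accepted receipt is among the receipts considered in it (`mem_guesses`), of which
there are at most `fv`, one per corrupted node (`length_guesses_le`). The event that the `g`-th of
these is `ρ`, at a time when `T` is the set of disclosers, is unchanged when the true receipt is
reshared with the same shares for `T` and the corrupted nodes (`guesses_setLine`), so it is
independent of the receipt (`measure_receipt_eq`). Each `g` thus succeeds with probability at most
`2⁻⁶⁴`. No conditioning on earlier wrong guesses is needed, and a union bound over guesses and
voters gives `n * fv / 2 ^ 64`, which is below the stated bound.

The negligible term is the success probability of the whole experiment viewed as a forger that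
outputs the signatures in certificates written by the adversary. The argument on guesses needs the
run to be a deterministic function of the setup, so the signing coins are drawn in advance, one
string per move. -/

namespace DDemos

/-! ### Computations with fixed replies -/

namespace SigComp

variable {U : ℕ} {α β : Type}

/-- Result and requests of a computation when every request `q` gets the reply `ans q`. -/
def eval (ans : SigQuery U → Bits) : SigComp U α → α × List (SigQuery U)
  | ret a => (a, [])
  | ask q f => (((f (ans q)).eval ans).1, q :: ((f (ans q)).eval ans).2)

/-- At most one request is made. -/
def AtMostOne : SigComp U α → Prop
  | ret _ => True
  | ask _ f => ∀ r, ∃ a, f r = ret a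

@[simp] theorem eval_pure (ans : SigQuery U → Bits) (a : α) :
    (pure a : SigComp U α).eval ans = (a, []) := rfl

theorem eval_bind' (ans : SigQuery U → Bits) (c : SigComp U α) (f : α → SigComp U β) :
    (c.bind f).eval ans =
      (((f (c.eval ans).1).eval ans).1, (c.eval ans).2 ++ ((f (c.eval ans).1).eval ans).2) := by
  induction c with
  | ret a => rfl
  | ask q g ih => simp only [bind, eval, ih, List.cons_append]

@[simp] theorem eval_bind (ans : SigQuery U → Bits) (c : SigComp U α) (f : α → SigComp U β) :
    (c >>= f).eval ans =
      (((f (c.eval ans).1).eval ans).1, (c.eval ans).2 ++ ((f (c.eval ans).1).eval ans).2) :=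
  eval_bind' ans c f

theorem AtMostOne.bind_pure {c : SigComp U α} (hc : c.AtMostOne) (f : α → β) :
    (c >>= fun a => (pure (f a) : SigComp U β)).AtMostOne := by
  cases c with
  | ret a => trivial
  | ask q g =>
    intro r
    obtain ⟨a, ha⟩ := hc r
    refine ⟨f a, ?_⟩
    change (g r).bind _ = _
    rw [ha]; rfl

/-- The reply of the signing module when the coins of a signature are `s`. -/
def reply (S : SignatureScheme) (k : ℕ) (keys : Fin U → Bits × Bits)
    (s : Fin (S.signLen k) → Bool) : SigQuery U → Bits
  | .pubKey i => (keys i).1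
  | .secKey i => (keys i).2
  | .sign i msg => S.sign k (keys i).2 msg s

theorem run_bind' (S : SignatureScheme) (k : ℕ) (keys : Fin U → Bits × Bits)
    (c : SigComp U α) (f : α → SigComp U β) :
    (c.bind f).run S k keys = (c.run S k keys).bind fun x =>
      ((f x.1).run S k keys).map fun y => (y.1, x.2 ++ y.2) := by
  induction c with
  | ret a =>
    simp only [bind, run, PMF.pure_bind, List.nil_append]
    exact (PMF.map_id _).symm
  | ask q g ih =>
    simp only [bind, run, ih, PMF.bind_bind, PMF.map_bind, PMF.bind_map, PMF.map_comp]
    rfl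

theorem run_bind (S : SignatureScheme) (k : ℕ) (keys : Fin U → Bits × Bits)
    (c : SigComp U α) (f : α → SigComp U β) :
    (c >>= f).run S k keys = (c.run S k keys).bind fun x =>
      ((f x.1).run S k keys).map fun y => (y.1, x.2 ++ y.2) :=
  run_bind' S k keys c f

theorem run_pure (S : SignatureScheme) (k : ℕ) (keys : Fin U → Bits × Bits) (a : α) :
    (pure a : SigComp U α).run S k keys = PMF.pure (a, []) := rfl

/-- A single request consumes at most one string of signing coins, so this string can be drawn
before the computation starts. If no signature is requested it is drawn and ignored. -/
theorem AtMostOne.run_eq {c : SigComp U α} (hc : c.AtMostOne) (S : SignatureScheme) (k : ℕ)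
    (keys : Fin U → Bits × Bits) :
    c.run S k keys = (PMF.uniformOfFintype (Fin (S.signLen k) → Bool)).map
      fun s => c.eval (reply S k keys s) := by
  cases c with
  | ret a => simp only [run, eval]; exact (PMF.map_const _ _).symm
  | ask q f =>
    choose a ha using hc
    have hf : f = fun r => ret (a r) := funext ha
    subst hf
    cases q with
    | pubKey i =>
      simp only [run, eval, reply, PMF.pure_bind, PMF.pure_map]
      exact (PMF.map_const _ _).symm
    | secKey i =>
      simp only [run, eval, reply, PMF.pure_bind, PMF.pure_map]
      exact (PMF.map_const _ _).symm
    | sign i msg =>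
      simp only [run, eval, reply, PMF.pure_map, PMF.bind_map]
      rfl

/-- Replies to the key requests. -/
def keyReply (keys : Fin U → Bits × Bits) : SigQuery U → Bits
  | .pubKey i => (keys i).1
  | .secKey i => (keys i).2
  | .sign _ _ => []

/-- A request for a key. -/
def IsKeyQuery : SigQuery U → Prop
  | .pubKey _ => True
  | .secKey _ => True
  | .sign _ _ => False

/-- Once the keys are fixed, key requests have determined replies, so the opening of the experiment
involves no randomness. -/
theorem run_askFin (S : SignatureScheme) (k : ℕ) (keys : Fin U → Bits × Bits) :
    ∀ (n : ℕ) (qs : Fin n → Option (SigQuery U)),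
      (∀ i q, qs i = some q → IsKeyQuery q) →
      ∃ l : List (SigQuery U), (∀ q ∈ l, ∃ i, qs i = some q) ∧
        (askFin n qs).run S k keys = PMF.pure (fun i => (qs i).map (keyReply keys), l)
  | 0, qs, _ => ⟨[], by simp, by
      simp only [askFin, run]
      congr 2
      funext i; exact i.elim0⟩
  | n + 1, qs, h => by
    obtain ⟨l, hl, hrun⟩ := run_askFin S k keys n (fun i => qs i.succ) (fun i q hq => h _ q hq)
    cases h0 : qs 0 with
    | none =>
      refine ⟨l, fun q hq => ?_, ?_⟩
      · obtain ⟨i, hi⟩ := hl q hq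
        exact ⟨_, hi⟩
      · simp only [askFin, h0, run_bind', hrun, PMF.pure_bind, run, PMF.pure_map, List.append_nil]
        congr 2
        funext i
        refine Fin.cases ?_ (fun j => ?_) i <;> simp [h0]
    | some q0 =>
      refine ⟨q0 :: l, fun q hq => ?_, ?_⟩
      · rcases List.mem_cons.1 hq with rfl | hq
        · exact ⟨0, h0⟩
        · obtain ⟨i, hi⟩ := hl q hq
          exact ⟨_, hi⟩
      · have hk := h 0 q0 h0
        have key : ∀ r : Bits, r = keyReply keys q0 →
            (Fin.cons (some r) (fun i : Fin n => (qs i.succ).map (keyReply keys)) :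
              Fin (n + 1) → Option Bits) = fun i => (qs i).map (keyReply keys) := by
          rintro r rfl
          funext i
          refine Fin.cases ?_ (fun j => ?_) i <;> simp [h0]
        cases q0 with
        | sign i m => exact hk.elim
        | pubKey i =>
          simp only [askFin, h0, run, run_bind', hrun, PMF.pure_bind, PMF.pure_map,
            List.append_nil]
          rw [key (keys i).1 rfl]
        | secKey i =>
          simp only [askFin, h0, run, run_bind', hrun, PMF.pure_bind, PMF.pure_map,
            List.append_nil]
          rw [key (keys i).2 rfl]

end SigComp

/-! ### The moves with fixed replies -/

section
open scoped Classical
open SigComp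

variable {P : Params}

/-- Reaction of a vote collector before the check whether all ballots are settled. -/
noncomputable def vcReact (ans : SigQuery P.Nv → Bits) (E : VCEnv P) (s : VCNode P)
    (src : Party P) (msg : Msg P) : (VCNode P × List (Envelope P)) × List (SigQuery P.Nv) :=
  match src, msg with
  | _, .vote ℓ c => (onVote E s src ℓ c, [])
  | .vc j, .endorse ℓ c => (onEndorse E s j ℓ c).eval ans
  | .vc j, .endorsement ℓ c σ => (onEndorsement E s j ℓ c σ, [])
  | .vc j, .voteP ℓ c sh u => (onVoteP E s j ℓ c sh u, [])
  | .vc j, .announce ℓ v => ((onAnnounce E s j ℓ v, []), [])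
  | .vc j, .recoverRequest ℓ => ((s, onRecoverRequest E s j ℓ), [])
  | .vc _, .recoverResponse ℓ c u => ((onRecoverResponse E s ℓ c u, []), [])
  | _, _ => ((s, []), [])

theorem eval_vcReceive (ans : SigQuery P.Nv → Bits) (E : VCEnv P) (s : VCNode P)
    (src : Party P) (msg : Msg P) :
    (vcReceive E s src msg).eval ans =
      (((finishVC E (vcReact ans E s src msg).1.1).1,
        (vcReact ans E s src msg).1.2 ++ (finishVC E (vcReact ans E s src msg).1.1).2),
        (vcReact ans E s src msg).2) := by
  unfold vcReceive vcReact
  cases src <;> cases msg <;> simp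

theorem atMostOne_onEndorse (E : VCEnv P) (s : VCNode P) (j : Fin P.Nv) (ℓ : Fin P.n) (c : Code) :
    (onEndorse E s j ℓ c).AtMostOne := by
  unfold onEndorse
  dsimp only
  split_ifs
  · exact fun r => ⟨_, rfl⟩
  · trivial

theorem atMostOne_vcReceive (E : VCEnv P) (s : VCNode P) (src : Party P) (msg : Msg P) :
    (vcReceive E s src msg).AtMostOne := by
  unfold vcReceive
  cases src <;> cases msg <;> first
    | trivial
    | exact (atMostOne_onEndorse E s _ _ _).bind_pure
        (fun r => ((finishVC E r.1).1, r.2 ++ (finishVC E r.1).2))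

theorem atMostOne_receive (I : Instance P) (st : State P) (e : Envelope P) :
    (receive I st e).AtMostOne := by
  unfold receive
  split_ifs
  · trivial
  · cases e.dst with
    | vc i =>
      exact (atMostOne_vcReceive (I.env i) (st.vc i) e.src e.msg).bind_pure
        fun r => ({ st with vc := Function.update st.vc i r.1 }, r.2)
    | _ => trivial

theorem atMostOne_applyAction (I : Instance P) (st : State P) (a : Action P) :
    (applyAction I st a).AtMostOne := by
  unfold applyAction
  cases a <;> dsimp only
  case deliver k => split; exacts [atMostOne_receive _ _ _, trivial]
  case inject e => split_ifs; exacts [atMostOne_receive _ _ _, trivial]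
  all_goals first | trivial | (split_ifs <;> trivial)

/-- State and observation after a move. -/
def finishMove (I : Instance P) (a : Action P) (r : State P × List (Envelope P)) :
    State P × Obs P :=
  let st' := { r.1 with log := r.1.log ++ r.2 }
  (st',
    { sent := r.2
      board := fun b => ((st'.bb b).final, (st'.bb b).key, (st'.bb b).result)
      opinions := fun i ℓ => ((st'.vc i).ballot ℓ).proposal
      revealed := match a with
        | .corrupt ℓ =>
          some (fun X o => (I.su.code ℓ (X, o), I.su.receipt ℓ X o), I.su.part ℓ, I.su.order ℓ)
        | _ => none })

theorem step_eq (I : Instance P) (st : State P) (a : Action P) :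
    step I st a = applyAction I st a >>= fun r => pure (finishMove I a r) := rfl

theorem atMostOne_step (I : Instance P) (st : State P) (a : Action P) :
    (step I st a).AtMostOne := by
  rw [step_eq]
  exact (atMostOne_applyAction I st a).bind_pure _

/-- The execution in which the requests of the successive moves get the given replies, with the
list of these requests. -/
noncomputable def playWith (I : Instance P) (act : List (Obs P) → Action P) :
    List (SigQuery P.Nv → Bits) → State P → List (Obs P) → State P × List (SigQuery P.Nv)
  | [], st, _ => (st, [])
  | ans :: t, st, past =>
    let x := (step I st (act past)).eval ans
    let y := playWith I act t x.1.1 (past ++ [x.1.2])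
    (y.1, x.2 ++ y.2)

/-- `T` independent draws. -/
noncomputable def draws {α : Type} (p : PMF α) : ℕ → PMF (List α)
  | 0 => PMF.pure []
  | T + 1 => p.bind fun a => (draws p T).map fun l => a :: l

/-- Each move makes at most one request, so one string of coins per move suffices. This turns the
random execution into the deterministic `playWith` applied to a tape that is independent of the
setup. -/
theorem run_play (S : SignatureScheme) (k : ℕ) (keys : Fin P.Nv → Bits × Bits) (I : Instance P)
    (act : List (Obs P) → Action P) (T : ℕ) (st : State P) (past : List (Obs P)) :
    (play I act T st past).run S k keys =
      (draws (PMF.uniformOfFintype (Fin (S.signLen k) → Bool)) T).map fun l =>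
        playWith I act (l.map (reply S k keys)) st past := by
  induction T generalizing st past with
  | zero =>
    simp only [play, draws, PMF.pure_map]
    rfl
  | succ T ih =>
    simp only [play, run_bind, (atMostOne_step I st _).run_eq, ih, draws, PMF.bind_map,
      PMF.map_bind, PMF.map_comp]
    rfl

/-- The start of the experiment. -/
noncomputable def initView (su : Setup P) (C : Corruption P) (keys : Fin P.Nv → Bits × Bits) :
    InitView P where
  pk i := (keys i).1
  sk i := if i ∈ C.vc then some (keys i).2 else none
  vcData i := if i ∈ C.vc then some (su.vcData i) else none
  trusteeData t := if t ∈ C.trustee then some (su.trusteeData t) else none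
  bbData := su.bbData

/-- The list `l0` of key requests is kept because freshness of a forgery refers to the whole log: no
secret key of an honest vote collector occurs in it. -/
theorem run_experiment (S : SignatureScheme) (k : ℕ) (keys : Fin P.Nv → Bits × Bits)
    (su : Setup P) (C : Corruption P)
    (act : InitView P → List (Obs P) → Action P) (T : ℕ) :
    ∃ l0 : List (SigQuery P.Nv), (∀ q ∈ l0, ∃ i, q = .pubKey i ∨ (i ∈ C.vc ∧ q = .secKey i)) ∧
    (experiment (S.verify k) su C act T).run S k keys =
      (draws (PMF.uniformOfFintype (Fin (S.signLen k) → Bool)) T).map fun l =>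
        let y := playWith ⟨su, C, fun i => (keys i).1, S.verify k⟩ (act (initView su C keys))
          (l.map (reply S k keys)) (State.init P) []
        (y.1, l0 ++ y.2) := by
  obtain ⟨l1, hl1, h1⟩ := run_askFin S k keys P.Nv (fun i => some (.pubKey i))
    (by rintro i q hq; cases hq; trivial)
  obtain ⟨l2, hl2, h2⟩ := run_askFin S k keys P.Nv
    (fun i => if i ∈ C.vc then some (.secKey i) else none)
    (by rintro i q hq; split_ifs at hq; cases hq; trivial)
  refine ⟨l1 ++ l2, ?_, ?_⟩
  · intro q hq
    rcases List.mem_append.1 hq with hq | hq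
    · obtain ⟨i, hi⟩ := hl1 q hq
      exact ⟨i, .inl (Option.some.inj hi).symm⟩
    · obtain ⟨i, hi⟩ := hl2 q hq
      split_ifs at hi with hc
      exact ⟨i, .inr ⟨hc, (Option.some.inj hi).symm⟩⟩
  · have hsk : (fun i => (if i ∈ C.vc then some (SigQuery.secKey i) else none).map
        (keyReply keys)) = fun i => if i ∈ C.vc then some (keys i).2 else none := by
      funext i; split_ifs <;> rfl
    unfold experiment
    rw [run_bind, h1, PMF.pure_bind, run_bind, h2, PMF.pure_bind, hsk]
    dsimp only
    rw [run_play, PMF.map_comp, PMF.map_comp]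
    simp only [Option.map_some, Option.getD_some, keyReply]
    congr 1
    funext l
    simp only [Function.comp, List.append_assoc]
    rfl

end
end DDemos

namespace DDemos

/-! ### Invariants of a vote collector -/

section
open scoped Classical

variable {P : Params}

/-- What is known about an execution: the signatures that are accounted for, the vote collectors
(corrupted or not) that may have disclosed a receipt share or announced that a ballot is unused,
the parties that may have posted a vote code, the opinions entered into consensus. -/
structure Facts (P : Params) where
  auth : Fin P.n → Code → Fin P.Nv → Bits → Prop
  disclosed : Fin P.Nv → Fin P.n → Code → Prop
  annNone : Fin P.Nv → Fin P.n → Prop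
  client : Party P → Fin P.n → Code → Prop
  proposed : Fin P.n → Bool → Prop

def Facts.certOK (K : Facts P) (ℓ : Fin P.n) (c : Code) (u : UCert P) : Prop :=
  ∀ j σ, u j = some σ → K.auth ℓ c j σ

/-- Knowledge only grows. A handler can therefore be analysed with the facts before the move, and
its conclusions carried over to the facts after it. -/
structure Facts.Le (K K' : Facts P) : Prop where
  auth : ∀ ℓ c j σ, K.auth ℓ c j σ → K'.auth ℓ c j σ
  disclosed : ∀ j ℓ c, K.disclosed j ℓ c → K'.disclosed j ℓ c
  annNone : ∀ j ℓ, K.annNone j ℓ → K'.annNone j ℓ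
  client : ∀ X ℓ c, K.client X ℓ c → K'.client X ℓ c
  proposed : ∀ ℓ d, K.proposed ℓ d → K'.proposed ℓ d

theorem Facts.Le.certOK {K K' : Facts P} (h : K.Le K') {ℓ : Fin P.n} {c : Code} {u : UCert P}
    (hu : K.certOK ℓ c u) : K'.certOK ℓ c u := fun j σ hj => h.auth _ _ _ _ (hu j σ hj)

/-- The clause `heard` makes the opinion `false` informative: it forces every announcer counted to
be corrupted or to have announced no code. The clause `shares` traces each stored share to a
disclosure for the code in use, so that a reconstructed receipt witnesses `Nv - fv` disclosures. -/
structure BallotInv (K : Facts P) (E : VCEnv P) (ℓ : Fin P.n) (b : VCBallot P) : Prop where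
  clients : ∀ x ∈ b.clients, K.client x.2 ℓ x.1
  sigs : ∀ c, K.certOK ℓ c (b.sigs c)
  used : ∀ c u, b.used = some (c, u) →
    K.certOK ℓ c u ∧ (E.findLine ℓ c).isSome = true ∧ E.validCert ℓ c u
  shares : ∀ j, (b.shares j).isSome = true → ∃ c u, b.used = some (c, u) ∧ K.disclosed j ℓ c
  receipt : b.receipt ≠ none →
    P.Nv - P.fv ≤ (Finset.univ.filter fun j => (b.shares j).isSome = true).card
  heard : ∀ j ∈ b.heard, K.annNone j ℓ ∨ (b.used ≠ none ∧ b.proposal ≠ some false)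
  proposal : b.proposal ≠ none → P.Nv - P.fv ≤ b.heard.card
  decision : ∀ d, b.decision = some d → K.proposed ℓ d

theorem BallotInv.mono {K K' : Facts P} (h : K.Le K') {E : VCEnv P} {ℓ : Fin P.n}
    {b : VCBallot P} (hb : BallotInv K E ℓ b) : BallotInv K' E ℓ b where
  clients x hx := h.client _ _ _ (hb.clients x hx)
  sigs c := h.certOK (hb.sigs c)
  used c u hu := let ⟨h1, h2⟩ := hb.used c u hu; ⟨h.certOK h1, h2⟩
  shares j hj := let ⟨c, u, h1, h2⟩ := hb.shares j hj; ⟨c, u, h1, h.disclosed _ _ _ h2⟩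
  receipt := hb.receipt
  heard j hj := (hb.heard j hj).imp (h.annNone _ _) id
  proposal := hb.proposal
  decision d hd := h.proposed _ _ (hb.decision d hd)

/-- These fields are written once. Permanence of `endorsed` is what gives each honest node one
endorsement per ballot over the whole run. -/
structure BallotLe (b b' : VCBallot P) : Prop where
  endorsed : ∀ c, b.endorsed = some c → b'.endorsed = some c
  used : ∀ x, b.used = some x → b'.used = some x
  receipt : b.receipt ≠ none → b'.receipt ≠ none
  decision : ∀ d, b.decision = some d → b'.decision = some d
  proposal : ∀ d, b.proposal = some d → b'.proposal = some d

theorem BallotLe.refl (b : VCBallot P) : BallotLe b b :=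
  ⟨fun _ h => h, fun _ h => h, fun h => h, fun _ h => h, fun _ h => h⟩

theorem BallotLe.trans {b b' b'' : VCBallot P} (h : BallotLe b b') (h' : BallotLe b' b'') :
    BallotLe b b'' :=
  ⟨fun _ k => h'.endorsed _ (h.endorsed _ k), fun _ k => h'.used _ (h.used _ k),
    fun k => h'.receipt (h.receipt k), fun _ k => h'.decision _ (h.decision _ k),
    fun _ k => h'.proposal _ (h.proposal _ k)⟩

def NodeInv (K : Facts P) (E : VCEnv P) (s : VCNode P) : Prop :=
  ∀ ℓ, BallotInv K E ℓ (s.ballot ℓ)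

structure NodeLe (s s' : VCNode P) : Prop where
  clock : s.clock ≤ s'.clock
  ballot : ∀ ℓ, BallotLe (s.ballot ℓ) (s'.ballot ℓ)

theorem NodeLe.refl (s : VCNode P) : NodeLe s s := ⟨le_rfl, fun _ => .refl _⟩

theorem NodeLe.trans {s s' s'' : VCNode P} (h : NodeLe s s') (h' : NodeLe s' s'') :
    NodeLe s s'' := ⟨h.clock.trans h'.clock, fun ℓ => (h.ballot ℓ).trans (h'.ballot ℓ)⟩

theorem NodeInv.setBallot {K : Facts P} {E : VCEnv P} {s : VCNode P} (hs : NodeInv K E s)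
    {ℓ : Fin P.n} {b : VCBallot P} (hb : BallotInv K E ℓ b) : NodeInv K E (s.setBallot ℓ b) := by
  intro ℓ'
  by_cases h : ℓ' = ℓ
  · subst h; simpa [VCNode.setBallot] using hb
  · simpa [VCNode.setBallot, h] using hs ℓ'

theorem NodeLe.setBallot {s : VCNode P} {ℓ : Fin P.n} {b : VCBallot P}
    (hb : BallotLe (s.ballot ℓ) b) : NodeLe s (s.setBallot ℓ b) := by
  refine ⟨le_rfl, fun ℓ' => ?_⟩
  by_cases h : ℓ' = ℓ
  · subst h; simpa [VCNode.setBallot] using hb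
  · simpa [VCNode.setBallot, h] using BallotLe.refl _

@[simp] theorem setBallot_ballot (s : VCNode P) (ℓ : Fin P.n) (b : VCBallot P) :
    (s.setBallot ℓ b).ballot ℓ = b := by simp [VCNode.setBallot]

/-- A message that a vote collector in state `s` may have sent to `dst`. -/
def SentOK (K : Facts P) (E : VCEnv P) (s : VCNode P) (dst : Party P) : Msg P → Prop
  | .voteP ℓ c _ u => K.certOK ℓ c u ∧ ∃ u', (s.ballot ℓ).used = some (c, u')
  | .announce ℓ v => P.Tend ≤ s.clock ∧ ∀ c u, v = some (c, u) →
      K.certOK ℓ c u ∧ (E.findLine ℓ c).isSome = true ∧ E.validCert ℓ c u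
  | .recoverResponse ℓ c u => K.certOK ℓ c u
  | .endorsement ℓ c _ => (s.ballot ℓ).endorsed = some c
  | .receipt ℓ _ => ∃ c u, (s.ballot ℓ).used = some (c, u) ∧ K.client dst ℓ c ∧
      (s.ballot ℓ).receipt ≠ none
  | .voteSet V => ∀ ℓ, (s.ballot ℓ).decision ≠ none ∧ ((s.ballot ℓ).decision = some true →
      ∃ c u, (s.ballot ℓ).used = some (c, u) ∧ ∀ c', (ℓ, c') ∈ V ↔ c' = c)
  | _ => True

/-- A message that a vote collector may just have sent. -/
def FreshOK (s : VCNode P) : Msg P → Prop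
  | .voteP _ _ _ _ => s.clock < P.Tend
  | .announce ℓ v => (s.ballot ℓ).used = v
  | _ => True

/-- All clauses concern fields that never revert. `FreshOK` is kept apart because it is not stable:
the clock may pass the end time, and an unused ballot may become used. -/
theorem SentOK.mono {K K' : Facts P} (h : K.Le K') {E : VCEnv P} {s s' : VCNode P} (hs : NodeLe s s')
    {dst : Party P} {msg : Msg P} (hm : SentOK K E s dst msg) :
    SentOK K' E s' dst msg := by
  cases msg <;> try exact hm
  case voteP ℓ c sh u =>
    obtain ⟨h1, u', h2⟩ := hm
    exact ⟨h.certOK h1, u', (hs.ballot ℓ).used _ h2⟩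
  case announce ℓ v => exact ⟨hm.1.trans hs.clock, fun c u hv =>
    ⟨h.certOK (hm.2 c u hv).1, (hm.2 c u hv).2⟩⟩
  case recoverResponse ℓ c u => exact h.certOK hm
  case endorsement ℓ c σ => exact (hs.ballot ℓ).endorsed _ hm
  case receipt ℓ r =>
    obtain ⟨c, u, h1, h2, h3⟩ := hm
    exact ⟨c, u, (hs.ballot ℓ).used _ h1, h.client _ _ _ h2, (hs.ballot ℓ).receipt h3⟩
  case voteSet V =>
    intro ℓ
    obtain ⟨h1, h2⟩ := hm ℓ
    obtain ⟨d, hd⟩ := Option.ne_none_iff_exists'.1 h1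
    have hd' := (hs.ballot ℓ).decision _ hd
    refine ⟨by simp [hd'], fun ht => ?_⟩
    obtain ⟨c, u, h3, h4⟩ := h2 (by rw [hd, ← hd', ht])
    exact ⟨c, u, (hs.ballot ℓ).used _ h3, h4⟩

/-- What is known of a message that reaches a vote collector. -/
def MsgOK (K : Facts P) (E : VCEnv P) : Party P → Msg P → Prop
  | X, .vote ℓ c => K.client X ℓ c
  | .vc j, .endorsement ℓ c σ => K.auth ℓ c j σ
  | .vc j, .voteP ℓ c _ u => K.certOK ℓ c u ∧ K.disclosed j ℓ c
  | .vc j, .announce ℓ v => (v = none → K.annNone j ℓ) ∧ ∀ c u, v = some (c, u) →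
      K.certOK ℓ c u ∧ (K.annNone j ℓ ∨ (E.findLine ℓ c).isSome = true ∧ E.validCert ℓ c u)
  | .vc _, .recoverResponse ℓ c u => K.certOK ℓ c u
  | _, _ => True

/-- The new state of a vote collector and the messages it sends. -/
structure Handled (K : Facts P) (E : VCEnv P) (s : VCNode P)
    (r : VCNode P × List (Envelope P)) : Prop where
  le : NodeLe s r.1
  inv : NodeInv K E r.1
  out : ∀ e ∈ r.2, e.src = .vc E.me ∧ SentOK K E r.1 e.dst e.msg ∧ FreshOK r.1 e.msg

theorem Handled.nil {K : Facts P} {E : VCEnv P} {s s' : VCNode P} (h : NodeLe s s')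
    (h' : NodeInv K E s') : Handled K E s (s', []) := ⟨h, h', by simp⟩

theorem mem_toAllVC {src : Party P} {msg : Msg P} {e : Envelope P} (h : e ∈ toAllVC src msg) :
    e.src = src ∧ e.msg = msg := by
  simp only [toAllVC, List.mem_map] at h
  obtain ⟨j, -, rfl⟩ := h
  exact ⟨rfl, rfl⟩

theorem mem_toAllBB {src : Party P} {msg : Msg P} {e : Envelope P} (h : e ∈ toAllBB src msg) :
    e.src = src ∧ e.msg = msg := by
  simp only [toAllBB, List.mem_map] at h
  obtain ⟨j, -, rfl⟩ := h
  exact ⟨rfl, rfl⟩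

/-! ### The handlers of a vote collector preserve its invariants. -/

variable {K : Facts P} {E : VCEnv P} {s : VCNode P}

theorem handled_onVote (hs : NodeInv K E s) {src : Party P} {ℓ : Fin P.n} {c : Code}
    (hm : K.client src ℓ c) : Handled K E s (onVote E s src ℓ c) := by
  have hb := hs ℓ
  unfold onVote
  dsimp only
  by_cases h1 : s.clock < P.Tend
  · rw [if_pos h1]
    split
    · by_cases h2 : (E.findLine ℓ c).isSome = true
      · rw [if_pos h2]
        refine ⟨.setBallot ⟨fun _ h => h, fun _ h => h, fun h => h, fun _ h => h, fun _ h => h⟩,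
          hs.setBallot { hb with clients := ?_ }, fun e he => ?_⟩
        · intro x hx
          rcases List.mem_cons.1 hx with rfl | hx
          exacts [hm, hb.clients x hx]
        · obtain ⟨h3, h4⟩ := mem_toAllVC he
          rw [h4]; exact ⟨h3, trivial, trivial⟩
      · rw [if_neg h2]; exact .nil (.refl _) hs
    · rename_i c' u r hu hr
      refine ⟨.refl _, hs, fun e he => ?_⟩
      dsimp only at he
      split_ifs at he with hc
      · obtain rfl := List.mem_singleton.1 he
        subst hc
        exact ⟨rfl, ⟨c, u, hu, hm, by simp [hr]⟩, trivial⟩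
      · simp at he
    · exact .nil (.refl _) hs
  · rw [if_neg h1]; exact .nil (.refl _) hs

theorem handled_onEndorse (ans : SigQuery P.Nv → Bits) (hs : NodeInv K E s) (j : Fin P.Nv)
    (ℓ : Fin P.n) (c : Code) :
    Handled K E s ((onEndorse E s j ℓ c).eval ans).1 ∧
    ∀ q ∈ ((onEndorse E s j ℓ c).eval ans).2, ∃ ℓ' c', q = .sign E.me (signedMsg ℓ' c') ∧
      (((onEndorse E s j ℓ c).eval ans).1.1.ballot ℓ').endorsed = some c' := by
  have hb := hs ℓ
  unfold onEndorse
  dsimp only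
  split_ifs with h1
  · refine ⟨⟨.setBallot ⟨?_, fun _ h => h, fun h => h, fun _ h => h, fun _ h => h⟩,
      hs.setBallot { hb with }, ?_⟩, ?_⟩
    · intro c' hc'
      rcases h1.2 with h | h
      · rw [h] at hc'; cases hc'
      · rw [← h, hc']
    · intro e he
      obtain rfl := List.mem_singleton.1 he
      exact ⟨rfl, by simp [SentOK], trivial⟩
    · intro q hq
      obtain rfl := List.mem_singleton.1 hq
      exact ⟨ℓ, c, rfl, by simp⟩
  · exact ⟨.nil (.refl _) hs, by simp⟩

/-- While no code is in use no share can be stored, and every announcer heard so far falls under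
`annNone`. Nothing recorded earlier can thus conflict with the new code. -/
theorem BallotInv.use (hb : BallotInv K E ℓ b) {c : Code} {u : UCert P} (hn : b.used = none)
    (hu : K.certOK ℓ c u) (hl : (E.findLine ℓ c).isSome = true) (hv : E.validCert ℓ c u) :
    BallotInv K E ℓ { b with used := some (c, u) } :=
  { hb with
    used := by
      rintro c' u' h
      simp only [Option.some.injEq, Prod.mk.injEq] at h
      obtain ⟨rfl, rfl⟩ := h
      exact ⟨hu, hl, hv⟩
    shares := by
      intro j hj
      obtain ⟨c', u', h, -⟩ := hb.shares j hj
      rw [hn] at h; cases h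
    heard := by
      intro j hj
      rcases hb.heard j hj with h | h
      · exact .inl h
      · exact (h.1 hn).elim }

theorem handled_onEndorsement (hs : NodeInv K E s) {j : Fin P.Nv} {ℓ : Fin P.n} {c : Code}
    {σ : Bits} (hm : K.auth ℓ c j σ) : Handled K E s (onEndorsement E s j ℓ c σ) := by
  have hb := hs ℓ
  unfold onEndorsement
  dsimp only
  by_cases h1 : s.clock < P.Tend ∧ (s.ballot ℓ).used = none ∧
      (∃ x ∈ (s.ballot ℓ).clients, x.1 = c) ∧ E.ver (E.pk j) (signedMsg ℓ c) σ = true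
  swap
  · rw [if_neg h1]; exact .nil (.refl _) hs
  · rw [if_pos h1]
    -- Entry `j` is accounted for by the incoming endorsement, the others by the signatures
    -- collected before.
    have hcert : K.certOK ℓ c (Function.update ((s.ballot ℓ).sigs c) j (some σ)) := by
      intro i τ hi
      by_cases h : i = j
      · subst h
        simp only [Function.update_self, Option.some.injEq] at hi
        rw [← hi]; exact hm
      · rw [Function.update_of_ne h] at hi
        exact hb.sigs c i τ hi
    have hb' : BallotInv K E ℓ { s.ballot ℓ with
        sigs := Function.update (s.ballot ℓ).sigs c
          (Function.update ((s.ballot ℓ).sigs c) j (some σ)) } :=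
      { hb with
        sigs := by
          intro c'
          by_cases h : c' = c
          · subst h
            simpa using hcert
          · simpa [Function.update_of_ne h] using hb.sigs c' }
    split
    · rename_i l hl
      by_cases h2 : E.validCert ℓ c (Function.update ((s.ballot ℓ).sigs c) j (some σ))
      · rw [if_pos h2]
        refine ⟨.setBallot ⟨fun _ h => h, ?_, fun h => h, fun _ h => h, fun _ h => h⟩,
          hs.setBallot (hb'.use h1.2.1 hcert (by simp [hl]) h2), fun e he => ?_⟩
        · intro x hx
          rw [h1.2.1] at hx; cases hx
        · obtain ⟨h3, h4⟩ := mem_toAllVC he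
          rw [h4]
          refine ⟨h3, ⟨hcert, ?_⟩, h1.1⟩
          simp
      · rw [if_neg h2]
        exact .nil (.setBallot ⟨fun _ h => h, fun _ h => h, fun h => h, fun _ h => h,
          fun _ h => h⟩) (hs.setBallot hb')
    · exact .nil (.setBallot ⟨fun _ h => h, fun _ h => h, fun h => h, fun _ h => h,
          fun _ h => h⟩) (hs.setBallot hb')

theorem tryReceipt_spec {ℓ : Fin P.n} {c : Code} {b : VCBallot P}
    (hb : BallotInv K E ℓ b) :
    BallotLe b (tryReceipt E ℓ c b).1 ∧ BallotInv K E ℓ (tryReceipt E ℓ c b).1 ∧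
    (tryReceipt E ℓ c b).1.used = b.used ∧
    ∀ e ∈ (tryReceipt E ℓ c b).2, e.src = .vc E.me ∧ (∃ r, e.msg = .receipt ℓ r) ∧
      K.client e.dst ℓ c ∧ (tryReceipt E ℓ c b).1.receipt ≠ none := by
  unfold tryReceipt
  split_ifs with h
  · refine ⟨⟨fun _ h => h, fun _ h => h, fun h => by simp, fun _ h => h, fun _ h => h⟩,
      { hb with receipt := fun _ => h.2 }, rfl, fun e he => ?_⟩
    simp only [List.mem_map, List.mem_filter] at he
    obtain ⟨x, ⟨hx, hc⟩, rfl⟩ := he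
    have := hb.clients x hx
    rw [of_decide_eq_true hc] at this
    exact ⟨rfl, ⟨_, rfl⟩, this, by simp⟩
  · exact ⟨.refl _, hb, rfl, by simp⟩

theorem BallotInv.addShare {ℓ : Fin P.n} {b : VCBallot P} (hb : BallotInv K E ℓ b) {c : Code}
    {u : UCert P} (hu : b.used = some (c, u)) {j : Fin P.Nv} (hj : K.disclosed j ℓ c)
    (sh : P.receiptVSS.Share) :
    BallotInv K E ℓ { b with shares := Function.update b.shares j (some sh) } :=
  { hb with
    shares := by
      intro i hi
      by_cases h : i = j
      · subst h; exact ⟨c, u, hu, hj⟩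
      · simp only [Function.update_of_ne h] at hi
        exact hb.shares i hi
    receipt := by
      intro h
      refine (hb.receipt h).trans (Finset.card_le_card fun i hi => ?_)
      simp only [Finset.mem_filter, Finset.mem_univ, true_and] at hi ⊢
      by_cases h : i = j
      · subst h; simp
      · simpa [Function.update_of_ne h] using hi }

theorem handled_onVoteP (hs : NodeInv K E s) {j : Fin P.Nv} {ℓ : Fin P.n} {c : Code}
    {sh : P.receiptVSS.Share} {u : UCert P} (hm : K.certOK ℓ c u ∧ K.disclosed j ℓ c) :
    Handled K E s (onVoteP E s j ℓ c sh u) := by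
  have hb := hs ℓ
  unfold onVoteP
  dsimp only
  split
  · exact .nil (.refl _) hs
  · rename_i l hl
    split_ifs with h1
    · split
      · rename_i hn
        have hb' := (hb.use hn hm.1 (by simp [hl]) h1.2.1).addShare rfl hm.2 sh
        obtain ⟨h2, h3, h4, h5⟩ := tryReceipt_spec (c := c) hb'
        refine ⟨.setBallot (BallotLe.trans (b' := { s.ballot ℓ with used := some (c, u), shares := _ })
          ⟨fun _ h => h, ?_, fun h => h, fun _ h => h, fun _ h => h⟩ h2),
          hs.setBallot h3, fun e he => ?_⟩
        · intro x hx
          rw [hn] at hx; cases hx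
        · rcases List.mem_append.1 he with he | he
          · obtain ⟨h6, h7⟩ := mem_toAllVC he
            rw [h7]
            refine ⟨h6, ⟨hm.1, u, ?_⟩, h1.1⟩
            simp only [setBallot_ballot]
            exact h4
          · obtain ⟨h6, ⟨r, h7⟩, h8, h9⟩ := h5 e he
            rw [h7]
            refine ⟨h6, ⟨c, u, ?_, h8, ?_⟩, trivial⟩
            · simp only [setBallot_ballot]; exact h4
            · simp only [setBallot_ballot]; exact h9
      · rename_i c' u' hu
        split_ifs with hc
        · subst hc
          have hb' := hb.addShare hu hm.2 sh
          obtain ⟨h2, h3, h4, h5⟩ := tryReceipt_spec (c := c) hb'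
          refine ⟨.setBallot (BallotLe.trans
            (b' := { s.ballot ℓ with shares := Function.update (s.ballot ℓ).shares j (some sh) })
            ⟨fun _ h => h, fun _ h => h, fun h => h, fun _ h => h, fun _ h => h⟩ h2), hs.setBallot h3, fun e he => ?_⟩
          obtain ⟨h6, ⟨r, h7⟩, h8, h9⟩ := h5 e he
          rw [h7]
          refine ⟨h6, ⟨c, u', ?_, h8, ?_⟩, trivial⟩
          · simp only [setBallot_ballot]; exact h4.trans hu
          · simp only [setBallot_ballot]; exact h9
        · exact .nil (.refl _) hs
    · exact .nil (.refl _) hs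

/-- The vote code known for a ballot after an announcement. -/
noncomputable def adopt (E : VCEnv P) (ℓ : Fin P.n) :
    Option (Code × UCert P) → Option (Code × UCert P) → Option (Code × UCert P)
  | none, some (c, u) =>
    if (E.findLine ℓ c).isSome = true ∧ E.validCert ℓ c u then some (c, u) else none
  | old, _ => old

theorem onAnnounce_eq (E : VCEnv P) (s : VCNode P) (j : Fin P.Nv) (ℓ : Fin P.n)
    (v : Option (Code × UCert P)) :
    onAnnounce E s j ℓ v =
      if P.Tend ≤ s.clock ∧ (s.ballot ℓ).proposal = none ∧ j ∉ (s.ballot ℓ).heard then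
        s.setBallot ℓ { s.ballot ℓ with
          heard := insert j (s.ballot ℓ).heard
          used := adopt E ℓ (s.ballot ℓ).used v
          proposal := if P.Nv - P.fv ≤ (insert j (s.ballot ℓ).heard).card then
            some (adopt E ℓ (s.ballot ℓ).used v).isSome else none }
      else s := by
  have h : (match (s.ballot ℓ).used, v with
      | none, some (c, u) =>
        if (E.findLine ℓ c).isSome = true ∧ E.validCert ℓ c u then some (c, u) else none
      | old, _ => old) = adopt E ℓ (s.ballot ℓ).used v := by
    cases (s.ballot ℓ).used <;> cases v <;> rfl
  rw [← h]
  rfl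

theorem handled_onAnnounce (hs : NodeInv K E s) {j : Fin P.Nv} {ℓ : Fin P.n}
    {v : Option (Code × UCert P)}
    (hm : (v = none → K.annNone j ℓ) ∧ ∀ c u, v = some (c, u) →
      K.certOK ℓ c u ∧ (K.annNone j ℓ ∨ (E.findLine ℓ c).isSome = true ∧ E.validCert ℓ c u)) :
    Handled K E s (onAnnounce E s j ℓ v, []) := by
  have hb := hs ℓ
  rw [onAnnounce_eq]
  by_cases h1 : P.Tend ≤ s.clock ∧ (s.ballot ℓ).proposal = none ∧ j ∉ (s.ballot ℓ).heard
  swap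
  · rw [if_neg h1]; exact .nil (.refl _) hs
  rw [if_pos h1]
  generalize hus : adopt E ℓ (s.ballot ℓ).used v = used
  -- A code already in use is never replaced by an announced one.
  have hold : ∀ x, (s.ballot ℓ).used = some x → used = some x := by
    intro x hx
    rw [← hus, hx]; rfl
  have hnew : ∀ c u, used = some (c, u) →
      K.certOK ℓ c u ∧ (E.findLine ℓ c).isSome = true ∧ E.validCert ℓ c u := by
    intro c u hcu
    cases hx : (s.ballot ℓ).used with
    | some x =>
      rw [hold x hx] at hcu
      exact hb.used c u (hx.trans hcu)
    | none =>
      rw [hx] at hus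
      rcases v with _ | ⟨c', u'⟩
      · rw [← hus] at hcu; cases hcu
      · simp only [adopt] at hus
        split_ifs at hus with hc
        · rw [← hus] at hcu
          simp only [Option.some.injEq, Prod.mk.injEq] at hcu
          obtain ⟨rfl, rfl⟩ := hcu
          exact ⟨(hm.2 _ _ rfl).1, hc⟩
        · rw [← hus] at hcu; cases hcu
  -- An announcer outside `annNone` supplies a line of the ballot and a valid certificate, so its
  -- code is adopted unless one is already in use.
  have hj : K.annNone j ℓ ∨ used ≠ none := by
    rcases v with _ | ⟨c', u'⟩
    · exact .inl (hm.1 rfl)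
    · rcases (hm.2 _ _ rfl).2 with h | h
      · exact .inl h
      · right
        cases hx : (s.ballot ℓ).used with
        | some x => rw [hold x hx]; simp
        | none =>
          rw [hx] at hus
          simp only [adopt] at hus
          rw [if_pos h] at hus
          rw [← hus]; simp
  refine .nil (.setBallot ⟨fun _ h => h, hold, fun h => h, fun _ h => h, ?_⟩)
    (hs.setBallot { hb with used := hnew, shares := ?_, heard := ?_, proposal := ?_ })
  · intro d hd
    rw [h1.2.1] at hd; cases hd
  · intro i hi
    obtain ⟨c, u, h2, h3⟩ := hb.shares i hi
    exact ⟨c, u, hold _ h2, h3⟩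
  · intro i hi
    have h2 : K.annNone i ℓ ∨ used ≠ none := by
      rcases Finset.mem_insert.1 hi with rfl | hi
      · exact hj
      · refine (hb.heard i hi).imp id fun h => ?_
        obtain ⟨x, hx⟩ := Option.ne_none_iff_exists'.1 h.1
        rw [hold x hx]; simp
    -- With a code in use, the new opinion is `some true` or still undetermined.
    refine h2.imp id fun h => ⟨h, ?_⟩
    dsimp only
    obtain ⟨x, rfl⟩ := Option.ne_none_iff_exists'.1 h
    split_ifs <;> simp
  · intro h
    dsimp only at h ⊢
    by_contra hc
    rw [if_neg hc] at h
    exact h rfl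

theorem handled_onRecoverRequest (hs : NodeInv K E s) (j : Fin P.Nv) (ℓ : Fin P.n) :
    Handled K E s (s, onRecoverRequest E s j ℓ) := by
  refine ⟨.refl _, hs, fun e he => ?_⟩
  unfold onRecoverRequest at he
  dsimp only at he
  split at he
  · rename_i c u hu
    split_ifs at he
    · obtain rfl := List.mem_singleton.1 he
      exact ⟨rfl, ((hs ℓ).used c u hu).1, trivial⟩
    · simp at he
  · simp at he

theorem handled_onRecoverResponse (hs : NodeInv K E s) {ℓ : Fin P.n} {c : Code} {u : UCert P}
    (hm : K.certOK ℓ c u) : Handled K E s (onRecoverResponse E s ℓ c u, []) := by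
  have hb := hs ℓ
  unfold onRecoverResponse
  dsimp only
  split_ifs with h
  · refine .nil (.setBallot ⟨fun _ h => h, ?_, fun h => h, fun _ h => h, fun _ h => h⟩)
      (hs.setBallot (hb.use h.2.1 hm h.2.2.1 h.2.2.2))
    intro x hx
    rw [h.2.1] at hx; cases hx
  · exact .nil (.refl _) hs

theorem handled_finishVC (hs : NodeInv K E s) : Handled K E s (finishVC E s) := by
  unfold finishVC
  split_ifs with h
  · refine ⟨⟨le_rfl, fun _ => .refl _⟩, hs, fun e he => ?_⟩
    dsimp only at he
    rcases List.mem_append.1 he with he | he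
    · obtain ⟨h1, h2⟩ := mem_toAllBB he
      rw [h2]
      refine ⟨h1, fun ℓ => ⟨?_, fun ht => ?_⟩, trivial⟩
      · rcases h.2.2 ℓ with h | h <;> simp [h]
      -- Since `used` holds a single pair, the submitted set contains exactly one code for a ballot
      -- decided as voted.
      · dsimp only at ht ⊢
        rcases h.2.2 ℓ with h3 | h3
        · rw [h3] at ht; cases ht
        · obtain ⟨⟨c, u⟩, hu⟩ := Option.ne_none_iff_exists'.1 h3.2
          refine ⟨c, u, hu, fun c' => ?_⟩
          simp only [Finset.mem_filter, Finset.mem_univ, true_and, ht, hu, Option.some.injEq,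
            Prod.mk.injEq]
          constructor
          · rintro ⟨u, h, -⟩; exact h.symm
          · rintro rfl; exact ⟨u, rfl, rfl⟩
    · obtain ⟨h1, h2⟩ := mem_toAllBB he
      rw [h2]
      exact ⟨h1, trivial, trivial⟩
  · exact .nil (.refl _) hs

theorem finishVC_ballot (E : VCEnv P) (s : VCNode P) :
    (finishVC E s).1.ballot = s.ballot ∧ (finishVC E s).1.clock = s.clock := by
  unfold finishVC
  split_ifs <;> exact ⟨rfl, rfl⟩

theorem FreshOK.congr {s s' : VCNode P} (h : s'.ballot = s.ballot) (h' : s'.clock = s.clock)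
    {msg : Msg P} (hm : FreshOK s msg) : FreshOK s' msg := by
  cases msg <;> try exact hm
  case voteP => exact h'.trans_lt hm
  case announce ℓ v =>
    change (s'.ballot ℓ).used = v
    rw [h]; exact hm

theorem Handled.finish {r : VCNode P × List (Envelope P)} (h : Handled K E s r) :
    Handled K E s ((finishVC E r.1).1, r.2 ++ (finishVC E r.1).2) := by
  have hf := handled_finishVC h.inv
  obtain ⟨hb, hc⟩ := finishVC_ballot E r.1
  refine ⟨h.le.trans hf.le, hf.inv, fun e he => ?_⟩
  rcases List.mem_append.1 he with he | he
  · obtain ⟨h1, h2, h3⟩ := h.out e he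
    exact ⟨h1, h2.mono ⟨fun _ _ _ _ h => h, fun _ _ _ h => h, fun _ _ h => h, fun _ _ _ h => h,
      fun _ _ h => h⟩ hf.le, h3.congr hb hc⟩
  · exact hf.out e he

theorem handled_vcReceive (ans : SigQuery P.Nv → Bits) (hs : NodeInv K E s) {src : Party P}
    {msg : Msg P} (hm : MsgOK K E src msg) :
    Handled K E s ((vcReceive E s src msg).eval ans).1 ∧
    ∀ q ∈ ((vcReceive E s src msg).eval ans).2, ∃ ℓ c, q = .sign E.me (signedMsg ℓ c) ∧
      (((vcReceive E s src msg).eval ans).1.1.ballot ℓ).endorsed = some c := by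
  rw [eval_vcReceive]
  have key : Handled K E s (vcReact ans E s src msg).1 ∧
      ∀ q ∈ (vcReact ans E s src msg).2, ∃ ℓ c, q = .sign E.me (signedMsg ℓ c) ∧
      ((vcReact ans E s src msg).1.1.ballot ℓ).endorsed = some c := by
    unfold vcReact
    split
    · exact ⟨handled_onVote hs (by cases src <;> exact hm), by simp⟩
    · exact handled_onEndorse ans hs _ _ _
    · exact ⟨handled_onEndorsement hs hm, by simp⟩
    · exact ⟨handled_onVoteP hs hm, by simp⟩
    · exact ⟨handled_onAnnounce hs hm, by simp⟩
    · exact ⟨handled_onRecoverRequest hs _ _, by simp⟩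
    · exact ⟨handled_onRecoverResponse hs hm, by simp⟩
    · exact ⟨.nil (.refl _) hs, by simp⟩
  refine ⟨key.1.finish, fun q hq => ?_⟩
  obtain ⟨ℓ, c, h1, h2⟩ := key.2 q hq
  refine ⟨ℓ, c, h1, ?_⟩
  dsimp only
  rw [(finishVC_ballot E _).1]
  exact h2

theorem handled_vcTick (hs : NodeInv K E s) : Handled K E s (vcTick E s) := by
  refine ⟨⟨Nat.le_succ _, fun _ => .refl _⟩, hs, fun e he => ?_⟩
  unfold vcTick at he ⊢
  dsimp only at he ⊢
  split_ifs at he with h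
  · simp only [List.mem_flatMap] at he
    obtain ⟨ℓ, -, he⟩ := he
    obtain ⟨h1, h2⟩ := mem_toAllVC he
    rw [h2]
    exact ⟨h1, ⟨h.ge, fun c u hu => (hs ℓ).used c u hu⟩, rfl⟩
  · simp at he

theorem handled_vcDecide (hs : NodeInv K E s) {ℓ : Fin P.n} {d : Bool} (hd : K.proposed ℓ d)
    (hn : (s.ballot ℓ).decision = none) : Handled K E s (vcDecide E s ℓ d) := by
  have h0 : Handled K E s (s.setBallot ℓ { s.ballot ℓ with decision := some d },
      if d = true ∧ (s.ballot ℓ).used = none then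
        toAllVC (.vc E.me) (.recoverRequest ℓ) else []) := by
    refine ⟨.setBallot ⟨fun _ h => h, fun _ h => h, fun h => h, ?_, fun _ h => h⟩,
      hs.setBallot { hs ℓ with decision := ?_ }, fun e he => ?_⟩
    · intro x hx
      rw [hn] at hx; cases hx
    · intro d' hd'
      obtain rfl := Option.some.inj hd'
      exact hd
    · dsimp only at he
      split_ifs at he
      · obtain ⟨h1, h2⟩ := mem_toAllVC he
        rw [h2]
        exact ⟨h1, trivial, trivial⟩
      · simp at he
  exact h0.finish

end
end DDemos

namespace DDemos

/-! ### Invariants of the execution -/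

section
open scoped Classical

variable {P : Params}

/-- Vote collector `j` has disclosed a share of the receipt that belongs to vote code `c`. -/
def Disclosed (st : State P) (j : Fin P.Nv) (ℓ : Fin P.n) (c : Code) : Prop :=
  ∃ sh u dst, (⟨.vc j, .voteP ℓ c sh u, dst⟩ : Envelope P) ∈ st.log

/-- Vote collector `j` has announced that it knows no vote code for ballot `ℓ`. -/
def AnnouncedNone (st : State P) (j : Fin P.Nv) (ℓ : Fin P.n) : Prop :=
  ∃ dst, (⟨.vc j, .announce ℓ none, dst⟩ : Envelope P) ∈ st.log

/-- The party may have posted `c` for ballot `ℓ`: honest voters post only their own vote code. -/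
def MayPost (I : Instance P) (st : State P) (X : Party P) (ℓ : Fin P.n) (c : Code) : Prop :=
  ∀ ℓ', X = .voter ℓ' → (st.voter ℓ').corrupted = true ∨
    (ℓ' = ℓ ∧ ∃ o, (st.voter ℓ).choice = some o ∧ c = I.su.code ℓ (I.su.part ℓ, o))

/-- What is known in a state. -/
def facts (I : Instance P) (st : State P) : Facts P where
  auth ℓ c j σ := j ∈ I.C.vc ∨ ((st.vc j).ballot ℓ).endorsed = some c ∨
    (j, signedMsg ℓ c, σ) ∈ candidates st
  disclosed j ℓ c := j ∈ I.C.vc ∨ Disclosed st j ℓ c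
  annNone j ℓ := j ∈ I.C.vc ∨ AnnouncedNone st j ℓ
  client := MayPost I st
  proposed ℓ d := ∃ j, j ∉ I.C.vc ∧ ((st.vc j).ballot ℓ).proposal = some d

/-- Vote collector `j` may have submitted the vote set `V`. -/
def MaySubmit (I : Instance P) (st : State P) (j : Fin P.Nv) (V : VoteSet P) : Prop :=
  j ∈ I.C.vc ∨ ∃ dst, (⟨.vc j, .voteSet V, dst⟩ : Envelope P) ∈ st.log

/-! ### Invariants of a bulletin board node. -/

/-- The published result: the openings of the total, interpolated at `0`. -/
noncomputable def interpolated (valid : Finset (Fin P.Nt)) (T : Fin P.Nt → Fin P.m → Opening P)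
    (j : Fin P.m) : ℕ :=
  ((Lagrange.interpolate valid (fun t => (t.val + 1 : ZMod P.q)) (fun t => (T t j).1)).eval 0).val

/-- Stored shares and the result are tied to the current view. This is consistent because vote set
and key are never overwritten once fixed, so all shares open commitments to one and the same total.
-/
structure BBInv (sub : Fin P.Nv → VoteSet P → Prop) (D : BBData P) (s : BBNode P) : Prop where
  sets : ∀ i V, s.sets i = some V → sub i V
  final : ∀ V, s.final = some V → ∃ T : Finset (Fin P.Nv), P.fv + 1 ≤ T.card ∧ ∀ i ∈ T, sub i V
  key : ∀ κ, s.key = some κ → P.hashKey κ D.mskSalt = D.mskDigest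
  tally : ∀ t T, s.tally t = some T → ∃ V κ, s.view = some (V, κ) ∧ ValidTotal D V κ t T
  result : ∀ x, s.result = some x → ∃ V κ, s.view = some (V, κ) ∧
    ∃ (valid : Finset (Fin P.Nt)) (T : Fin P.Nt → Fin P.m → Opening P), P.ht ≤ valid.card ∧
      (∀ t ∈ valid, ValidTotal D V κ t (T t)) ∧ x = interpolated valid T

theorem BBInv.mono {sub sub' : Fin P.Nv → VoteSet P → Prop} (h : ∀ i V, sub i V → sub' i V)
    {D : BBData P} {s : BBNode P} (hs : BBInv sub D s) : BBInv sub' D s :=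
  { hs with
    sets := fun i V hi => h i V (hs.sets i V hi)
    final := fun V hV => let ⟨T, h1, h2⟩ := hs.final V hV; ⟨T, h1, fun i hi => h i V (h2 i hi)⟩ }

theorem view_eq_some {s : BBNode P} {x : VoteSet P × Key} :
    s.view = some x ↔ s.final = some x.1 ∧ s.key = some x.2 := by
  unfold BBNode.view
  cases s.final <;> cases s.key <;> simp [Prod.ext_iff]

theorem BBInv.receive {sub : Fin P.Nv → VoteSet P → Prop} {D : BBData P} {s : BBNode P}
    (hs : BBInv sub D s) (me : Fin P.Nb) {src : Party P} {msg : Msg P}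
    (hm : ∀ i V, src = .vc i → msg = .voteSet V → sub i V) :
    BBInv sub D (bbReceive D me s src msg).1 := by
  unfold bbReceive
  dsimp only
  by_cases h0 : s.clock < P.Tend
  · rw [if_pos h0]; exact hs
  rw [if_neg h0]
  split
  · rename_i i V
    by_cases h1 : s.sets i = none
    swap
    · rw [if_neg h1]; exact hs
    rw [if_pos h1]
    have hsets : ∀ j W, Function.update s.sets i (some V) j = some W → sub j W := by
      intro j W hj
      by_cases h : j = i
      · subst h
        rw [Function.update_self] at hj
        cases hj
        exact hm _ _ rfl rfl
      · rw [Function.update_of_ne h] at hj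
        exact hs.sets j W hj
    generalize hf : (if s.final = none ∧ P.fv + 1 ≤ (Finset.univ.filter fun j =>
      Function.update s.sets i (some V) j = some V).card then some V else s.final) = fin
    -- An accepted vote set stays, so shares checked against the old view remain valid for the new
    -- one.
    have hold : ∀ W, s.final = some W → fin = some W := by
      intro W hW
      rw [← hf, if_neg (by simp [hW]), hW]
    have hview : ∀ x, s.view = some x → BBNode.view { s with
        sets := Function.update s.sets i (some V), final := fin } = some x := by
      intro x hx
      rw [view_eq_some] at hx ⊢
      exact ⟨hold _ hx.1, hx.2⟩
    refine { hs with sets := hsets, final := ?_, tally := ?_, result := ?_ }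
    · intro W hW
      dsimp only at hW
      rw [← hf] at hW
      split_ifs at hW with hc
      · cases hW
        exact ⟨_, hc.2, fun j hj => hsets j _ (Finset.mem_filter.1 hj).2⟩
      · exact hs.final W hW
    · intro t T ht
      obtain ⟨W, κ, h2, h3⟩ := hs.tally t T ht
      exact ⟨W, κ, hview _ h2, h3⟩
    · intro x hx
      obtain ⟨W, κ, h2, h3⟩ := hs.result x hx
      exact ⟨W, κ, hview _ h2, h3⟩
  · rename_i i sh
    by_cases h1 : P.keyVSS.verify D.mskPub i sh = true
    swap
    · rw [if_neg h1]; exact hs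
    rw [if_pos h1]
    generalize Function.update s.keyShares i (some sh) = shares
    generalize hf : (if s.key = none ∧ P.hashKey (P.keyVSS.recon shares) D.mskSalt = D.mskDigest ∧
      P.Nv - P.fv ≤ (Finset.univ.filter fun j => (shares j).isSome = true).card then
        some (P.keyVSS.recon shares) else s.key) = key
    -- Likewise the first accepted key is final.
    have hold : ∀ W, s.key = some W → key = some W := by
      intro W hW
      rw [← hf, if_neg (by simp [hW]), hW]
    have hview : ∀ x, s.view = some x → BBNode.view { s with
        keyShares := shares, key := key } = some x := by
      intro x hx
      rw [view_eq_some] at hx ⊢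
      exact ⟨hx.1, hold _ hx.2⟩
    refine { hs with key := ?_, tally := ?_, result := ?_ }
    · intro κ hκ
      dsimp only at hκ
      rw [← hf] at hκ
      split_ifs at hκ with hc
      · cases hκ
        exact hc.2.1
      · exact hs.key κ hκ
    · intro t T ht
      obtain ⟨W, κ, h2, h3⟩ := hs.tally t T ht
      exact ⟨W, κ, hview _ h2, h3⟩
    · intro x hx
      obtain ⟨W, κ, h2, h3⟩ := hs.result x hx
      exact ⟨W, κ, hview _ h2, h3⟩
  · rename_i t T
    split
    · exact hs
    · rename_i V κ hv
      by_cases h1 : ValidTotal D V κ t T ∧ s.result = none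
      swap
      · rw [if_neg h1]; exact hs
      rw [if_pos h1]
      have htally : ∀ t' T', Function.update s.tally t (some T) t' = some T' →
          ValidTotal D V κ t' T' := by
        intro t' T' ht
        by_cases h : t' = t
        · subst h
          rw [Function.update_self] at ht
          cases ht
          exact h1.1
        · rw [Function.update_of_ne h] at ht
          obtain ⟨W, κ', h2, h3⟩ := hs.tally _ _ ht
          rw [hv] at h2
          cases h2
          exact h3
      refine { hs with tally := fun t' T' ht => ⟨V, κ, hv, htally t' T' ht⟩, result := ?_ }
      intro x hx
      refine ⟨V, κ, hv, ?_⟩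
      dsimp only at hx
      split_ifs at hx with hc
      cases hx
      -- The default `0` is never used: the interpolation runs over the trustees whose entry is
      -- present.
      refine ⟨_, fun t' => (Function.update s.tally t (some T) t').getD 0, hc,
        fun t' ht' => htally t' _ ?_, rfl⟩
      obtain ⟨T', hT'⟩ := Option.isSome_iff_exists.1 (Finset.mem_filter.1 ht').2
      dsimp only
      rw [hT']; rfl
  · exact hs

theorem mem_bbReceive_src {D : BBData P} {me : Fin P.Nb} {s : BBNode P} {src : Party P}
    {msg : Msg P} {e : Envelope P} (he : e ∈ (bbReceive D me s src msg).2) : e.src = .bb me := by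
  unfold bbReceive at he
  dsimp only at he
  split at he
  · simp only [List.mem_map] at he
    obtain ⟨t, -, rfl⟩ := he
    rfl
  · simp at he

theorem mem_trusteeReceive_src {D : BBData P} {T : TrusteeData P} {me : Fin P.Nt}
    {s : TrusteeNode P} {src : Party P} {msg : Msg P} {e : Envelope P}
    (he : e ∈ (trusteeReceive D T me s src msg).2) : e.src = .trustee me := by
  unfold trusteeReceive at he
  split at he
  · dsimp only at he
    split_ifs at he
    · exact (mem_toAllBB he).1
    · simp at he
  · simp at he

/-! ### Voters -/

/-- The voter keeps her choice, and posts nothing but its vote code. -/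
structure VoterMove (su : Setup P) (ℓ : Fin P.n) (v : Voter P)
    (r : Voter P × List (Envelope P)) : Prop where
  choice : r.1.choice = v.choice
  corrupted : r.1.corrupted = v.corrupted
  out : ∀ e ∈ r.2, e.src = .voter ℓ ∧ ∃ o, v.choice = some o ∧
    e.msg = .vote ℓ (su.code ℓ (su.part ℓ, o))

theorem voterMove_contactNext (su : Setup P) (ℓ : Fin P.n) {o : Fin P.m} {v : Voter P}
    (ho : v.choice = some o) : VoterMove su ℓ v (contactNext su ℓ o v) := by
  unfold contactNext
  split_ifs
  · refine ⟨rfl, rfl, fun e he => ?_⟩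
    obtain rfl := List.mem_singleton.1 he
    exact ⟨rfl, o, ho, rfl⟩
  · exact ⟨rfl, rfl, by simp⟩
  · exact ⟨rfl, rfl, by simp⟩

theorem voterMove_voterReceive (su : Setup P) (ℓ : Fin P.n) (v : Voter P) (src : Party P)
    (msg : Msg P) : VoterMove su ℓ v (voterReceive su ℓ v src msg) := by
  unfold voterReceive
  split
  · rename_i ho
    split_ifs
    · exact ⟨rfl, rfl, by simp⟩
    · exact voterMove_contactNext su ℓ ho
    · exact ⟨rfl, rfl, by simp⟩
  · exact ⟨rfl, rfl, by simp⟩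

theorem voterMove_voterTick (su : Setup P) (ℓ : Fin P.n) (v : Voter P) :
    VoterMove su ℓ v (voterTick su ℓ v) := by
  unfold voterTick
  dsimp only
  split
  · rename_i o ho
    split_ifs
    · have := voterMove_contactNext su ℓ (v := { v with clock := v.clock + 1 }) ho
      exact ⟨this.choice, this.corrupted, this.out⟩
    · exact ⟨rfl, rfl, by simp⟩
  · exact ⟨rfl, rfl, by simp⟩

/-! ### The invariant -/

/-- The clause `excl` is the timing property on which safety rests: disclosing a share and
announcing ignorance of the ballot are incompatible for one vote collector. It compares events on
that node's own clock, so it survives any manipulation of clocks by the adversary. -/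
structure Inv (I : Instance P) (st : State P) : Prop where
  node : ∀ i, NodeInv (facts I st) (I.env i) (st.vc i)
  sent : ∀ e ∈ st.log, ∀ i, e.src = .vc i →
    i ∉ I.C.vc ∧ SentOK (facts I st) (I.env i) (st.vc i) e.dst e.msg
  posted : ∀ e ∈ st.log, ∀ ℓ, e.src = .voter ℓ → ∃ o, (st.voter ℓ).choice = some o ∧
    e.msg = .vote ℓ (I.su.code ℓ (I.su.part ℓ, o))
  excl : ∀ i ℓ c, AnnouncedNone st i ℓ → ¬ Disclosed st i ℓ c
  bb : ∀ b, BBInv (MaySubmit I st) I.su.bbData (st.bb b)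

structure StateLe (st st' : State P) : Prop where
  log : ∀ e ∈ st.log, e ∈ st'.log
  injected : ∀ e ∈ st.injected, e ∈ st'.injected
  vc : ∀ i, NodeLe (st.vc i) (st'.vc i)
  choice : ∀ ℓ o, (st.voter ℓ).choice = some o → (st'.voter ℓ).choice = some o
  corrupted : ∀ ℓ, (st.voter ℓ).corrupted = true → (st'.voter ℓ).corrupted = true

theorem StateLe.refl (st : State P) : StateLe st st :=
  ⟨fun _ h => h, fun _ h => h, fun _ => .refl _, fun _ _ h => h, fun _ h => h⟩

theorem StateLe.disclosed {st st' : State P} (h : StateLe st st') {j : Fin P.Nv} {ℓ : Fin P.n}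
    {c : Code} : Disclosed st j ℓ c → Disclosed st' j ℓ c :=
  fun ⟨sh, u, dst, h1⟩ => ⟨sh, u, dst, h.log _ h1⟩

theorem StateLe.facts {st st' : State P} (h : StateLe st st') (I : Instance P) :
    (facts I st).Le (facts I st') where
  auth ℓ c j σ := by
    refine Or.imp id (Or.imp (((h.vc j).ballot ℓ).endorsed c) fun hx => ?_)
    unfold candidates at hx ⊢
    obtain ⟨e, he, hx⟩ := List.mem_flatMap.1 hx
    exact List.mem_flatMap.2 ⟨e, h.injected e he, hx⟩
  disclosed j ℓ c := Or.imp id h.disclosed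
  annNone j ℓ := Or.imp id fun ⟨dst, h1⟩ => ⟨dst, h.log _ h1⟩
  client X ℓ c hX ℓ' hℓ' := (hX ℓ' hℓ').imp (h.corrupted _) fun ⟨h1, o, h2, h3⟩ =>
    ⟨h1, o, h.choice _ _ h2, h3⟩
  proposed ℓ d := fun ⟨j, h1, h2⟩ => ⟨j, h1, ((h.vc j).ballot ℓ).proposal _ h2⟩

theorem StateLe.maySubmit {st st' : State P} (h : StateLe st st') (I : Instance P)
    {j : Fin P.Nv} {V : VoteSet P} : MaySubmit I st j V → MaySubmit I st' j V :=
  Or.imp id fun ⟨dst, h1⟩ => ⟨dst, h.log _ h1⟩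

/-- The invariant carries over to the state after a move. -/
theorem Inv.move {I : Instance P} {st st' : State P} {out : List (Envelope P)} (hI : Inv I st)
    (hle : StateLe st st') (hlog : st'.log = st.log ++ out)
    (node : ∀ i, NodeInv (facts I st') (I.env i) (st'.vc i))
    (sent : ∀ e ∈ out, ∀ i, e.src = .vc i → i ∉ I.C.vc ∧
      SentOK (facts I st') (I.env i) (st'.vc i) e.dst e.msg ∧ FreshOK (st'.vc i) e.msg)
    (posted : ∀ e ∈ out, ∀ ℓ, e.src = .voter ℓ → ∃ o, (st'.voter ℓ).choice = some o ∧
      e.msg = .vote ℓ (I.su.code ℓ (I.su.part ℓ, o)))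
    (bb : ∀ b, BBInv (MaySubmit I st') I.su.bbData (st'.bb b)) : Inv I st' where
  node := node
  sent e he i hi := by
    rw [hlog] at he
    rcases List.mem_append.1 he with he | he
    · obtain ⟨h1, h2⟩ := hI.sent e he i hi
      exact ⟨h1, h2.mono (hle.facts I) (hle.vc i)⟩
    · obtain ⟨h1, h2, -⟩ := sent e he i hi
      exact ⟨h1, h2⟩
  posted e he ℓ hℓ := by
    rw [hlog] at he
    rcases List.mem_append.1 he with he | he
    · obtain ⟨o, h1, h2⟩ := hI.posted e he ℓ hℓ
      exact ⟨o, hle.choice _ _ h1, h2⟩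
    · exact posted e he ℓ hℓ
  excl := by
    rintro i ℓ c ⟨dst, h1⟩ ⟨sh, u, dst', h2⟩
    rw [hlog] at h1 h2
    -- A new disclosure needs a clock before the end time, an announcement (old or new) a clock at
    -- or after it. An old disclosure has set `used` for good, which a new announcement of `none`
    -- contradicts.
    rcases List.mem_append.1 h1 with h1 | h1 <;> rcases List.mem_append.1 h2 with h2 | h2
    · exact hI.excl i ℓ c ⟨dst, h1⟩ ⟨sh, u, dst', h2⟩
    · obtain ⟨-, h3, -⟩ := hI.sent _ h1 i rfl
      obtain ⟨-, -, h4⟩ := sent _ h2 i rfl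
      exact absurd ((h3.trans (hle.vc i).clock).trans_lt h4) (lt_irrefl _)
    · obtain ⟨-, -, u', h3⟩ := hI.sent _ h2 i rfl
      obtain ⟨-, -, h4⟩ := sent _ h1 i rfl
      have h5 := ((hle.vc i).ballot ℓ).used _ h3
      change ((st'.vc i).ballot ℓ).used = none at h4
      rw [h4] at h5; cases h5
    · obtain ⟨-, -, h3⟩ := sent _ h2 i rfl
      obtain ⟨-, h4, -⟩ := sent _ h1 i rfl
      exact absurd (h4.1.trans_lt h3) (lt_irrefl _)
  bb := bb

/-- The effect of a move: the new state, messages and requests. -/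
structure MoveOK (I : Instance P) (st : State P)
    (x : (State P × List (Envelope P)) × List (SigQuery P.Nv)) : Prop where
  le : StateLe st { x.1.1 with log := x.1.1.log ++ x.1.2 }
  inv : Inv I { x.1.1 with log := x.1.1.log ++ x.1.2 }
  queries : ∀ q ∈ x.2, ∃ i ℓ c, i ∉ I.C.vc ∧ q = .sign i (signedMsg ℓ c) ∧
    ((x.1.1.vc i).ballot ℓ).endorsed = some c

theorem MoveOK.idle {I : Instance P} {st : State P} (hI : Inv I st) :
    MoveOK I st ((st, []), []) := by
  have : ({ st with log := st.log ++ [] } : State P) = st := by simp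
  exact ⟨by simpa [this] using StateLe.refl st, by simpa [this] using hI, by simp⟩

/-- A move of a vote collector. -/
theorem MoveOK.vc {I : Instance P} {st : State P} (hI : Inv I st) {i : Fin P.Nv}
    (hi : i ∉ I.C.vc) {r : VCNode P × List (Envelope P)} {L : List (SigQuery P.Nv)}
    (h : Handled (facts I st) (I.env i) (st.vc i) r)
    (hL : ∀ q ∈ L, ∃ ℓ c, q = .sign i (signedMsg ℓ c) ∧ (r.1.ballot ℓ).endorsed = some c) :
    MoveOK I st (({ st with vc := Function.update st.vc i r.1 }, r.2), L) := by
  have hvc : ∀ j, NodeLe (st.vc j) (Function.update st.vc i r.1 j) := by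
    intro j
    by_cases hj : j = i
    · subst hj; simpa using h.le
    · simpa [Function.update_of_ne hj] using NodeLe.refl _
  have hle : StateLe st { st with vc := Function.update st.vc i r.1, log := st.log ++ r.2 } :=
    ⟨fun e he => List.mem_append_left _ he, fun _ h => h, hvc, fun _ _ h => h, fun _ h => h⟩
  refine ⟨hle, hI.move hle rfl ?_ ?_ ?_ ?_, ?_⟩
  · intro j ℓ
    dsimp only
    by_cases hj : j = i
    · subst hj
      rw [Function.update_self]
      exact (h.inv ℓ).mono (hle.facts I)
    · rw [Function.update_of_ne hj]
      exact (hI.node j ℓ).mono (hle.facts I)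
  · intro e he j hj
    obtain ⟨h1, h2, h3⟩ := h.out e he
    rw [hj] at h1
    obtain rfl : j = i := Party.vc.inj h1
    dsimp only
    rw [Function.update_self]
    exact ⟨hi, h2.mono (hle.facts I) (.refl _), h3⟩
  · intro e he ℓ hℓ
    obtain ⟨h1, -⟩ := h.out e he
    rw [hℓ] at h1; cases h1
  · exact fun b => (hI.bb b).mono fun _ _ => hle.maySubmit I
  · intro q hq
    obtain ⟨ℓ, c, h1, h2⟩ := hL q hq
    exact ⟨i, ℓ, c, hi, h1, by simpa using h2⟩

/-- A move after which the vote collectors are the same. -/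
theorem MoveOK.other {I : Instance P} {st st' : State P} {out : List (Envelope P)} (hI : Inv I st)
    (hvc : st'.vc = st.vc) (hlog : st'.log = st.log)
    (hinj : ∀ e ∈ st.injected, e ∈ st'.injected)
    (choice : ∀ ℓ o, (st.voter ℓ).choice = some o → (st'.voter ℓ).choice = some o)
    (corrupted : ∀ ℓ, (st.voter ℓ).corrupted = true → (st'.voter ℓ).corrupted = true)
    (sent : ∀ e ∈ out, ∀ i, e.src ≠ .vc i)
    (posted : ∀ e ∈ out, ∀ ℓ, e.src = .voter ℓ → ∃ o, (st'.voter ℓ).choice = some o ∧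
      e.msg = .vote ℓ (I.su.code ℓ (I.su.part ℓ, o)))
    (bb : ∀ b, BBInv (MaySubmit I st) I.su.bbData (st'.bb b)) :
    MoveOK I st ((st', out), []) := by
  have hle : StateLe st { st' with log := st'.log ++ out } :=
    ⟨fun e he => List.mem_append_left _ (hlog ▸ he), hinj, fun i => by
      simpa [hvc] using NodeLe.refl _, choice, corrupted⟩
  refine ⟨hle, hI.move hle (by simp [hlog]) ?_ (fun e he i hi => (sent e he i hi).elim) posted
    fun b => (bb b).mono fun _ _ => hle.maySubmit I, by simp⟩
  intro j ℓ
  have := (hI.node j ℓ).mono (hle.facts I)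
  simpa [hvc] using this

/-- The intermediate state `v` may differ from the stored one: when a voter is started, her choice
and clock are entered before she contacts anyone. -/
theorem MoveOK.voter {I : Instance P} {st : State P} (hI : Inv I st) {ℓ : Fin P.n}
    {v : Voter P} {r : Voter P × List (Envelope P)} (h : VoterMove I.su ℓ v r)
    (hchoice : ∀ o, (st.voter ℓ).choice = some o → v.choice = some o)
    (hcorr : v.corrupted = (st.voter ℓ).corrupted) :
    MoveOK I st (({ st with voter := Function.update st.voter ℓ r.1 }, r.2), []) := by
  refine .other hI rfl rfl (fun _ h => h) ?_ ?_ ?_ ?_ hI.bb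
  · intro ℓ' o ho
    dsimp only
    by_cases hℓ : ℓ' = ℓ
    · subst hℓ
      rw [Function.update_self, h.choice]
      exact hchoice o ho
    · rwa [Function.update_of_ne hℓ]
  · intro ℓ' ho
    dsimp only
    by_cases hℓ : ℓ' = ℓ
    · subst hℓ
      rw [Function.update_self, h.corrupted, hcorr]
      exact ho
    · rwa [Function.update_of_ne hℓ]
  · intro e he i hi
    rw [(h.out e he).1] at hi; cases hi
  · intro e he ℓ' hℓ'
    obtain ⟨h1, o, h2, h3⟩ := h.out e he
    rw [hℓ'] at h1
    obtain rfl : ℓ' = ℓ := Party.voter.inj h1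
    refine ⟨o, ?_, h3⟩
    dsimp only
    rw [Function.update_self, h.choice, h2]

/-! ### Every move of the adversary preserves the invariant. -/

/-- What is known of a message that reaches an honest party. -/
def Legit (I : Instance P) (st : State P) (e : Envelope P) : Prop :=
  (∀ i, MsgOK (facts I st) (I.env i) e.src e.msg) ∧
    ∀ j V, e.src = .vc j → e.msg = .voteSet V → MaySubmit I st j V

/-- The log contains only what honest parties sent, so the guarantees on sent messages become the
assumptions of the receiver, however late or often the message arrives. -/
theorem Inv.legit {I : Instance P} {st : State P} (hI : Inv I st) {e : Envelope P}
    (he : e ∈ st.log) : Legit I st e := by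
  obtain ⟨src, msg, dst⟩ := e
  refine ⟨fun i => ?_, ?_⟩
  · dsimp only
    cases src with
    | vc j =>
      obtain ⟨-, h1⟩ := hI.sent _ he j rfl
      cases msg with
      | vote ℓ c => intro ℓ' h; cases h
      | endorsement ℓ c σ => exact .inr (.inl h1)
      | voteP ℓ c sh u => exact ⟨h1.1, .inr ⟨sh, u, dst, he⟩⟩
      | announce ℓ v =>
        refine ⟨?_, fun c u hv => ⟨(h1.2 c u hv).1, .inr (h1.2 c u hv).2⟩⟩
        rintro rfl
        exact .inr ⟨dst, he⟩
      | recoverResponse ℓ c u => exact h1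
      | _ => trivial
    | voter ℓ =>
      obtain ⟨o, h1, h2⟩ := hI.posted _ he ℓ rfl
      dsimp only at h2
      subst h2
      intro ℓ' h
      cases h
      exact .inr ⟨rfl, o, h1, rfl⟩
    | _ =>
      cases msg <;> first | trivial | (intro ℓ' h; cases h)
  · rintro j V rfl rfl
    exact .inr ⟨dst, he⟩

theorem mem_candidates {st : State P} {ℓ : Fin P.n} {c : Code} {u : UCert P} {j : Fin P.Nv}
    {σ : Bits} (hu : u j = some σ) {e : Envelope P} (he : e ∈ st.injected)
    (hm : (∃ sh, e.msg = .voteP ℓ c sh u) ∨ e.msg = .announce ℓ (some (c, u)) ∨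
      e.msg = .recoverResponse ℓ c u) : (j, signedMsg ℓ c, σ) ∈ candidates st := by
  unfold candidates
  refine List.mem_flatMap.2 ⟨e, he, ?_⟩
  have key : (j, signedMsg ℓ c, σ) ∈ (List.finRange P.Nv).filterMap fun i =>
      (u i).map fun σ => (i, signedMsg ℓ c, σ) :=
    List.mem_filterMap.2 ⟨j, List.mem_finRange j, by simp [hu]⟩
  rcases hm with ⟨sh, h⟩ | h | h <;> rw [h] <;> exact key

/-- Nothing has to be proved about the content of such a message: `facts` exempts corrupted senders,
and all signatures in certificates written by the adversary are listed in `candidates`. Whether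
those are genuine is settled later by `NoForgery`. -/
theorem legit_of_corrupt {I : Instance P} {st : State P} {e : Envelope P}
    (hc : Corrupt I.C st e.src) (he : e ∈ st.injected) : Legit I st e := by
  obtain ⟨src, msg, dst⟩ := e
  refine ⟨fun i => ?_, ?_⟩
  · dsimp only at hc ⊢
    cases src with
    | vc j =>
      cases msg with
      | vote ℓ c => intro ℓ' h; cases h
      | endorsement ℓ c σ => exact .inl hc
      | voteP ℓ c sh u =>
        exact ⟨fun k σ hk => .inr (.inr (mem_candidates hk he (.inl ⟨sh, rfl⟩))), .inl hc⟩
      | announce ℓ v =>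
        refine ⟨fun _ => .inl hc, ?_⟩
        rintro c u rfl
        exact ⟨fun k σ hk => .inr (.inr (mem_candidates hk he (.inr (.inl rfl)))), .inl (.inl hc)⟩
      | recoverResponse ℓ c u =>
        exact fun k σ hk => .inr (.inr (mem_candidates hk he (.inr (.inr rfl))))
      | _ => trivial
    | voter ℓ =>
      cases msg with
      | vote ℓ' c =>
        intro ℓ'' h
        cases h
        exact .inl hc
      | _ => trivial
    | _ =>
      cases msg <;> first | trivial | (intro ℓ' h; cases h)
  · rintro j V rfl rfl
    exact .inl hc

theorem moveOK_receive {I : Instance P} {st : State P} (hI : Inv I st)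
    (ans : SigQuery P.Nv → Bits) {e : Envelope P} (he : Legit I st e) :
    MoveOK I st ((receive I st e).eval ans) := by
  unfold receive
  split_ifs with hc
  · exact .idle hI
  · split
    · rename_i i hdst
      rw [hdst] at hc
      obtain ⟨h1, h2⟩ := handled_vcReceive ans (hI.node i) (he.1 i)
      have := MoveOK.vc hI hc h1 h2
      simpa using this
    · rename_i b hdst
      dsimp only
      refine .other hI rfl rfl (fun _ h => h) (fun _ _ h => h) (fun _ h => h) ?_ ?_ ?_
      · intro e he i hi
        rw [mem_bbReceive_src he] at hi; cases hi
      · intro e he i hi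
        rw [mem_bbReceive_src he] at hi; cases hi
      · intro b'
        dsimp only
        by_cases hb : b' = b
        · subst hb
          rw [Function.update_self]
          exact (hI.bb b').receive _ he.2
        · rw [Function.update_of_ne hb]
          exact hI.bb b'
    · rename_i t hdst
      refine .other hI rfl rfl (fun _ h => h) (fun _ _ h => h) (fun _ h => h) ?_ ?_ hI.bb
      · intro e he i hi
        rw [mem_trusteeReceive_src he] at hi; cases hi
      · intro e he i hi
        rw [mem_trusteeReceive_src he] at hi; cases hi
    · rename_i ℓ hdst
      exact .voter hI (voterMove_voterReceive I.su ℓ (st.voter ℓ) e.src e.msg)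
        (fun _ h => h) rfl
    · exact .idle hI

theorem moveOK_tickNode {I : Instance P} {st : State P} (hI : Inv I st) {X : Party P}
    (hX : ¬ Corrupt I.C st X) : MoveOK I st (tickNode I st X, []) := by
  unfold tickNode
  split
  · rename_i i
    exact MoveOK.vc hI hX (handled_vcTick (hI.node i)) (by simp)
  · rename_i b
    refine .other hI rfl rfl (fun _ h => h) (fun _ _ h => h) (fun _ h => h) (by simp) (by simp) ?_
    intro b'
    dsimp only
    by_cases hb : b' = b
    · subst hb
      rw [Function.update_self]
      have h := hI.bb b'
      exact ⟨h.sets, h.final, h.key, h.tally, h.result⟩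
    · rw [Function.update_of_ne hb]
      exact hI.bb b'
  · rename_i ℓ
    exact .voter hI (voterMove_voterTick I.su ℓ (st.voter ℓ)) (fun _ h => h) rfl
  · exact .idle hI

theorem moveOK_applyAction {I : Instance P} {st : State P} (hI : Inv I st)
    (ans : SigQuery P.Nv → Bits) (a : Action P) :
    MoveOK I st ((applyAction I st a).eval ans) := by
  unfold applyAction
  split
  · exact .other hI rfl rfl (fun _ h => h) (fun _ _ h => h) (fun _ h => h) (by simp) (by simp) hI.bb
  · rename_i X
    split_ifs with hX
    · exact .idle hI
    · exact moveOK_tickNode hI hX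
  · rename_i k
    split
    · rename_i e he
      exact moveOK_receive hI ans (hI.legit (List.mem_of_getElem? he))
    · exact .idle hI
  · rename_i e
    split_ifs with hc
    -- The message is recorded before it is handled, so that its signatures already count as
    -- candidates when the recipient processes it.
    · have h0 : MoveOK I st (({ st with injected := st.injected ++ [e] }, []), []) :=
        .other hI rfl rfl (fun x h => List.mem_append_left _ h) (fun _ _ h => h) (fun _ h => h)
          (by simp) (by simp) hI.bb
      have hI' : Inv I { st with injected := st.injected ++ [e] } := by simpa using h0.inv
      have h1 := moveOK_receive hI' ans (e := e) (legit_of_corrupt (by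
        revert hc; cases e.src <;> exact id) (by simp))
      refine ⟨⟨h1.le.log, fun x hx => h1.le.injected x (List.mem_append_left _ hx), h1.le.vc,
        h1.le.choice, h1.le.corrupted⟩, h1.inv, h1.queries⟩
    · exact .idle hI
  · rename_i ℓ
    refine .other hI rfl rfl (fun _ h => h) ?_ ?_ (by simp) (by simp) hI.bb
    · intro ℓ' o ho
      dsimp only
      by_cases h : ℓ' = ℓ
      · subst h; rw [Function.update_self]; exact ho
      · rwa [Function.update_of_ne h]
    · intro ℓ' ho
      dsimp only
      by_cases h : ℓ' = ℓ
      · subst h; rw [Function.update_self]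
      · rwa [Function.update_of_ne h]
  · rename_i ℓ o
    split_ifs with h
    · refine .voter hI (voterMove_contactNext I.su ℓ rfl) ?_ rfl
      intro o' ho'
      rw [h.2] at ho'; cases ho'
    · exact .idle hI
  · rename_i i ℓ d
    split_ifs with h
    -- Here `h5` is validity of consensus: the value delivered was the opinion of some honest node.
    · obtain ⟨h1, -, h3, -, h5⟩ := h
      exact MoveOK.vc hI h1 (handled_vcDecide (hI.node i) h5 h3) (by simp)
    · exact .idle hI

theorem inv_init (I : Instance P) : Inv I (State.init P) where
  node i ℓ := by
    refine ⟨?_, ?_, ?_, ?_, ?_, ?_, ?_, ?_⟩ <;> simp [State.init, Facts.certOK]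
  sent := by simp [State.init]
  posted := by simp [State.init]
  excl := by rintro i ℓ c ⟨dst, h⟩; simp [State.init] at h
  bb b := by
    refine ⟨?_, ?_, ?_, ?_, ?_⟩ <;> simp [State.init]

/-- The requests made so far are those of the honest vote collectors that endorse. -/
def QueriesOK (I : Instance P) (st : State P) (L : List (SigQuery P.Nv)) : Prop :=
  ∀ q ∈ L, ∃ i ℓ c, i ∉ I.C.vc ∧ q = .sign i (signedMsg ℓ c) ∧
    ((st.vc i).ballot ℓ).endorsed = some c

theorem step_spec {I : Instance P} {st : State P} (hI : Inv I st) (ans : SigQuery P.Nv → Bits)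
    (a : Action P) :
    StateLe st ((step I st a).eval ans).1.1 ∧ Inv I ((step I st a).eval ans).1.1 ∧
      QueriesOK I ((step I st a).eval ans).1.1 ((step I st a).eval ans).2 := by
  have h := moveOK_applyAction hI ans a
  rw [step_eq]
  simp only [SigComp.eval_bind, SigComp.eval_pure, List.append_nil]
  exact ⟨h.le, h.inv, h.queries⟩

theorem StateLe.trans {st st' st'' : State P} (h : StateLe st st') (h' : StateLe st' st'') :
    StateLe st st'' :=
  ⟨fun e he => h'.log e (h.log e he), fun e he => h'.injected e (h.injected e he),
    fun i => (h.vc i).trans (h'.vc i), fun ℓ o ho => h'.choice ℓ o (h.choice ℓ o ho),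
    fun ℓ hℓ => h'.corrupted ℓ (h.corrupted ℓ hℓ)⟩

theorem playWith_spec {I : Instance P} (act : List (Obs P) → Action P)
    (tape : List (SigQuery P.Nv → Bits)) {st : State P} (hI : Inv I st) (past : List (Obs P)) :
    StateLe st (playWith I act tape st past).1 ∧ Inv I (playWith I act tape st past).1 ∧
      QueriesOK I (playWith I act tape st past).1 (playWith I act tape st past).2 := by
  induction tape generalizing st past with
  | nil => exact ⟨.refl _, hI, by simp [QueriesOK, playWith]⟩
  | cons ans t ih =>
    obtain ⟨h1, h2, h3⟩ := step_spec hI ans (act past)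
    obtain ⟨h4, h5, h6⟩ := ih h2 (past ++ [((step I st (act past)).eval ans).1.2])
    refine ⟨h1.trans h4, h5, fun q hq => ?_⟩
    rcases List.mem_append.1 hq with hq | hq
    · obtain ⟨i, ℓ, c, h7, h8, h9⟩ := h3 q hq
      exact ⟨i, ℓ, c, h7, h8, ((h4.vc i).ballot ℓ).endorsed c h9⟩
    · exact h6 q hq

end
end DDemos

namespace DDemos

/-! ### Safety once enough shares of a receipt are disclosed -/

section
open scoped Classical

variable {P : Params}

/-- The code occupies a block of fixed length 160, so the concatenation splits uniquely, and the
binary digits determine the serial number. -/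
theorem signedMsg_injective {ℓ ℓ' : Fin P.n} {c c' : Code}
    (h : signedMsg ℓ c = signedMsg ℓ' c') : ℓ = ℓ' ∧ c = c' := by
  unfold signedMsg at h
  obtain ⟨h1, h2⟩ := List.append_inj h (by simp)
  constructor
  · exact Fin.ext (Nat.eq_of_testBit_eq fun i => by simp only [Nat.testBit_eq_inth, h2])
  · refine BitVec.eq_of_getLsbD_eq fun i hi => ?_
    have := List.map_inj_left.1 h1 ⟨i, hi⟩ (List.mem_finRange _)
    exact this

/-- A matching digest is computed with the salt of that line, and for a fixed salt the hash is
injective. -/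
theorem findLine_spec {I : Instance P} {i : Fin P.Nv} {ℓ : Fin P.n} {c : Code}
    {x : Bool × Fin P.m} (h : (I.env i).findLine ℓ c = some x) :
    I.su.code ℓ (x.1, I.su.shuffle ℓ x.1 x.2) = c := by
  have := List.find?_some h
  simp only [beq_iff_eq] at this
  exact P.hashCode_binding _ this

/-- Quorum intersection: `A ∩ B` has at least `|A| + |B| - N` elements, more than `C`. It serves
with `C` the corrupted nodes, and also with `C = ∅`. -/
theorem exists_mem_inter {N : ℕ} {A B C : Finset (Fin N)} (h : N + C.card < A.card + B.card) :
    ∃ i ∈ A, i ∈ B ∧ i ∉ C := by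
  have h1 := Finset.card_union_add_card_inter A B
  have h2 : (A ∪ B).card ≤ N := (Finset.card_le_univ _).trans_eq (Fintype.card_fin N)
  obtain ⟨i, hi, hi'⟩ := Finset.exists_mem_notMem_of_card_lt_card
    (s := C) (t := A ∩ B) (by omega)
  rw [Finset.mem_inter] at hi
  exact ⟨i, hi.1, hi.2, hi'⟩

/-- Every signature of an honest vote collector that the adversary has written into a certificate
stems from an endorsement. -/
def NoForgery (I : Instance P) (st : State P) : Prop :=
  ∀ x ∈ candidates st, x.1 ∉ I.C.vc → I.ver (I.pk x.1) x.2.1 x.2.2 = true →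
    ∃ ℓ c, x.2.1 = signedMsg ℓ c ∧ ((st.vc x.1).ballot ℓ).endorsed = some c

/-- Two quorums of `Nv - fv` signers have at least `Nv - 2 * fv > fv` members in common, one of them
honest. Without forgery both of its signatures stem from endorsements, and it endorses a single code
per ballot. -/
theorem cert_unique {I : Instance P} {st : State P} (hfv : 3 * P.fv < P.Nv)
    (hC : I.C.vc.card ≤ P.fv) (hN : NoForgery I st) {i i' : Fin P.Nv} {ℓ : Fin P.n} {c c' : Code}
    {u u' : UCert P} (h : (facts I st).certOK ℓ c u) (h' : (facts I st).certOK ℓ c' u')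
    (hv : (I.env i).validCert ℓ c u) (hv' : (I.env i').validCert ℓ c' u') : c = c' := by
  have key : ∀ (k j : Fin P.Nv) (d : Code) (w : UCert P), (facts I st).certOK ℓ d w →
      j ∉ I.C.vc →
      (∃ σ, w j = some σ ∧ (I.env k).ver ((I.env k).pk j) (signedMsg ℓ d) σ = true) →
      ((st.vc j).ballot ℓ).endorsed = some d := by
    rintro k j d w hw hj ⟨σ, h1, h2⟩
    rcases hw j σ h1 with h3 | h3 | h3
    · exact (hj h3).elim
    · exact h3
    · obtain ⟨ℓ', d', h4, h5⟩ := hN _ h3 hj h2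
      obtain ⟨rfl, rfl⟩ := signedMsg_injective h4
      exact h5
  unfold VCEnv.validCert VCEnv.sigCount at hv hv'
  obtain ⟨j, h1, h2, h3⟩ := exists_mem_inter (C := I.C.vc)
    (lt_of_lt_of_le (by omega) (Nat.add_le_add hv hv'))
  have h4 := key i j c u h h3 (Finset.mem_filter.1 h1).2
  have h5 := key i' j c' u' h' h3 (Finset.mem_filter.1 h2).2
  rw [h4] at h5
  exact Option.some.inj h5

/-- The vote collectors that have disclosed their share of the receipt for `c`. -/
noncomputable def disclosers (st : State P) (ℓ : Fin P.n) (c : Code) : Finset (Fin P.Nv) :=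
  Finset.univ.filter fun j => Disclosed st j ℓ c

theorem mem_disclosers {st : State P} {ℓ : Fin P.n} {c : Code} {j : Fin P.Nv} :
    j ∈ disclosers st ℓ c ↔ Disclosed st j ℓ c := by simp [disclosers]

theorem disclosed_honest {I : Instance P} {st : State P} (hI : Inv I st) {j : Fin P.Nv}
    {ℓ : Fin P.n} {c : Code} (h : Disclosed st j ℓ c) : j ∉ I.C.vc :=
  let ⟨_, _, _, h1⟩ := h
  (hI.sent _ h1 j rfl).1

/-- A discloser keeps the code in use with a certificate; it is compared with the certificate at
`i`. -/
theorem used_eq_of_disclosed {I : Instance P} {st : State P} (hI : Inv I st)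
    (hfv : 3 * P.fv < P.Nv) (hC : I.C.vc.card ≤ P.fv) (hN : NoForgery I st) {i j : Fin P.Nv}
    {ℓ : Fin P.n} {c c' : Code} {u : UCert P} (hj : Disclosed st j ℓ c)
    (hi : ((st.vc i).ballot ℓ).used = some (c', u)) : c' = c := by
  obtain ⟨sh, w, dst, h1⟩ := hj
  obtain ⟨-, -, w', h2⟩ := hI.sent _ h1 j rfl
  obtain ⟨h3, -, h4⟩ := (hI.node j ℓ).used _ _ h2
  obtain ⟨h5, -, h6⟩ := (hI.node i ℓ).used _ _ hi
  exact cert_unique hfv hC hN h5 h3 h6 h4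

/-- The opinion `false` rests on `Nv - fv` announcements, and `(Nv - fv) + (Nv - 2 * fv) > Nv`, so
some discloser was heard. It is honest and cannot have announced `none`, hence its announcement
forces the ballot to be in use. -/
theorem proposal_ne_false {I : Instance P} {st : State P} (hI : Inv I st)
    (hfv : 3 * P.fv < P.Nv) {ℓ : Fin P.n} {c : Code}
    (hD : P.Nv - 2 * P.fv ≤ (disclosers st ℓ c).card) (i : Fin P.Nv) :
    ((st.vc i).ballot ℓ).proposal ≠ some false := by
  intro h
  have hb := hI.node i ℓ
  have h1 := hb.proposal (by simp [h])
  obtain ⟨j, h2, h3, -⟩ := exists_mem_inter (C := ∅) (lt_of_lt_of_le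
    (by rw [Finset.card_empty]; omega) (Nat.add_le_add h1 hD))
  rw [mem_disclosers] at h3
  rcases hb.heard j h2 with (h4 | h4) | h4
  · exact disclosed_honest hI h3 h4
  · exact hI.excl j ℓ c h4 h3
  · exact h4.2 h

/-- One of the `fv + 1` submitters is honest. Its decision on the ballot is some honest node's
opinion, hence `true`, and the only code that it can hold there is the disclosed one. -/
theorem mem_voteSet_iff {I : Instance P} {st : State P} (hI : Inv I st)
    (hfv : 3 * P.fv < P.Nv) (hC : I.C.vc.card ≤ P.fv) (hN : NoForgery I st)
    {ℓ : Fin P.n} {c : Code} (hD : P.Nv - 2 * P.fv ≤ (disclosers st ℓ c).card)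
    {b : Fin P.Nb} {V : VoteSet P} (hV : (st.bb b).final = some V) (c' : Code) :
    (ℓ, c') ∈ V ↔ c' = c := by
  obtain ⟨j, hj⟩ : (disclosers st ℓ c).Nonempty := Finset.card_pos.1 (by omega)
  rw [mem_disclosers] at hj
  obtain ⟨T, h1, h2⟩ := (hI.bb b).final V hV
  obtain ⟨i, h3, h4⟩ := Finset.exists_mem_notMem_of_card_lt_card
    (s := I.C.vc) (t := T) (by omega)
  obtain ⟨dst, h5⟩ := (h2 i h3).resolve_left h4
  obtain ⟨-, h6⟩ := hI.sent _ h5 i rfl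
  obtain ⟨h7, h8⟩ := h6 ℓ
  have h9 : ((st.vc i).ballot ℓ).decision = some true := by
    obtain ⟨d, hd⟩ := Option.ne_none_iff_exists'.1 h7
    cases d
    · obtain ⟨k, -, hk⟩ := (hI.node i ℓ).decision _ hd
      exact (proposal_ne_false hI hfv hD k hk).elim
    · exact hd
  obtain ⟨c2, u, h10, h11⟩ := h8 h9
  obtain rfl := used_eq_of_disclosed hI hfv hC hN hj h10
  exact h11 c'

/-! ### Correctness of the homomorphic tally. -/

/-- Lifted ElGamal commitments are homomorphic. -/
def commitHom (P : Params) : Opening P →ₗ[ZMod P.q] P.G × P.G where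
  toFun := commit P
  map_add' a b := by
    simp only [commit, Prod.fst_add, Prod.snd_add, add_smul, Prod.mk_add_mk, Prod.mk.injEq,
      true_and]
    abel
  map_smul' a b := by
    simp [commit, mul_smul]

/-- Lifted ElGamal commitments are perfectly binding. -/
theorem commit_injective (P : Params) : Function.Injective (commit P) := by
  intro a b h
  simp only [commit, Prod.mk.injEq] at h
  have h2 : a.2 = b.2 := smul_left_injective (ZMod P.q) P.g_ne h.1
  rw [h2] at h
  have h1 : a.1 = b.1 := smul_left_injective (ZMod P.q) P.g_ne (add_right_cancel h.2)
  exact Prod.ext h1 h2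

/-- The combination of commitments against which a share is checked commits to the same combination
of coefficients. Binding leaves one opening, so even a corrupted trustee can only post the correct
share. -/
theorem opening_of_validTotal (su : Setup P) {V : VoteSet P} {κ : Key} {t : Fin P.Nt}
    {T : Fin P.m → Opening P} (h : ValidTotal su.bbData V κ t T) (j : Fin P.m) :
    T j = ∑ x ∈ tallyLines su.bbData V κ, ∑ d : Fin P.ht,
      ((t.val + 1 : ZMod P.q) ^ d.val) • su.poly x.1 x.2.1 (su.shuffle x.1 x.2.1 x.2.2) j d := by
  apply commit_injective
  rw [h j]
  change _ = commitHom P _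
  simp only [map_sum, map_smul]
  rfl

/-- The evaluation points `1, …, Nt` stay distinct modulo `q` because `Nt < q`. -/
theorem trustee_points_injective (P : Params) :
    Function.Injective fun t : Fin P.Nt => (t.val + 1 : ZMod P.q) := by
  intro t t' h
  have h1 : ((t.val + 1 : ℕ) : ZMod P.q) = ((t'.val + 1 : ℕ) : ZMod P.q) := by
    push_cast; exact h
  have h2 := P.Nt_lt_q
  have h3 := congrArg ZMod.val h1
  rw [ZMod.val_natCast_of_lt (by omega), ZMod.val_natCast_of_lt (by omega)] at h3
  exact Fin.ext (by omega)

/-- A ballot with several marked lines is discarded, so each ballot contributes at most one line. -/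
theorem card_tallyLines_le (D : BBData P) (V : VoteSet P) (κ : Key) :
    (tallyLines D V κ).card ≤ P.n := by
  have h : Set.InjOn (fun x : Fin P.n × Bool × Fin P.m => x.1) (tallyLines D V κ) := by
    rintro ⟨ℓ, X, p⟩ hx ⟨ℓ', X', p'⟩ hy rfl
    simp only [tallyLines, Finset.coe_filter, Finset.mem_univ, true_and, Set.mem_ofPred_eq] at hx hy
    rw [hx.2 _ _ hy.1]
  calc _ = ((tallyLines D V κ).image fun x => x.1).card := (Finset.card_image_of_injOn h).symm
    _ ≤ Fintype.card (Fin P.n) := Finset.card_le_univ _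
    _ = P.n := Fintype.card_fin _

/-- Summing the sharing polynomials over the tally set gives a polynomial `p` of degree below `ht`.
Every valid share is a value of `p`, so any `ht` of them determine it, and its constant term sums
the entries of the unit vectors. -/
theorem interpolated_eq (su : Setup P) (hht : 1 ≤ P.ht) {V : VoteSet P} {κ : Key}
    {valid : Finset (Fin P.Nt)} {T : Fin P.Nt → Fin P.m → Opening P}
    (hcard : P.ht ≤ valid.card) (hT : ∀ t ∈ valid, ValidTotal su.bbData V κ t (T t))
    (j : Fin P.m) :
    interpolated valid T j = ((tallyLines su.bbData V κ).filter fun y =>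
      su.shuffle y.1 y.2.1 y.2.2 = j).card := by
  set L := tallyLines su.bbData V κ with hL
  let p : Polynomial (ZMod P.q) := ∑ x ∈ L, ∑ d : Fin P.ht,
    Polynomial.monomial d.val (su.poly x.1 x.2.1 (su.shuffle x.1 x.2.1 x.2.2) j d).1
  have hdeg : p.degree < valid.card := by
    refine lt_of_lt_of_le ?_ (Nat.cast_le.2 hcard)
    rw [← Polynomial.mem_degreeLT]
    refine Submodule.sum_mem _ fun x _ => Submodule.sum_mem _ fun d _ => ?_
    rw [Polynomial.mem_degreeLT]
    exact (Polynomial.degree_monomial_le _ _).trans_lt (Nat.cast_lt.2 d.isLt)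
  have hp : p = Lagrange.interpolate valid (fun t => (t.val + 1 : ZMod P.q))
      (fun t => (T t j).1) := by
    refine Lagrange.eq_interpolate_of_eval_eq _ (trustee_points_injective P).injOn hdeg ?_
    intro t ht
    rw [opening_of_validTotal su (hT t ht) j]
    simp only [p, Polynomial.eval_finsetSum, Polynomial.eval_monomial, Prod.fst_sum, Prod.smul_fst,
      smul_eq_mul]
    exact Finset.sum_congr rfl fun x _ => Finset.sum_congr rfl fun d _ => mul_comm _ _
  have h0 : p.eval 0 = ((L.filter fun y => su.shuffle y.1 y.2.1 y.2.2 = j).card : ZMod P.q) := by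
    simp only [p, Polynomial.eval_finsetSum, Polynomial.eval_monomial]
    rw [Finset.card_filter, Nat.cast_sum]
    refine Finset.sum_congr rfl fun x _ => ?_
    -- At `0` only the constant coefficient survives; `1 ≤ ht` makes its index exist.
    rw [Finset.sum_eq_single (⟨0, hht⟩ : Fin P.ht)]
    · simp only [pow_zero, mul_one, Setup.poly, if_true]
      by_cases h : su.shuffle x.1 x.2.1 x.2.2 = j
      · simp [h]
      · simp [h, Ne.symm h]
    · intro d _ hd
      have : d.val ≠ 0 := fun h => hd (Fin.ext h)
      simp [this]
    · simp
  unfold interpolated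
  rw [← hp, h0, ZMod.val_natCast_of_lt]
  -- The count is at most `n < q`, so its residue represents it exactly.
  exact lt_of_le_of_lt ((Finset.card_filter_le _ _).trans (card_tallyLines_le _ _ _)) P.n_lt_q

theorem key_eq (su : Setup P) {sub : Fin P.Nv → VoteSet P → Prop} {s : BBNode P}
    (hs : BBInv sub su.bbData s) {κ : Key} (hκ : s.key = some κ) : κ = su.msk :=
  P.hashKey_binding _ (hs.key κ hκ)

/-- On her ballot the vote set contains her code only, and the codes of a ballot are distinct.
Exactly one position is therefore marked and the ballot is not discarded. -/
theorem tallyIncludes {I : Instance P} {st : State P} (hI : Inv I st)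
    (hfv : 3 * P.fv < P.Nv) (hht : 1 ≤ P.ht) (hC : I.C.vc.card ≤ P.fv) (hN : NoForgery I st)
    {ℓ : Fin P.n} {o : Fin P.m}
    (hD : P.Nv - 2 * P.fv ≤ (disclosers st ℓ (I.su.code ℓ (I.su.part ℓ, o))).card)
    {b : Fin P.Nb} {x : Fin P.m → ℕ} (hx : (st.bb b).result = some x) :
    TallyIncludes I.su (st.bb b) x ℓ o := by
  obtain ⟨V, κ, hview, valid, T, h1, h2, rfl⟩ := (hI.bb b).result x hx
  obtain ⟨hV, hκ⟩ := view_eq_some.1 hview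
  obtain rfl := key_eq I.su (hI.bb b) hκ
  refine ⟨V, _, hview, fun j => interpolated_eq I.su hht h1 h2 j,
    (I.su.shuffle ℓ (I.su.part ℓ)).symm o, by simp, ?_⟩
  have key : ∀ X p, Marked I.su.bbData V I.su.msk ℓ X p ↔
      (X, I.su.shuffle ℓ X p) = (I.su.part ℓ, o) := by
    intro X p
    unfold Marked
    rw [mem_voteSet_iff hI hfv hC hN hD hV]
    simp only [Setup.bbData, P.dec_enc]
    exact (I.su.code ℓ).injective.eq_iff
  simp only [tallyLines, Finset.mem_filter, Finset.mem_univ, true_and]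
  refine ⟨(key _ _).2 (by simp), fun X p h => ?_⟩
  have h3 := (key X p).1 h
  simp only [Prod.mk.injEq] at h3
  obtain ⟨rfl, h4⟩ := h3
  simp [← h4]

/-- If enough shares of her receipt are disclosed, an honest voter's vote is counted. -/
theorem not_safetyBroken_of_disclosed {I : Instance P} {st : State P} (hI : Inv I st)
    (hfv : 3 * P.fv < P.Nv) (hht : 1 ≤ P.ht) (hC : I.C.vc.card ≤ P.fv) (hN : NoForgery I st)
    (h : ∀ ℓ o, (st.voter ℓ).corrupted = false → (st.voter ℓ).choice = some o →
      (st.voter ℓ).hasReceipt = true →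
      P.Nv - 2 * P.fv ≤ (disclosers st ℓ (I.su.code ℓ (I.su.part ℓ, o))).card) :
    ¬ SafetyBroken I.su I.C st := by
  rintro ⟨ℓ, o, h1, h2, h3, b, -, ⟨V, h4, h5⟩ | ⟨x, h4, h5⟩⟩
  · exact h5 ((mem_voteSet_iff hI hfv hC hN (h ℓ o h1 h2 h3) h4 _).2 rfl)
  · exact h5 (tallyIncludes hI hfv hht hC hN (h ℓ o h1 h2 h3) h4)

/-- An honest vote collector has sent a receipt to an honest voter only after enough shares were
disclosed. -/
theorem disclosed_of_receipt {I : Instance P} {st : State P} (hI : Inv I st)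
    (hC : I.C.vc.card ≤ P.fv) {i : Fin P.Nv} {ℓ : Fin P.n} {r : Receipt} {o : Fin P.m}
    (h : (⟨.vc i, .receipt ℓ r, .voter ℓ⟩ : Envelope P) ∈ st.log)
    (hc : (st.voter ℓ).corrupted = false) (ho : (st.voter ℓ).choice = some o) :
    P.Nv - 2 * P.fv ≤ (disclosers st ℓ (I.su.code ℓ (I.su.part ℓ, o))).card := by
  obtain ⟨-, c, u, h1, h2, h3⟩ := hI.sent _ h i rfl
  -- Receipts go only to parties that may have posted the code, and an honest voter posts no code
  -- but her own.
  have hcode : c = I.su.code ℓ (I.su.part ℓ, o) := by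
    rcases h2 ℓ rfl with h4 | ⟨-, o', h4, h5⟩
    · simp [hc] at h4
    · rw [ho] at h4
      cases h4
      exact h5
  subst hcode
  have h4 := (hI.node i ℓ).receipt h3
  have h5 : (Finset.univ.filter fun j => (((st.vc i).ballot ℓ).shares j).isSome = true) ⊆
      I.C.vc ∪ disclosers st ℓ (I.su.code ℓ (I.su.part ℓ, o)) := by
    intro j hj
    obtain ⟨c', u', h6, h7⟩ := (hI.node i ℓ).shares j (Finset.mem_filter.1 hj).2
    rw [h1] at h6
    cases h6
    rw [Finset.mem_union, mem_disclosers]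
    exact h7
  have h6 := (Finset.card_le_card h5).trans (Finset.card_union_le _ _)
  omega

end
end DDemos

namespace DDemos

/-! ### Runs in which a voter rejects every receipt -/

section
open scoped Classical

variable {P : Params}

/-- The message that reaches its destination in a move. -/
def target (st : State P) : Action P → Option (Envelope P)
  | .deliver k => st.log[k]?
  | .inject e => some e
  | _ => none

/-- The receipt that reaches voter `v` in a move. -/
noncomputable def replyTo (v : Fin P.n) (st : State P) (a : Action P) : Option Receipt :=
  match target st a with
  | some ⟨_, .receipt _ r, .voter ℓ⟩ => if ℓ = v then some r else none
  | _ => none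

/-- The setup with the receipts of ballot `v` changed into something other than `r`. -/
def Setup.avoid (su : Setup P) (v : Fin P.n) (r : Receipt) : Setup P :=
  { su with receipt := Function.update su.receipt v fun _ _ => r + 1 }

/-- The instance in which voter `v` rejects the receipt that she gets in this move. -/
noncomputable def Instance.rejecting (I : Instance P) (v : Fin P.n) (st : State P)
    (a : Action P) : Instance P :=
  match replyTo v st a with
  | some r => { I with su := I.su.avoid v r }
  | none => I

/-- A receipt that voter `v` gets in this move from a corrupted vote collector, with her choice and
the vote collectors that have disclosed a share of her receipt. -/
noncomputable def guess (I : Instance P) (v : Fin P.n) (st : State P) (a : Action P) :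
    Option (Fin P.m × Finset (Fin P.Nv) × Receipt) :=
  match target st a with
  | some ⟨.vc i, .receipt ℓ r, .voter ℓ'⟩ =>
    if (ℓ = v ∧ ℓ' = v ∧ i ∈ I.C.vc) ∧ (st.voter v).corrupted = false ∧
        (st.voter v).waiting = some i then
      (st.voter v).choice.map fun o => (o, disclosers st v (I.su.code v (I.su.part v, o)), r)
    else none
  | _ => none

/-- The receipts that voter `v` gets from corrupted vote collectors if she rejects all of them. -/
noncomputable def guesses (I : Instance P) (v : Fin P.n) (act : List (Obs P) → Action P) :
    List (SigQuery P.Nv → Bits) → State P → List (Obs P) →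
      List (Fin P.m × Finset (Fin P.Nv) × Receipt)
  | [], _, _ => []
  | ans :: t, st, past =>
    (guess I v st (act past)).toList ++
      -- Corruption of the voter reveals her receipts, so the list ends there; only voters honest at
      -- the end matter.
      if act past = .corrupt v then [] else
        let x := (step (I.rejecting v st (act past)) st (act past)).eval ans
        guesses I v act t x.1.1 (past ++ [x.1.2])

/-! ### Comparison of the rejecting run with the real one. -/

theorem receipt_ne_add_one (r : Receipt) : r ≠ r + 1 := by
  intro h
  have h1 : (1 : BitVec 64) = 0 := by
    have := congrArg (fun x => x - r) h
    simp at this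
  exact absurd h1 (by decide)

theorem receive_voter (I : Instance P) (st : State P) (src : Party P) (msg : Msg P)
    (ℓ : Fin P.n) : receive I st ⟨src, msg, .voter ℓ⟩ =
      if (st.voter ℓ).corrupted = true then pure (st, []) else
        pure ({ st with
          voter := Function.update st.voter ℓ (voterReceive I.su ℓ (st.voter ℓ) src msg).1 },
          (voterReceive I.su ℓ (st.voter ℓ) src msg).2) := by
  have h : Corrupt I.C st (.voter ℓ) ↔ (st.voter ℓ).corrupted = true := Iff.rfl
  unfold receive
  by_cases hc : (st.voter ℓ).corrupted = true
  · rw [if_pos hc, if_pos (h.2 hc)]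
  · rw [if_neg hc, if_neg (fun hh => hc (h.1 hh))]

/-- Secrets of the setup enter an observation only through the corruption of a voter. -/
theorem finishMove_congr {I I' : Instance P} {a : Action P}
    (h : ∀ ℓ, a = .corrupt ℓ → I'.su.code ℓ = I.su.code ℓ ∧ I'.su.receipt ℓ = I.su.receipt ℓ ∧
      I'.su.part ℓ = I.su.part ℓ ∧ I'.su.order ℓ = I.su.order ℓ)
    (r : State P × List (Envelope P)) : finishMove I' a r = finishMove I a r := by
  cases a with
  | corrupt ℓ =>
    obtain ⟨h1, h2, h3, h4⟩ := h ℓ rfl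
    simp only [finishMove, h1, h2, h3, h4]
  | _ => rfl

/-- A move depends on the setup only through the reaction to the message that is delivered, if
there is one. -/
theorem step_eval_congr {I I' : Instance P} {st : State P} {a : Action P} {e : Envelope P}
    (ht : target st a = some e) (hC : I'.C = I.C) (ans : SigQuery P.Nv → Bits)
    (h : ∀ st0 : State P, st0.voter = st.voter →
      (applyAction I st a).eval ans = (receive I st0 e).eval ans →
      (receive I' st0 e).eval ans = (receive I st0 e).eval ans ∨
      ((a = .inject e ∧ ¬ Corrupt I.C st e.src))) :
    (step I' st a).eval ans = (step I st a).eval ans := by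
  have happ : (applyAction I' st a).eval ans = (applyAction I st a).eval ans := by
    cases a with
    | deliver k =>
      have ht' : st.log[k]? = some e := ht
      simp only [applyAction, ht']
      exact (h st rfl (by simp only [applyAction, ht'])).resolve_right (by simp)
    | inject e' =>
      obtain rfl : e' = e := Option.some.inj ht
      simp only [applyAction, hC]
      split_ifs with hc
      · exact (h { st with injected := st.injected ++ [e'] } rfl
          (by simp only [applyAction, if_pos hc])).resolve_right (fun hh => hh.2 hc)
      · rfl
    | _ => simp [target] at ht
  rw [step_eq, step_eq]
  simp only [SigComp.eval_bind, SigComp.eval_pure, happ]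
  rw [finishMove_congr]
  rintro ℓ rfl
  simp [target] at ht

theorem voterReceive_congr {su su' : Setup P} {ℓ : Fin P.n} (h1 : su'.code ℓ = su.code ℓ)
    (h2 : su'.receipt ℓ = su.receipt ℓ) (h3 : su'.part ℓ = su.part ℓ)
    (h4 : su'.order ℓ = su.order ℓ) (v : Voter P) (src : Party P) (msg : Msg P) :
    voterReceive su' ℓ v src msg = voterReceive su ℓ v src msg := by
  unfold voterReceive contactNext
  rw [h1, h2, h3, h4]

theorem replyTo_eq_some {v : Fin P.n} {st : State P} {a : Action P} {r : Receipt} :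
    replyTo v st a = some r ↔ ∃ src ℓ, target st a = some ⟨src, .receipt ℓ r, .voter v⟩ := by
  unfold replyTo
  split
  · rename_i src ℓ' r' ℓ h
    rw [h]
    constructor
    · intro hr
      split_ifs at hr with hv
      subst hv
      cases hr
      exact ⟨_, _, rfl⟩
    · rintro ⟨src', ℓ'', h2⟩
      simp only [Option.some.injEq, Envelope.mk.injEq, Msg.receipt.injEq, Party.voter.injEq] at h2
      obtain ⟨-, ⟨-, rfl⟩, rfl⟩ := h2
      simp
  · rename_i h
    constructor
    · intro hr; cases hr
    · rintro ⟨src', ℓ'', h2⟩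
      exact (h _ _ _ _ h2).elim

theorem rejecting_of_reply {I : Instance P} {v : Fin P.n} {st : State P} {a : Action P}
    {r : Receipt} (h : replyTo v st a = some r) :
    I.rejecting v st a = { I with su := I.su.avoid v r } := by
  unfold Instance.rejecting; rw [h]

theorem rejecting_of_none {I : Instance P} {v : Fin P.n} {st : State P} {a : Action P}
    (h : replyTo v st a = none) : I.rejecting v st a = I := by
  unfold Instance.rejecting; rw [h]

/-- Voter `v` accepts the receipt that she gets in this move. -/
def Accepts (I : Instance P) (v : Fin P.n) (st : State P) (a : Action P) : Prop :=
  ∃ i o, target st a = some ⟨.vc i, .receipt v (I.su.receipt v (I.su.part v) o), .voter v⟩ ∧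
    (st.voter v).corrupted = false ∧ (st.voter v).waiting = some i ∧
    -- The last clause rules out messages injected under the name of an honest vote collector, which
    -- authenticated channels drop.
    (st.voter v).choice = some o ∧ (i ∈ I.C.vc ∨ ∃ k, a = .deliver k)

/-- The two setups differ only in the receipts of ballot `v`, and in such a move these matter only
in the voter's comparison. If she does not accept, the comparison fails, or is not reached, in both.
-/
theorem step_rejecting_of_not_accepts {I : Instance P} {v : Fin P.n} {st : State P}
    {a : Action P} (h : ¬ Accepts I v st a) (ans : SigQuery P.Nv → Bits) :
    (step (I.rejecting v st a) st a).eval ans = (step I st a).eval ans := by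
  cases hr : replyTo v st a with
  | none => rw [rejecting_of_none hr]
  | some r =>
    rw [rejecting_of_reply hr]
    obtain ⟨src, ℓ, ht⟩ := replyTo_eq_some.1 hr
    refine step_eval_congr (I := I) (I' := { I with su := I.su.avoid v r }) ht rfl ans
      fun st0 hst0 _ => ?_
    by_cases hinj : a = .inject ⟨src, .receipt ℓ r, .voter v⟩ ∧ ¬ Corrupt I.C st src
    · exact .inr hinj
    left
    rw [receive_voter, receive_voter]
    split_ifs with hc
    · rfl
    rw [hst0] at hc
    have : voterReceive (I.su.avoid v r) v (st0.voter v) src (.receipt ℓ r) =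
        voterReceive I.su v (st0.voter v) src (.receipt ℓ r) := by
      rw [hst0]
      unfold voterReceive
      cases src with
      | vc i =>
        cases ho : (st.voter v).choice with
        | none => rfl
        | some o =>
          dsimp only
          by_cases hw : ℓ = v ∧ (st.voter v).waiting = some i
          · rw [if_pos hw, if_pos hw]
            have h1 : r ≠ (I.su.avoid v r).receipt v ((I.su.avoid v r).part v) o := by
              simp only [Setup.avoid, Function.update_self]
              exact receipt_ne_add_one r
            have h2 : r ≠ I.su.receipt v (I.su.part v) o := by
              rintro rfl
              obtain ⟨rfl, hw⟩ := hw
              refine h ⟨i, o, ht, by simpa using hc, hw, ho, ?_⟩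
              by_contra hk
              rw [not_or] at hk
              cases a with
              | deliver k => exact hk.2 ⟨k, rfl⟩
              | inject e =>
                obtain rfl := Option.some.inj ht
                exact hinj ⟨rfl, hk.1⟩
              | _ => simp [target] at ht
            rw [if_neg h1, if_neg h2]
            rfl
          · rw [if_neg hw, if_neg hw]
      | _ => rfl
    rw [this]

/-- How the state of voter `v` changes in a move. -/
theorem step_voter (I : Instance P) (v : Fin P.n) (st : State P) (a : Action P)
    (ans : SigQuery P.Nv → Bits) :
    ((step I st a).eval ans).1.1.voter v = st.voter v ∨
    (∃ src msg, target st a = some ⟨src, msg, .voter v⟩ ∧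
      ((step I st a).eval ans).1.1.voter v = (voterReceive I.su v (st.voter v) src msg).1) ∨
    ((step I st a).eval ans).1.1.voter v = (voterTick I.su v (st.voter v)).1 ∨
    (∃ o c, (st.voter v).choice = none ∧ ((step I st a).eval ans).1.1.voter v =
      (contactNext I.su v o { st.voter v with choice := some o, clock := c }).1) ∨
    (a = .corrupt v ∧ ((step I st a).eval ans).1.1.voter v =
      { st.voter v with corrupted := true }) := by
  have h0 : ((step I st a).eval ans).1.1.voter = ((applyAction I st a).eval ans).1.1.voter := by
    rw [step_eq]; simp [finishMove]
  rw [h0]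
  have hupd : ∀ (ℓ : Fin P.n) (x : Voter P), Function.update st.voter ℓ x v = st.voter v ∨
      (ℓ = v ∧ Function.update st.voter ℓ x v = x) := by
    intro ℓ x
    by_cases h : ℓ = v
    · subst h; right; simp
    · left; rw [Function.update_of_ne (Ne.symm h)]
  have hrec : ∀ (st0 : State P) (e : Envelope P), st0.voter = st.voter →
      ((receive I st0 e).eval ans).1.1.voter v = st.voter v ∨
      ∃ src msg, e = ⟨src, msg, .voter v⟩ ∧ ((receive I st0 e).eval ans).1.1.voter v =
        (voterReceive I.su v (st.voter v) src msg).1 := by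
    rintro st0 ⟨src, msg, dst⟩ hst
    unfold receive
    split_ifs
    · left; simp [hst]
    · cases dst with
      | voter ℓ =>
        dsimp only
        simp only [SigComp.eval_pure, hst]
        rcases hupd ℓ (voterReceive I.su ℓ (st.voter ℓ) src msg).1 with h | ⟨rfl, h⟩
        · exact .inl h
        · exact .inr ⟨src, msg, rfl, h⟩
      | _ => left; simp [hst]
  cases a with
  | tick => left; rfl
  | tickNode X =>
    simp only [applyAction]
    split_ifs
    · left; rfl
    · cases X with
      | voter ℓ =>
        simp only [tickNode, SigComp.eval_pure]
        rcases hupd ℓ (voterTick I.su ℓ (st.voter ℓ)).1 with h | ⟨rfl, h⟩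
        · exact .inl h
        · exact .inr (.inr (.inl h))
      | _ => left; rfl
  | deliver k =>
    simp only [applyAction]
    cases hk : st.log[k]? with
    | none => left; rfl
    | some e =>
      rcases hrec st e rfl with h | ⟨src, msg, rfl, h⟩
      · exact .inl h
      · exact .inr (.inl ⟨src, msg, hk, h⟩)
  | inject e =>
    simp only [applyAction]
    split_ifs
    · rcases hrec { st with injected := st.injected ++ [e] } e rfl with h | ⟨src, msg, rfl, h⟩
      · exact .inl h
      · exact .inr (.inl ⟨src, msg, rfl, h⟩)
    · left; rfl
  | corrupt ℓ =>
    simp only [applyAction, SigComp.eval_pure]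
    rcases hupd ℓ { st.voter ℓ with corrupted := true } with h | ⟨rfl, h⟩
    · exact .inl h
    · exact .inr (.inr (.inr (.inr ⟨rfl, h⟩)))
  | start ℓ o =>
    simp only [applyAction]
    split_ifs with hc
    · simp only [SigComp.eval_pure]
      rcases hupd ℓ (contactNext I.su ℓ o
        { st.voter ℓ with choice := some o, clock := st.clock }).1 with h | ⟨rfl, h⟩
      · exact .inl h
      · exact .inr (.inr (.inr (.inl ⟨o, _, hc.2, h⟩)))
    · left; rfl
  | decide i ℓ d =>
    simp only [applyAction]
    split_ifs <;> (left; rfl)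

theorem contactNext_hasReceipt (su : Setup P) (ℓ : Fin P.n) (o : Fin P.m) (v : Voter P) :
    (contactNext su ℓ o v).1.hasReceipt = v.hasReceipt := by
  unfold contactNext
  split_ifs <;> rfl

/-- A voter who rejects every receipt does not obtain one. -/
theorem hasReceipt_step_rejecting {I : Instance P} {v : Fin P.n} {st : State P} {a : Action P}
    (h : (st.voter v).hasReceipt = false) (ans : SigQuery P.Nv → Bits) :
    (((step (I.rejecting v st a) st a).eval ans).1.1.voter v).hasReceipt = false := by
  rcases step_voter (I.rejecting v st a) v st a ans with h1 | ⟨src, msg, ht, h1⟩ | h1 |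
    ⟨o, c, -, h1⟩ | ⟨-, h1⟩
  · rw [h1, h]
  · rw [h1]
    unfold voterReceive
    split
    · rename_i i ℓ r o ho
      rw [rejecting_of_reply (replyTo_eq_some.2 ⟨_, _, ht⟩)]
      have h1 : r ≠ (I.su.avoid v r).receipt v ((I.su.avoid v r).part v) o := by
        simp only [Setup.avoid, Function.update_self]
        exact receipt_ne_add_one r
      dsimp only
      rw [if_neg h1]
      split_ifs
      · rw [contactNext_hasReceipt, h]
      · exact h
    · exact h
  · rw [h1]
    unfold voterTick
    dsimp only
    split
    · split_ifs
      · rw [contactNext_hasReceipt]; exact h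
      · exact h
    · exact h
  · rw [h1, contactNext_hasReceipt]; exact h
  · rw [h1]; exact h

theorem disclosers_subset {st st' : State P} (h : ∀ e ∈ st.log, e ∈ st'.log) (ℓ : Fin P.n)
    (c : Code) : disclosers st ℓ c ⊆ disclosers st' ℓ c := by
  intro j hj
  rw [mem_disclosers] at hj ⊢
  obtain ⟨sh, u, dst, h1⟩ := hj
  exact ⟨sh, u, dst, h _ h1⟩

/-- If an honest voter obtains a receipt of which few shares are disclosed, then it is one of the
receipts that she would get from corrupted vote collectors if she rejected all of them. -/
theorem mem_guesses {I : Instance P} (hC : I.C.vc.card ≤ P.fv) {v : Fin P.n} {o : Fin P.m}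
    (act : List (Obs P) → Action P) (tape : List (SigQuery P.Nv → Bits)) {st : State P}
    (hI : Inv I st) (h0 : (st.voter v).hasReceipt = false) (past : List (Obs P))
    (hc : ((playWith I act tape st past).1.voter v).corrupted = false)
    (ho : ((playWith I act tape st past).1.voter v).choice = some o)
    (hr : ((playWith I act tape st past).1.voter v).hasReceipt = true)
    (hD : (disclosers (playWith I act tape st past).1 v
      (I.su.code v (I.su.part v, o))).card < P.Nv - 2 * P.fv) :
    ∃ T : Finset (Fin P.Nv), T.card < P.Nv - 2 * P.fv ∧
      (o, T, I.su.receipt v (I.su.part v) o) ∈ guesses I v act tape st past := by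
  induction tape generalizing st past with
  | nil =>
    simp only [playWith] at hr
    rw [h0] at hr; cases hr
  | cons ans t ih =>
    obtain ⟨h1, h2, -⟩ := step_spec hI ans (act past)
    obtain ⟨h3, -, -⟩ := playWith_spec act t h2 (past ++ [((step I st (act past)).eval ans).1.2])
    simp only [playWith] at hc ho hr hD
    -- Corruption is permanent, so this move cannot occur before a final state in which the voter is
    -- honest.
    by_cases hcor : act past = .corrupt v
    · have h4 : (((step I st (act past)).eval ans).1.1.voter v).corrupted = true := by
        rw [hcor]; simp [step_eq, finishMove, applyAction]
      rw [h3.corrupted v h4] at hc; cases hc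
    by_cases hacc : Accepts I v st (act past)
    · obtain ⟨i, o', ht, h4, h5, h6, h7⟩ := hacc
      have h8 := h3.choice v o' (h1.choice v o' h6)
      rw [ho] at h8
      cases h8
      -- Disclosers only accumulate, so few at the end means few at the time of acceptance.
      have hsub := Finset.card_le_card
        (disclosers_subset (h1.trans h3).log v (I.su.code v (I.su.part v, o)))
      by_cases hi : i ∈ I.C.vc
      · refine ⟨disclosers st v (I.su.code v (I.su.part v, o)), by omega, ?_⟩
        simp only [guesses, List.mem_append]
        left
        simp [guess, ht, hi, h4, h5, h6]
      -- An honest sender would have needed enough disclosures already.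
      · obtain ⟨k, hk⟩ := h7.resolve_left hi
        rw [hk] at ht
        have := disclosed_of_receipt hI hC (List.mem_of_getElem? ht) h4 h6
        omega
    · have heq := step_rejecting_of_not_accepts hacc ans
      have h4 := hasReceipt_step_rejecting (I := I) (a := act past) h0 ans
      rw [heq] at h4
      obtain ⟨T, h5, h6⟩ := ih h2 h4 _ hc ho hr hD
      refine ⟨T, h5, ?_⟩
      simp only [guesses, List.mem_append, if_neg hcor, heq]
      exact .inr h6

/-! ### The number of receipts that a voter considers -/

/-- The voter waits for the vote collector that she contacted last. -/
def WaitOK (su : Setup P) (v : Fin P.n) (x : Voter P) : Prop :=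
  ∀ i, x.waiting = some i → ∃ k, su.order v k = i ∧ k.val + 1 = x.tried

/-- The corrupted vote collectors from which the voter may still consider a reply. -/
noncomputable def pending (su : Setup P) (C : Corruption P) (v : Fin P.n) (x : Voter P) :
    Finset (Fin P.Nv) :=
  Finset.univ.filter fun k => su.order v k ∈ C.vc ∧
    (x.tried ≤ k.val ∨ (x.waiting ≠ none ∧ k.val + 1 = x.tried))

/-- Moving on abandons the position contacted before, which is `tried - 1` by `WaitOK`; only
positions from the old `tried` onwards remain. -/
theorem contactNext_pending (su : Setup P) (C : Corruption P) (v : Fin P.n) (o : Fin P.m)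
    (x : Voter P) : WaitOK su v (contactNext su v o x).1 ∧
      ∀ k ∈ pending su C v (contactNext su v o x).1, su.order v k ∈ C.vc ∧ x.tried ≤ k.val := by
  unfold contactNext
  split_ifs with h1 h2
  · refine ⟨?_, ?_⟩
    · intro i hi
      simp only [Option.some.injEq] at hi
      exact ⟨_, hi, rfl⟩
    · intro k hk
      simp only [pending, Finset.mem_filter, Finset.mem_univ, true_and] at hk
      exact ⟨hk.1, by omega⟩
  · refine ⟨fun i hi => by simp at hi, fun k hk => ?_⟩
    simpa [pending] using hk
  · refine ⟨fun i hi => by simp at hi, fun k hk => ?_⟩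
    simpa [pending] using hk

theorem pending_of_tried {su : Setup P} {C : Corruption P} {v : Fin P.n} {x : Voter P}
    {k : Fin P.Nv} (h : su.order v k ∈ C.vc ∧ x.tried ≤ k.val) : k ∈ pending su C v x := by
  simp only [pending, Finset.mem_filter, Finset.mem_univ, true_and]
  exact ⟨h.1, .inl h.2⟩

theorem voterReceive_pending (su : Setup P) (C : Corruption P) (v : Fin P.n) {x : Voter P}
    (hx : WaitOK su v x) (src : Party P) (msg : Msg P) :
    WaitOK su v (voterReceive su v x src msg).1 ∧
      pending su C v (voterReceive su v x src msg).1 ⊆ pending su C v x := by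
  unfold voterReceive
  split
  · split_ifs
    · refine ⟨fun i hi => by simp at hi, fun k hk => pending_of_tried ?_⟩
      simpa [pending] using hk
    · obtain ⟨h1, h2⟩ := contactNext_pending su C v _ x
      exact ⟨h1, fun k hk => pending_of_tried (h2 k hk)⟩
    · exact ⟨hx, subset_rfl⟩
  · exact ⟨hx, subset_rfl⟩

theorem step_pending {I : Instance P} {v : Fin P.n} {st : State P} (a : Action P)
    (hx : WaitOK I.su v (st.voter v)) (ans : SigQuery P.Nv → Bits) :
    WaitOK I.su v (((step I st a).eval ans).1.1.voter v) ∧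
      pending I.su I.C v (((step I st a).eval ans).1.1.voter v) ⊆
        pending I.su I.C v (st.voter v) := by
  rcases step_voter I v st a ans with h1 | ⟨src, msg, ht, h1⟩ | h1 | ⟨o, c, -, h1⟩ | ⟨-, h1⟩
  · rw [h1]; exact ⟨hx, subset_rfl⟩
  · rw [h1]; exact voterReceive_pending _ _ _ hx _ _
  · rw [h1]
    unfold voterTick
    dsimp only
    split
    · split_ifs
      · obtain ⟨h2, h3⟩ := contactNext_pending I.su I.C v _
          { st.voter v with clock := (st.voter v).clock + 1 }
        exact ⟨h2, fun k hk => pending_of_tried (h3 k hk)⟩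
      · exact ⟨hx, subset_rfl⟩
    · exact ⟨hx, subset_rfl⟩
  · rw [h1]
    obtain ⟨h2, h3⟩ := contactNext_pending I.su I.C v o
      { st.voter v with choice := some o, clock := c }
    exact ⟨h2, fun k hk => pending_of_tried (h3 k hk)⟩
  · rw [h1]; exact ⟨hx, subset_rfl⟩

theorem guess_isSome {I : Instance P} {v : Fin P.n} {st : State P} {a : Action P}
    {x : Fin P.m × Finset (Fin P.Nv) × Receipt} (h : guess I v st a = some x) :
    ∃ i r o, target st a = some ⟨.vc i, .receipt v r, .voter v⟩ ∧ i ∈ I.C.vc ∧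
      (st.voter v).corrupted = false ∧ (st.voter v).waiting = some i ∧
      (st.voter v).choice = some o ∧
      x = (o, disclosers st v (I.su.code v (I.su.part v, o)), r) := by
  unfold guess at h
  split at h
  · rename_i i ℓ r ℓ' ht
    split_ifs at h with hc
    obtain ⟨⟨rfl, rfl, hi⟩, h1, h2⟩ := hc
    obtain ⟨o, ho, rfl⟩ := Option.map_eq_some_iff.1 h
    exact ⟨i, r, o, ht, hi, h1, h2, ho, rfl⟩
  · cases h

theorem rejecting_eq (I : Instance P) (v : Fin P.n) (st : State P) (a : Action P) :
    (I.rejecting v st a).C = I.C ∧ (I.rejecting v st a).su.order = I.su.order ∧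
      (I.rejecting v st a).su.part = I.su.part ∧ (I.rejecting v st a).su.code = I.su.code := by
  unfold Instance.rejecting
  split <;> exact ⟨rfl, rfl, rfl, rfl⟩

theorem step_pending_rejecting {I : Instance P} {v : Fin P.n} {st : State P} (a : Action P)
    (hx : WaitOK I.su v (st.voter v)) (ans : SigQuery P.Nv → Bits) :
    WaitOK I.su v (((step (I.rejecting v st a) st a).eval ans).1.1.voter v) ∧
      pending I.su I.C v (((step (I.rejecting v st a) st a).eval ans).1.1.voter v) ⊆
        pending I.su I.C v (st.voter v) := by
  obtain ⟨h1, h2, -, -⟩ := rejecting_eq I v st a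
  have h := step_pending (I := I.rejecting v st a) (v := v) a
    (by unfold WaitOK; rw [h2]; exact hx) ans
  unfold WaitOK pending at h ⊢
  rw [h1, h2] at h
  exact h

theorem step_voter_of_target {I : Instance P} {v : Fin P.n} {st : State P} {a : Action P}
    {i : Fin P.Nv} {msg : Msg P} (ht : target st a = some ⟨.vc i, msg, .voter v⟩)
    (hi : i ∈ I.C.vc) (hc : (st.voter v).corrupted = false) (ans : SigQuery P.Nv → Bits) :
    ((step I st a).eval ans).1.1.voter v =
      (voterReceive I.su v (st.voter v) (.vc i) msg).1 := by
  have hrec : ∀ st0 : State P, st0.voter = st.voter →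
      ((receive I st0 ⟨.vc i, msg, .voter v⟩).eval ans).1.1.voter v =
      (voterReceive I.su v (st.voter v) (.vc i) msg).1 := by
    intro st0 h0
    rw [receive_voter, h0, if_neg (by simp [hc])]
    simp
  have h0 : ((step I st a).eval ans).1.1.voter = ((applyAction I st a).eval ans).1.1.voter := by
    rw [step_eq]; simp [finishMove]
  rw [h0]
  cases a with
  | deliver k =>
    have ht' : st.log[k]? = some ⟨.vc i, msg, .voter v⟩ := ht
    simp only [applyAction, ht']
    exact hrec st rfl
  | inject e =>
    obtain rfl := Option.some.inj ht
    have hcor : Corrupt I.C st (.vc i) := hi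
    simp only [applyAction, if_pos hcor]
    exact hrec _ rfl
  | _ => simp [target] at ht

/-- A guess answers the contact at position `tried - 1`. Whatever the comparison yields, the voter
stops waiting there and never returns to it, so this position leaves `pending`. -/
theorem step_pending_guess {I : Instance P} {v : Fin P.n} {st : State P} {a : Action P}
    (hx : WaitOK I.su v (st.voter v)) (ans : SigQuery P.Nv → Bits)
    (hg : (guess I v st a).isSome = true) :
    (pending I.su I.C v (((step (I.rejecting v st a) st a).eval ans).1.1.voter v)).card <
        (pending I.su I.C v (st.voter v)).card := by
  obtain ⟨x, hg⟩ := Option.isSome_iff_exists.1 hg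
  obtain ⟨i, r, o, ht, hi, h1, h2, h3, -⟩ := guess_isSome hg
  obtain ⟨k, h4, h5⟩ := hx i h2
  refine Finset.card_lt_card (Finset.ssubset_iff_of_subset
    (step_pending_rejecting a hx ans).2 |>.2 ⟨k, ?_, ?_⟩)
  · simp only [pending, Finset.mem_filter, Finset.mem_univ, true_and]
    exact ⟨h4 ▸ hi, .inr ⟨by simp [h2], h5⟩⟩
  · obtain ⟨h6, h7, -, -⟩ := rejecting_eq I v st a
    rw [step_voter_of_target ht (h6 ▸ hi) h1]
    intro hk
    have key : (st.voter v).tried ≤ k.val := by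
      unfold voterReceive at hk
      simp only [h3, h2, true_and, if_true] at hk
      split_ifs at hk
      · simpa [pending] using (Finset.mem_filter.1 hk).2.2
      · have hk' : k ∈ pending (I.rejecting v st a).su I.C v
            (contactNext (I.rejecting v st a).su v o (st.voter v)).1 := by
          unfold pending at hk ⊢
          rw [h7]; exact hk
        exact ((contactNext_pending _ _ _ _ _).2 k hk').2
    omega

/-- The cardinality of `pending` is a potential: no move increases it and every guess lowers it. -/
theorem length_guesses_le_pending (I : Instance P) (v : Fin P.n)
    (act : List (Obs P) → Action P) (tape : List (SigQuery P.Nv → Bits)) {st : State P}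
    (hx : WaitOK I.su v (st.voter v)) (past : List (Obs P)) :
    (guesses I v act tape st past).length ≤ (pending I.su I.C v (st.voter v)).card := by
  induction tape generalizing st past with
  | nil => simp [guesses]
  | cons ans t ih =>
    obtain ⟨h1, h2⟩ := step_pending_rejecting (act past) hx ans
    have h3 := ih h1
      (past ++ [((step (I.rejecting v st (act past)) st (act past)).eval ans).1.2])
    have h4 := Finset.card_le_card h2
    simp only [guesses, List.length_append]
    cases hg : guess I v st (act past) with
    | none =>
      split_ifs
      · simp
      · simp only [Option.toList_none, List.length_nil, Nat.zero_add]
        exact h3.trans h4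
    | some x =>
      have h5 := step_pending_guess hx ans (by rw [hg]; rfl)
      simp only [Option.toList_some, List.length_singleton]
      split_ifs
      · simp only [List.length_nil]; omega
      · omega

/-- A voter considers at most one reply of each corrupted vote collector. -/
theorem length_guesses_le (I : Instance P) (v : Fin P.n) (act : List (Obs P) → Action P)
    (tape : List (SigQuery P.Nv → Bits)) (past : List (Obs P)) :
    (guesses I v act tape (State.init P) past).length ≤ I.C.vc.card := by
  refine (length_guesses_le_pending I v act tape (by intro i hi; simp [State.init] at hi)
    past).trans ?_
  -- The order is a permutation, so positions inject into the corrupted nodes found there.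
  refine Finset.card_le_card_of_injOn (I.su.order v) (fun k hk => ?_)
    (I.su.order v).injective.injOn
  exact (Finset.mem_filter.1 hk).2.1

/-! ### Dependence on an undisclosed receipt -/

/-- The setup with another receipt, shared with other coins, on one ballot line. -/
def Setup.setLine (su : Setup P) (v : Fin P.n) (X : Bool) (o : Fin P.m) (s : Receipt)
    (r : P.receiptVSS.Coins) : Setup P :=
  { su with
    receipt := fun ℓ Y p => if ℓ = v ∧ Y = X ∧ p = o then s else su.receipt ℓ Y p
    receiptCoins := fun ℓ Y p => if ℓ = v ∧ Y = X ∧ p = o then r else su.receiptCoins ℓ Y p }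

/-- The public data and the shares of the vote collectors in `T` are those of the receipt `s`
shared with coins `r`. -/
def SameShares (su : Setup P) (v : Fin P.n) (X : Bool) (o : Fin P.m) (T : Finset (Fin P.Nv))
    (s : Receipt) (r : P.receiptVSS.Coins) : Prop :=
  P.receiptVSS.pub s r = P.receiptVSS.pub (su.receipt v X o) (su.receiptCoins v X o) ∧
  ∀ i ∈ T, P.receiptVSS.share s r i =
    P.receiptVSS.share (su.receipt v X o) (su.receiptCoins v X o) i

/-- A vote collector with other receipt shares. -/
def VCEnv.withShare (E : VCEnv P) (sh : Fin P.n → Bool → Fin P.m → P.receiptVSS.Share) :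
    VCEnv P :=
  { E with data := { E.data with share := sh } }

/-- A vote collector uses its receipt shares only as content of VOTE_P messages. Any visible effect
of changing the share of `c0` is thus itself a disclosure for `c0`. The index `j0` provides a
recipient, so that the broadcast is not empty. -/
theorem vcReceive_withShare {E : VCEnv P} {sh : Fin P.n → Bool → Fin P.m → P.receiptVSS.Share}
    {v : Fin P.n} {c0 : Code}
    (hsh : ∀ ℓ c l, E.findLine ℓ c = some l → sh ℓ l.1 l.2 = E.data.share ℓ l.1 l.2 ∨
      (ℓ = v ∧ c = c0)) (j0 : Fin P.Nv) (s : VCNode P) (src : Party P) (msg : Msg P)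
    (ans : SigQuery P.Nv → Bits) :
    (vcReceive (E.withShare sh) s src msg).eval ans = (vcReceive E s src msg).eval ans ∨
    ∃ sh u dst, (⟨.vc E.me, .voteP v c0 sh u, dst⟩ : Envelope P) ∈
      ((vcReceive E s src msg).eval ans).1.2 := by
  rw [eval_vcReceive, eval_vcReceive]
  have key : vcReact ans (E.withShare sh) s src msg = vcReact ans E s src msg ∨
      ∃ sh u dst, (⟨.vc E.me, .voteP v c0 sh u, dst⟩ : Envelope P) ∈
        (vcReact ans E s src msg).1.2 := by
    have hall : ∀ (ℓ : Fin P.n) (c : Code) (x : P.receiptVSS.Share) (u : UCert P), ℓ = v → c = c0 →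
        ∃ sh' u' dst, (⟨.vc E.me, .voteP v c0 sh' u', dst⟩ : Envelope P) ∈
          toAllVC (.vc E.me) (.voteP ℓ c x u) := by
      rintro ℓ c x u rfl rfl
      exact ⟨x, u, .vc j0, List.mem_map.2 ⟨j0, List.mem_finRange _, rfl⟩⟩
    unfold vcReact
    split
    · exact .inl rfl
    · exact .inl rfl
    · rename_i j ℓ c σ
      have h1 : (E.withShare sh).findLine ℓ c = E.findLine ℓ c := rfl
      have h2 : ∀ u : UCert P, (E.withShare sh).validCert ℓ c u = E.validCert ℓ c u := fun _ => rfl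
      have h3 : (E.withShare sh).ver = E.ver := rfl
      have h4 : (E.withShare sh).pk = E.pk := rfl
      have h5 : (E.withShare sh).me = E.me := rfl
      have h6 : (E.withShare sh).data.share = sh := rfl
      unfold onEndorsement
      dsimp only
      rw [h3, h4, h1]
      by_cases h7 : s.clock < P.Tend ∧ (s.ballot ℓ).used = none ∧
          (∃ x ∈ (s.ballot ℓ).clients, x.1 = c) ∧ E.ver (E.pk j) (signedMsg ℓ c) σ = true
      swap
      · rw [if_neg h7, if_neg h7]; exact .inl rfl
      rw [if_pos h7, if_pos h7]
      cases hl : E.findLine ℓ c with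
      | none => exact .inl rfl
      | some l =>
        dsimp only
        rw [h2]
        by_cases h8 : E.validCert ℓ c (Function.update ((s.ballot ℓ).sigs c) j (some σ))
        swap
        · rw [if_neg h8, if_neg h8]; exact .inl rfl
        rw [if_pos h8, if_pos h8, h5, h6]
        rcases hsh ℓ c l hl with h9 | ⟨h9, h10⟩
        · rw [h9]; exact .inl rfl
        · right
          exact hall ℓ c _ _ h9 h10
    · rename_i j ℓ c sh' u
      have h1 : (E.withShare sh).findLine ℓ c = E.findLine ℓ c := rfl
      have h2 : ∀ u : UCert P, (E.withShare sh).validCert ℓ c u = E.validCert ℓ c u := fun _ => rfl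
      have h3 : (E.withShare sh).data.pub = E.data.pub := rfl
      have h5 : (E.withShare sh).me = E.me := rfl
      have h6 : (E.withShare sh).data.share = sh := rfl
      have h7 : ∀ b, tryReceipt (E.withShare sh) ℓ c b = tryReceipt E ℓ c b := fun _ => rfl
      unfold onVoteP
      dsimp only
      rw [h1]
      cases hl : E.findLine ℓ c with
      | none => exact .inl rfl
      | some l =>
        dsimp only
        rw [h2, h3]
        by_cases h8 : s.clock < P.Tend ∧ E.validCert ℓ c u ∧
          P.receiptVSS.verify (E.data.pub ℓ l.1 l.2) j sh' = true
        swap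
        · rw [if_neg h8, if_neg h8]; exact .inl rfl
        rw [if_pos h8, if_pos h8, h5, h6]
        cases hu : (s.ballot ℓ).used with
        | some x => exact .inl rfl
        | none =>
          dsimp only
          rcases hsh ℓ c l hl with h9 | ⟨h9, h10⟩
          · rw [h9, h7]; exact .inl rfl
          · right
            obtain ⟨a1, a2, a3, h11⟩ := hall ℓ c (E.data.share ℓ l.1 l.2) u h9 h10
            exact ⟨a1, a2, a3, List.mem_append_left _ h11⟩
    · exact .inl rfl
    · exact .inl rfl
    · exact .inl rfl
    · exact .inl rfl
  rcases key with h | ⟨a1, a2, a3, h⟩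
  · left
    rw [h]; rfl
  · right
    exact ⟨a1, a2, a3, List.mem_append_left _ h⟩

/-- Digests and salts do not involve receipts, and the public sharing data agree by assumption, so
only shares can change. -/
theorem vcData_setLine {su : Setup P} {v : Fin P.n} {X : Bool} {o : Fin P.m}
    {T : Finset (Fin P.Nv)} {s : Receipt} {r : P.receiptVSS.Coins}
    (h : SameShares su v X o T s r) (i : Fin P.Nv) :
    (su.setLine v X o s r).vcData i =
      { su.vcData i with share := ((su.setLine v X o s r).vcData i).share } := by
  have : ((su.setLine v X o s r).vcData i).pub = (su.vcData i).pub := by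
    funext ℓ Y p
    simp only [Setup.vcData, Setup.setLine]
    split_ifs with hc
    · obtain ⟨rfl, rfl, hc⟩ := hc
      rw [h.1, hc]
    · rfl
  calc (su.setLine v X o s r).vcData i
      = { su.vcData i with
          share := ((su.setLine v X o s r).vcData i).share
          pub := ((su.setLine v X o s r).vcData i).pub } := rfl
    _ = _ := by rw [this]

theorem share_setLine {su : Setup P} {v : Fin P.n} {X : Bool} {o : Fin P.m}
    (s : Receipt) (r : P.receiptVSS.Coins) (i : Fin P.Nv) (ℓ : Fin P.n) (Y : Bool)
    (p : Fin P.m) : ((su.setLine v X o s r).vcData i).share ℓ Y p = (su.vcData i).share ℓ Y p ∨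
      (ℓ = v ∧ Y = X ∧ su.shuffle ℓ Y p = o ∧
        ((su.setLine v X o s r).vcData i).share ℓ Y p = P.receiptVSS.share s r i) := by
  simp only [Setup.vcData, Setup.setLine]
  by_cases hc : ℓ = v ∧ Y = X ∧ su.shuffle ℓ Y p = o
  · right
    rw [if_pos hc, if_pos hc]
    exact ⟨hc.1, hc.2.1, hc.2.2, rfl⟩
  · left
    rw [if_neg hc, if_neg hc]

theorem vcData_setLine_of_mem {su : Setup P} {v : Fin P.n} {X : Bool} {o : Fin P.m}
    {T : Finset (Fin P.Nv)} {s : Receipt} {r : P.receiptVSS.Coins}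
    (h : SameShares su v X o T s r) {i : Fin P.Nv} (hi : i ∈ T) :
    (su.setLine v X o s r).vcData i = su.vcData i := by
  rw [vcData_setLine h]
  have : ((su.setLine v X o s r).vcData i).share = (su.vcData i).share := by
    funext ℓ Y p
    rcases share_setLine (su := su) (v := v) (X := X) (o := o) s r i ℓ Y p with h1 |
      ⟨rfl, rfl, rfl, h1⟩
    · exact h1
    · rw [h1, h.2 i hi]; rfl
  rw [this]

theorem mem_log_step {I : Instance P} {st : State P} {a : Action P}
    {ans : SigQuery P.Nv → Bits} {e : Envelope P}
    (h : e ∈ ((applyAction I st a).eval ans).1.2) : e ∈ ((step I st a).eval ans).1.1.log := by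
  rw [step_eq]
  simp only [SigComp.eval_bind, SigComp.eval_pure, finishMove]
  exact List.mem_append_right _ h

theorem log_receive (I : Instance P) (st : State P) (e : Envelope P)
    (ans : SigQuery P.Nv → Bits) : ((receive I st e).eval ans).1.1.log = st.log := by
  unfold receive
  split_ifs
  · rfl
  · split <;> simp

theorem log_step (I : Instance P) (st : State P) (a : Action P) (ans : SigQuery P.Nv → Bits) :
    ∀ e ∈ st.log, e ∈ ((step I st a).eval ans).1.1.log := by
  have h : ((applyAction I st a).eval ans).1.1.log = st.log := by
    unfold applyAction
    split
    · rfl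
    · split_ifs
      · rfl
      · unfold tickNode; split <;> rfl
    · split
      · exact log_receive _ _ _ _
      · rfl
    · split_ifs
      · exact log_receive _ _ _ _
      · rfl
    · rfl
    · split_ifs <;> rfl
    · split_ifs <;> rfl
  intro e he
  rw [step_eq]
  simp only [SigComp.eval_bind, SigComp.eval_pure, finishMove]
  exact List.mem_append_left _ (h ▸ he)

/-- The instance with another receipt on one ballot line. -/
def Instance.setLine (I : Instance P) (v : Fin P.n) (X : Bool) (o : Fin P.m) (s : Receipt)
    (r : P.receiptVSS.Coins) : Instance P :=
  { I with su := I.su.setLine v X o s r }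

/-- Messages to `v` are left out because she compares them with the receipt itself. For any other
recipient, a difference can arise only at a vote collector outside `T` that discloses its share. -/
theorem receive_setLine {I : Instance P} {v : Fin P.n} {o : Fin P.m} {X : Bool}
    {T : Finset (Fin P.Nv)} {s : Receipt} {r : P.receiptVSS.Coins}
    (h : SameShares I.su v X o T s r) (st : State P) {e : Envelope P}
    (he : e.dst ≠ .voter v) (ans : SigQuery P.Nv → Bits) :
    (receive (I.setLine v X o s r) st e).eval ans = (receive I st e).eval ans ∨
    ∃ i, i ∉ T ∧ ∃ sh u dst, (⟨.vc i, .voteP v (I.su.code v (X, o)) sh u, dst⟩ : Envelope P) ∈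
      ((receive I st e).eval ans).1.2 := by
  obtain ⟨src, msg, dst⟩ := e
  by_cases hc : Corrupt I.C st dst
  · have hc' : Corrupt (I.setLine v X o s r).C st dst := hc
    left
    simp only [receive, if_pos hc, if_pos hc']
  have hc' : ¬ Corrupt (I.setLine v X o s r).C st dst := hc
  simp only [receive, if_neg hc, if_neg hc']
  cases dst with
  | bb b => exact .inl rfl
  | trustee t => exact .inl rfl
  | client => exact .inl rfl
  | voter ℓ =>
    left
    dsimp only
    have hℓ : ℓ ≠ v := fun hh => he (by rw [hh])
    have h1 : (I.setLine v X o s r).su.receipt ℓ = I.su.receipt ℓ := by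
      funext Y p
      simp [Instance.setLine, Setup.setLine, hℓ]
    rw [voterReceive_congr (su := I.su) (su' := (I.setLine v X o s r).su) rfl h1 rfl rfl]
  | vc i =>
    dsimp only
    simp only [SigComp.eval_bind, SigComp.eval_pure, List.append_nil]
    by_cases hi : i ∈ T
    · left
      have h1 : (I.setLine v X o s r).env i = I.env i := by
        simp only [Instance.env, Instance.setLine, vcData_setLine_of_mem h hi]
      rw [h1]
    · have h1 : (I.setLine v X o s r).env i =
          (I.env i).withShare (((I.su.setLine v X o s r).vcData i).share) := by
        simp only [Instance.env, Instance.setLine, VCEnv.withShare]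
        rw [vcData_setLine h]
      rw [h1]
      have h2 : ∀ ℓ c l, (I.env i).findLine ℓ c = some l →
          ((I.su.setLine v X o s r).vcData i).share ℓ l.1 l.2 =
            (I.env i).data.share ℓ l.1 l.2 ∨ (ℓ = v ∧ c = I.su.code v (X, o)) := by
        intro ℓ c l hl
        rcases share_setLine (su := I.su) (v := v) (X := X) (o := o) s r i ℓ l.1 l.2 with h3 |
          ⟨h3, h4, h5, -⟩
        · exact .inl h3
        · right
          refine ⟨h3, ?_⟩
          rw [← findLine_spec hl, h5, h4, h3]
      rcases vcReceive_withShare h2 i (st.vc i) src msg ans with h3 | ⟨sh, u, dst, h3⟩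
      · left; rw [h3]
      · exact .inr ⟨i, hi, sh, u, dst, h3⟩

/-- As long as only vote collectors in `T` disclose their shares of a receipt, a voter who rejects
all receipts takes part in the same execution for any receipt with the same shares. -/
theorem step_rejecting_setLine {I : Instance P} {v : Fin P.n} {o : Fin P.m} {X : Bool}
    {T : Finset (Fin P.Nv)} {s : Receipt} {r : P.receiptVSS.Coins}
    (h : SameShares I.su v X o T s r) {st : State P} {a : Action P} (ha : a ≠ .corrupt v)
    (ans : SigQuery P.Nv → Bits)
    (hT : disclosers ((step (I.rejecting v st a) st a).eval ans).1.1 v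
      (I.su.code v (X, o)) ⊆ T) :
    (step ((I.setLine v X o s r).rejecting v st a) st a).eval ans =
      (step (I.rejecting v st a) st a).eval ans := by
  cases hr : replyTo v st a with
  | some ρ =>
    -- When a receipt `ρ` reaches `v`, both instances overwrite all receipts of her ballot by `ρ +
    -- 1`, which erases the difference.
    rw [rejecting_of_reply hr, rejecting_of_reply hr]
    obtain ⟨src, ℓ, ht⟩ := replyTo_eq_some.1 hr
    refine step_eval_congr (I := { I with su := I.su.avoid v ρ })
      (I' := { I.setLine v X o s r with su := (I.setLine v X o s r).su.avoid v ρ }) ht rfl ans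
      fun st0 _ _ => .inl ?_
    rw [receive_voter, receive_voter]
    dsimp only
    rw [voterReceive_congr (su := I.su.avoid v ρ) (su' := (I.setLine v X o s r).su.avoid v ρ)
      rfl (by simp [Setup.avoid]) rfl rfl]
  | none =>
    rw [rejecting_of_none hr] at hT
    rw [rejecting_of_none hr, rejecting_of_none hr]
    cases ht : target st a with
    | some e =>
      refine step_eval_congr (I := I) (I' := I.setLine v X o s r) ht rfl ans
        fun st0 h1 h2 => .inl ?_
      by_cases hv : e.dst = .voter v
      · obtain ⟨src, msg, dst⟩ := e
        obtain rfl : dst = .voter v := hv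
        have hmsg : ∀ su, voterReceive su v (st0.voter v) src msg = (st0.voter v, []) := by
          intro su
          unfold voterReceive
          split
          · rename_i ℓ ρ _ _
            rw [(replyTo_eq_some (r := ρ)).2 ⟨_, ℓ, ht⟩] at hr
            cases hr
          · rfl
        rw [receive_voter, receive_voter, hmsg, hmsg]
      · refine (receive_setLine h st0 hv ans).resolve_right ?_
        rintro ⟨i, hi, sh, u, dst, hmem⟩
        rw [← h2] at hmem
        exact hi (hT (mem_disclosers.2 ⟨sh, u, dst, mem_log_step hmem⟩))
    | none =>
      -- Corruption of another voter reveals only an unchanged ballot.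
      have hrec : ∀ ℓ, a = .corrupt ℓ → (I.setLine v X o s r).su.receipt ℓ = I.su.receipt ℓ := by
        rintro ℓ rfl
        have hℓ : ℓ ≠ v := fun hh => ha (by rw [hh])
        funext Y p
        simp [Instance.setLine, Setup.setLine, hℓ]
      have happ : (applyAction (I.setLine v X o s r) st a).eval ans =
          (applyAction I st a).eval ans := by
        cases a with
        | tickNode Y => cases Y <;> rfl
        | deliver k =>
          have ht' : st.log[k]? = none := ht
          simp only [applyAction, ht']
        | inject e => simp [target] at ht
        | _ => rfl
      rw [step_eq, step_eq]
      simp only [SigComp.eval_bind, SigComp.eval_pure, happ]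
      rw [finishMove_congr]
      intro ℓ hℓ
      exact ⟨rfl, hrec ℓ hℓ, rfl, rfl⟩

/-- The set `T` is recorded when the guess is made, and disclosers only accumulate, so it contains
those of every earlier state. -/
theorem disclosers_subset_of_guess {I : Instance P} {v : Fin P.n} {o : Fin P.m}
    {T : Finset (Fin P.Nv)} {ρ : Receipt} (act : List (Obs P) → Action P)
    (tape : List (SigQuery P.Nv → Bits)) {st : State P} (past : List (Obs P)) {g : ℕ}
    (hg : (guesses I v act tape st past)[g]? = some (o, T, ρ)) :
    disclosers st v (I.su.code v (I.su.part v, o)) ⊆ T := by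
  replace hg := List.mem_of_getElem? hg
  induction tape generalizing st past with
  | nil => simp [guesses] at hg
  | cons ans t ih =>
    simp only [guesses, List.mem_append, Option.mem_toList] at hg
    rcases hg with hg | hg
    · obtain ⟨i, r, o', -, -, -, -, -, h⟩ := guess_isSome hg
      simp only [Prod.mk.injEq] at h
      obtain ⟨rfl, rfl, -⟩ := h
      exact subset_rfl
    · split_ifs at hg
      · simp at hg
      · exact (disclosers_subset (log_step _ _ _ _) _ _).trans (ih _ hg)

/-- Up to the `g`-th guess only nodes in `T` disclose, and these hold the same shares in both
setups. The rejecting runs therefore coincide move by move until that guess. -/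
theorem guesses_setLine {I : Instance P} {v : Fin P.n} {o : Fin P.m}
    {T : Finset (Fin P.Nv)} {s : Receipt} {r : P.receiptVSS.Coins} {ρ : Receipt}
    (h : SameShares I.su v (I.su.part v) o T s r) (act : List (Obs P) → Action P)
    (tape : List (SigQuery P.Nv → Bits)) {st : State P} (past : List (Obs P)) {g : ℕ}
    (hg : (guesses I v act tape st past)[g]? = some (o, T, ρ)) :
    (guesses (I.setLine v (I.su.part v) o s r) v act tape st past)[g]? = some (o, T, ρ) := by
  induction tape generalizing st past g with
  | nil => simp [guesses] at hg
  | cons ans t ih =>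
    have hguess : guess (I.setLine v (I.su.part v) o s r) v st (act past) =
        guess I v st (act past) := rfl
    simp only [guesses] at hg ⊢
    rw [hguess]
    rw [List.getElem?_append] at hg ⊢
    by_cases h1 : g < (guess I v st (act past)).toList.length
    · rw [if_pos h1] at hg ⊢
      exact hg
    · rw [if_neg h1] at hg ⊢
      by_cases h2 : act past = .corrupt v
      · rw [if_pos h2] at hg
        simp at hg
      · rw [if_neg h2] at hg ⊢
        have hT := disclosers_subset_of_guess _ _ _ hg
        rw [step_rejecting_setLine h h2 ans hT]
        exact ih _ hg

/-- The receipts that a voter gets if she rejects all of them, in the whole execution. -/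
noncomputable def allGuesses (C : Corruption P) (keys : Fin P.Nv → Bits × Bits)
    (ver : (pk msg sig : Bits) → Bool) (act : InitView P → List (Obs P) → Action P)
    (tape : List (SigQuery P.Nv → Bits)) (v : Fin P.n) (su : Setup P) :
    List (Fin P.m × Finset (Fin P.Nv) × Receipt) :=
  guesses ⟨su, C, fun i => (keys i).1, ver⟩ v (act (initView su C keys)) tape (State.init P) []

/-- The adversary is handed the shares of the corrupted nodes at the start, so these must agree in
addition to those of `T`. -/
theorem initView_setLine {su : Setup P} {C : Corruption P} (keys : Fin P.Nv → Bits × Bits)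
    {v : Fin P.n} {X : Bool} {o : Fin P.m} {T : Finset (Fin P.Nv)} {s : Receipt}
    {r : P.receiptVSS.Coins} (h : SameShares su v X o (T ∪ C.vc) s r) :
    initView (su.setLine v X o s r) C keys = initView su C keys := by
  have h1 : ∀ i, (if i ∈ C.vc then some ((su.setLine v X o s r).vcData i) else none) =
      if i ∈ C.vc then some (su.vcData i) else none := by
    intro i
    split_ifs with hi
    · rw [vcData_setLine_of_mem h (Finset.mem_union_right _ hi)]
    · rfl
  unfold initView
  congr 1
  exact funext h1

end
end DDemos

namespace DDemos

/-! ### Resampling an undisclosed receipt -/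

section
open scoped Classical
open scoped ENNReal

/-- Only one value of the first draw can lead to the outcome. -/
theorem bind_apply_eq {α β : Type*} (p : PMF α) {f : α → PMF β} {x : β} {a : α} {y : ℝ≥0∞}
    (h : ∀ b, x ∈ (f b).support → b = a) (hy : f a x = y) : (p.bind f) x = p a * y := by
  rw [PMF.bind_apply, ← hy]
  refine tsum_eq_single a fun b hb => ?_
  rw [PMF.apply_eq_zero_iff _ x |>.2 fun hx => hb (h b hx), mul_zero]

/-- A distribution with constant mass is invariant under bijections. -/
theorem map_equiv_of_const {α : Type*} {p : PMF α} (h : ∀ a b, p a = p b) (e : α ≃ α) :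
    p.map e = p := by
  ext x
  rw [PMF.map_apply, tsum_eq_single (e.symm x)]
  · simp [h (e.symm x) x]
  · intro b hb
    rw [if_neg]
    rintro rfl
    simp at hb

variable {P : Params}

/-- The twelve components are independent and uniform, and each is a field of the record, so the
mass of a setup is a product of constants. -/
theorem setupDist_const (su su' : Setup P) : setupDist P su = setupDist P su' := by
  have key : ∀ su : Setup P, setupDist P su =
      PMF.uniformOfFintype (Fin P.n → (Bool × Fin P.m) ↪ Code) su.code *
      (PMF.uniformOfFintype (Fin P.n → Bool → Fin P.m → Receipt) su.receipt *
      (PMF.uniformOfFintype (Fin P.n → Bool → Equiv.Perm (Fin P.m)) su.shuffle *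
      (PMF.uniformOfFintype (Fin P.n → Bool → Fin P.m → Salt) su.codeSalt *
      (PMF.uniformOfFintype (Fin P.n → Bool → Fin P.m → BitVec 128) su.iv *
      (PMF.uniformOfFintype (Fin P.n → Bool → Fin P.m → P.receiptVSS.Coins) su.receiptCoins *
      (PMF.uniformOfFintype Key su.msk *
      (PMF.uniformOfFintype Salt su.mskSalt *
      (PMF.uniformOfFintype P.keyVSS.Coins su.mskCoins *
      (PMF.uniformOfFintype (Fin P.n → Bool → Fin P.m → Fin P.m → Fin P.ht → Opening P) su.coeffs *
      (PMF.uniformOfFintype (Fin P.n → Bool) su.part *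
      (PMF.uniformOfFintype (Fin P.n → Equiv.Perm (Fin P.Nv)) su.order * 1))))))))))) := by
    rintro ⟨_, _, _, _, _, _, _, _, _, _, _, _⟩
    unfold setupDist
    iterate 12
      refine bind_apply_eq _ (fun b hb => ?_) ?_
      · revert hb
        simp only [Bind.bind, Pure.pure, PMF.mem_support_bind_iff, PMF.support_uniformOfFintype,
          PMF.support_pure, Set.mem_singleton_iff, Set.top_eq_univ, Set.mem_univ, true_and,
          forall_exists_index, Setup.mk.injEq]
        intros
        simp_all only
    exact if_pos rfl
  rw [key, key]
  simp only [PMF.uniformOfFintype_apply]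

/-- Exchange of the receipt of one line of the part used by voter `v` and of its coins. -/
def swapLine (v : Fin P.n) (o : Fin P.m) :
    Setup P × Receipt × P.receiptVSS.Coins ≃ Setup P × Receipt × P.receiptVSS.Coins :=
  Function.Involutive.toPerm
    (fun x => (x.1.setLine v (x.1.part v) o x.2.1 x.2.2,
      x.1.receipt v (x.1.part v) o, x.1.receiptCoins v (x.1.part v) o)) (by
    -- The exchange does not alter the part, so a second application acts on the same line and
    -- restores it.
    rintro ⟨su, s, r⟩
    have h1 : ∀ ℓ Y p, (if ℓ = v ∧ Y = su.part v ∧ p = o then su.receipt v (su.part v) o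
        else if ℓ = v ∧ Y = su.part v ∧ p = o then s else su.receipt ℓ Y p) =
        su.receipt ℓ Y p := by
      intro ℓ Y p
      split_ifs with h
      · obtain ⟨rfl, rfl, rfl⟩ := h; rfl
      · rfl
    have h2 : ∀ ℓ Y p, (if ℓ = v ∧ Y = su.part v ∧ p = o then su.receiptCoins v (su.part v) o
        else if ℓ = v ∧ Y = su.part v ∧ p = o then r else su.receiptCoins ℓ Y p) =
        su.receiptCoins ℓ Y p := by
      intro ℓ Y p
      split_ifs with h
      · obtain ⟨rfl, rfl, rfl⟩ := h; rfl
      · rfl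
    simp only [Setup.setLine, h1, h2, and_self, if_true])

/-- The law `Q` of a setup with a fresh receipt and fresh coins has constant mass, hence is
invariant under `swapLine`. Comparing first marginals gives the claim, also though the line depends
on the part drawn in the setup. -/
theorem setupDist_resample (v : Fin P.n) (o : Fin P.m) :
    setupDist P = (setupDist P).bind fun su => (PMF.uniformOfFintype Receipt).bind fun s =>
      (PMF.uniformOfFintype P.receiptVSS.Coins).map fun r => su.setLine v (su.part v) o s r := by
  let Q : PMF (Setup P × Receipt × P.receiptVSS.Coins) := (setupDist P).bind fun su =>
    (PMF.uniformOfFintype Receipt).bind fun s =>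
      (PMF.uniformOfFintype P.receiptVSS.Coins).bind fun r => PMF.pure (su, s, r)
  have hQ : ∀ a b, Q a = Q b := by
    have key : ∀ a, Q a = setupDist P a.1 * (PMF.uniformOfFintype Receipt a.2.1 *
        (PMF.uniformOfFintype P.receiptVSS.Coins a.2.2 * 1)) := by
      rintro ⟨su, s, r⟩
      iterate 3
        refine bind_apply_eq _ (fun b hb => ?_) ?_
        · revert hb
          simp only [PMF.mem_support_bind_iff, PMF.support_pure, Set.mem_singleton_iff,
            Prod.mk.injEq]
          rintro hb
          simp_all
      exact if_pos rfl
    intro a b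
    rw [key, key, setupDist_const a.1 b.1]
    simp only [PMF.uniformOfFintype_apply]
  have h1 : Q.map Prod.fst = setupDist P := by
    simp only [Q, PMF.map_bind, PMF.pure_map, PMF.bind_const, PMF.bind_pure]
  have h2 := congrArg (PMF.map Prod.fst) (map_equiv_of_const hQ (swapLine v o))
  rw [h1] at h2
  refine h2.symm.trans ?_
  simp only [Q, PMF.map_bind, PMF.pure_map]
  rfl

theorem uniform_receipt (ρ : Receipt) :
    PMF.uniformOfFintype Receipt ρ = (2 ^ 64 : ℝ≥0∞)⁻¹ := by
  rw [PMF.uniformOfFintype_apply, Fintype.card_congr (BitVec.equivFin (m := 64)).toEquiv,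
    Fintype.card_fin]
  norm_num

/-- An event that, given the public data and fewer than the threshold of the shares, does not
depend on a receipt, is independent of that receipt. -/
theorem measure_receipt_eq (v : Fin P.n) (o : Fin P.m) {T : Finset (Fin P.Nv)}
    (hT : T.card < P.Nv - P.fv) {E : Set (Setup P)}
    (hE : ∀ su s r, SameShares su v (su.part v) o T s r → su ∈ E →
      su.setLine v (su.part v) o s r ∈ E) (ρ : Receipt) :
    (setupDist P).toOuterMeasure {su | su ∈ E ∧ su.receipt v (su.part v) o = ρ} =
      PMF.uniformOfFintype Receipt ρ * (setupDist P).toOuterMeasure E := by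
  have hset : ∀ (su : Setup P) s r s' r',
      (su.setLine v (su.part v) o s r).setLine v (su.part v) o s' r' =
        su.setLine v (su.part v) o s' r' := by
    intro su s r s' r'
    simp only [Setup.setLine]
    congr 1 <;> (funext ℓ Y p; split_ifs <;> rfl)
  have hrec : ∀ (su : Setup P) s r, (su.setLine v (su.part v) o s r).receipt v (su.part v) o = s ∧
      (su.setLine v (su.part v) o s r).receiptCoins v (su.part v) o = r := by
    intro su s r; simp [Setup.setLine]
  have hpart : ∀ (su : Setup P) s r, (su.setLine v (su.part v) o s r).part = su.part :=
    fun _ _ _ => rfl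
  let view : Receipt → P.receiptVSS.Coins → P.receiptVSS.Pub × (T → P.receiptVSS.Share) :=
    fun s r => (P.receiptVSS.pub s r, fun i : T => P.receiptVSS.share s r i)
  have hview : ∀ (su : Setup P) s r s' r', view s r = view s' r' →
      su.setLine v (su.part v) o s r ∈ E → su.setLine v (su.part v) o s' r' ∈ E := by
    intro su s r s' r' h hs
    have := hE (su.setLine v (su.part v) o s r) s' r' ?_ hs
    · rw [hpart, hset] at this; exact this
    · simp only [view, Prod.mk.injEq] at h
      rw [hpart]
      unfold SameShares
      rw [(hrec su s r).1, (hrec su s r).2]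
      exact ⟨h.1.symm, fun i hi => (congrFun h.2 ⟨i, hi⟩).symm⟩
  -- Membership in `E` depends on the line only through public data and the shares in `T`, and by
  -- secrecy their law is the same for all receipts.
  have hconst : ∀ (su : Setup P) s s',
      (PMF.uniformOfFintype P.receiptVSS.Coins).toOuterMeasure
        {r | su.setLine v (su.part v) o s r ∈ E} =
      (PMF.uniformOfFintype P.receiptVSS.Coins).toOuterMeasure
        {r | su.setLine v (su.part v) o s' r ∈ E} := by
    intro su s s'
    let S : Set (P.receiptVSS.Pub × (T → P.receiptVSS.Share)) :=
      {κ | ∃ s r, view s r = κ ∧ su.setLine v (su.part v) o s r ∈ E}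
    have h1 : ∀ s, {r | su.setLine v (su.part v) o s r ∈ E} = view s ⁻¹' S := by
      intro s
      ext r
      exact ⟨fun h => ⟨s, r, rfl, h⟩, fun ⟨s', r', h, h'⟩ => hview su s' r' s r h h'⟩
    rw [h1, h1, ← PMF.toOuterMeasure_map_apply, ← PMF.toOuterMeasure_map_apply]
    exact congrArg (fun p : PMF _ => p.toOuterMeasure S) (P.receiptVSS.secrecy T hT s s')
  -- By `hconst` the fresh receipt may be taken to be `ρ` throughout, so averaging over it changes
  -- nothing.
  have hright : (setupDist P).toOuterMeasure E = ∑' su, setupDist P su *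
      (PMF.uniformOfFintype P.receiptVSS.Coins).toOuterMeasure
        {r | su.setLine v (su.part v) o ρ r ∈ E} := by
    conv_lhs => rw [setupDist_resample v o]
    simp only [PMF.toOuterMeasure_bind_apply, PMF.toOuterMeasure_map_apply]
    refine tsum_congr fun su => congrArg _ ?_
    calc _ = ∑' s, PMF.uniformOfFintype Receipt s *
        (PMF.uniformOfFintype P.receiptVSS.Coins).toOuterMeasure
          {r | su.setLine v (su.part v) o ρ r ∈ E} :=
          tsum_congr fun s => congrArg _ (hconst su s ρ)
      _ = _ := by rw [ENNReal.tsum_mul_right, PMF.tsum_coe, one_mul]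
  have hleft : (setupDist P).toOuterMeasure {su | su ∈ E ∧ su.receipt v (su.part v) o = ρ} =
      ∑' su, setupDist P su * (PMF.uniformOfFintype Receipt ρ *
      (PMF.uniformOfFintype P.receiptVSS.Coins).toOuterMeasure
        {r | su.setLine v (su.part v) o ρ r ∈ E}) := by
    conv_lhs => rw [setupDist_resample v o]
    simp only [PMF.toOuterMeasure_bind_apply, PMF.toOuterMeasure_map_apply]
    refine tsum_congr fun su => congrArg _ ?_
    -- After resampling the receipt of the line is `s`, so only `s = ρ` contributes.
    rw [tsum_eq_single ρ]
    · congr 2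
      ext r
      simp only [Set.mem_preimage, Set.mem_ofPred_eq, hpart, (hrec su ρ r).1, and_true]
    · intro s hs
      have : ((fun r => su.setLine v (su.part v) o s r) ⁻¹'
          {su | su ∈ E ∧ su.receipt v (su.part v) o = ρ}) = ∅ := by
        ext r
        simp only [Set.mem_preimage, Set.mem_ofPred_eq, hpart, (hrec su s r).1, hs, and_false,
          Set.mem_empty_iff_false]
      rw [this, MeasureTheory.measure_empty, mul_zero]
  rw [hleft, hright, ← ENNReal.tsum_mul_left]
  exact tsum_congr fun su => by ring

/-- The setup makes a voter accept a receipt of which few shares are disclosed. -/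
def Guessed (C : Corruption P) (keys : Fin P.Nv → Bits × Bits)
    (ver : (pk msg sig : Bits) → Bool) (act : InitView P → List (Obs P) → Action P)
    (tape : List (SigQuery P.Nv → Bits)) (v : Fin P.n) (su : Setup P) : Prop :=
  ∃ o, ∃ T : Finset (Fin P.Nv), T.card < P.Nv - 2 * P.fv ∧
    (o, T, su.receipt v (su.part v) o) ∈ allGuesses C keys ver act tape v su

/-- For each index `g`, the value of the `g`-th guess, including its set of disclosers, splits the
setups into disjoint events. On each one with few disclosers the true receipt is uniform and hits
the guess with probability `2⁻⁶⁴`. -/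
theorem measure_guessed_le (C : Corruption P) (hC : C.vc.card ≤ P.fv)
    (keys : Fin P.Nv → Bits × Bits)
    (ver : (pk msg sig : Bits) → Bool) (act : InitView P → List (Obs P) → Action P)
    (tape : List (SigQuery P.Nv → Bits)) (v : Fin P.n) :
    (setupDist P).toOuterMeasure {su | Guessed C keys ver act tape v su} ≤
      P.fv * (2 ^ 64 : ℝ≥0∞)⁻¹ := by
  let G := allGuesses C keys ver act tape v
  let E : ℕ → Fin P.m × Finset (Fin P.Nv) × Receipt → Set (Setup P) :=
    fun g x => {su | (G su)[g]? = some x}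
  let small : Finset (Fin P.m × Finset (Fin P.Nv) × Receipt) :=
    Finset.univ.filter fun x => x.2.1.card < P.Nv - 2 * P.fv
  have hsub : {su | Guessed C keys ver act tape v su} ⊆
      ⋃ g ∈ Finset.range P.fv, ⋃ x ∈ small, {su | su ∈ E g x ∧ su.receipt v (su.part v) x.1 = x.2.2} := by
    rintro su ⟨o, T, hT, h⟩
    obtain ⟨g, hg, h⟩ := List.mem_iff_getElem.1 h
    have hlen : g < P.fv := hg.trans_le ((length_guesses_le _ _ _ _ _).trans hC)
    simp only [Set.mem_iUnion]
    exact ⟨g, Finset.mem_range.2 hlen, (o, T, su.receipt v (su.part v) o),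
      by simp [small, hT], List.getElem?_eq_some_iff.2 ⟨hg, h⟩, rfl⟩
  -- The `g`-th guess takes one value at most, so these probabilities are masses of a single
  -- distribution.
  have hone : ∀ g, ∑ x ∈ small, (setupDist P).toOuterMeasure (E g x) ≤ 1 := by
    intro g
    calc ∑ x ∈ small, (setupDist P).toOuterMeasure (E g x)
        ≤ ∑ x, (setupDist P).toOuterMeasure (E g x) :=
          Finset.sum_le_sum_of_subset (Finset.subset_univ _)
      _ = ∑ x, ((setupDist P).map fun su => (G su)[g]?) (some x) := by
          refine Finset.sum_congr rfl fun x _ => ?_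
          rw [← PMF.toOuterMeasure_apply_singleton, PMF.toOuterMeasure_map_apply]
          rfl
      _ = ∑' x, ((setupDist P).map fun su => (G su)[g]?) (some x) := (tsum_fintype _).symm
      _ ≤ ∑' y, ((setupDist P).map fun su => (G su)[g]?) y :=
          ENNReal.tsum_comp_le_tsum_of_injective (Option.some_injective _) _
      _ = 1 := PMF.tsum_coe _
  have hcond : ∀ g, ∀ x ∈ small, (setupDist P).toOuterMeasure
      {su | su ∈ E g x ∧ su.receipt v (su.part v) x.1 = x.2.2} =
      (2 ^ 64 : ℝ≥0∞)⁻¹ * (setupDist P).toOuterMeasure (E g x) := by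
    rintro g ⟨o, T, ρ⟩ hx
    simp only [small, Finset.mem_filter, Finset.mem_univ, true_and] at hx
    rw [← uniform_receipt ρ]
    -- Fewer than `Nv - 2 * fv` disclosers and at most `fv` corrupted nodes stay below the threshold
    -- `Nv - fv`.
    refine measure_receipt_eq v o (T := T ∪ C.vc) ?_ ?_ ρ
    · have := Finset.card_union_le T C.vc
      omega
    · intro su s r hsr hsu
      change (allGuesses C keys ver act tape v _)[g]? = _
      unfold allGuesses
      rw [initView_setLine keys hsr]
      exact guesses_setLine (I := ⟨su, C, fun i => (keys i).1, ver⟩)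
        ⟨hsr.1, fun i hi => hsr.2 i (Finset.mem_union_left _ hi)⟩ _ _ _ hsu
  calc _ ≤ (setupDist P).toOuterMeasure (⋃ g ∈ Finset.range P.fv, ⋃ x ∈ small,
        {su | su ∈ E g x ∧ su.receipt v (su.part v) x.1 = x.2.2}) :=
        (setupDist P).toOuterMeasure.mono hsub
    _ ≤ ∑ g ∈ Finset.range P.fv, ∑ x ∈ small, (setupDist P).toOuterMeasure
        {su | su ∈ E g x ∧ su.receipt v (su.part v) x.1 = x.2.2} :=
        (MeasureTheory.measure_biUnion_finset_le _ _).trans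
          (Finset.sum_le_sum fun g _ => MeasureTheory.measure_biUnion_finset_le _ _)
    _ ≤ ∑ g ∈ Finset.range P.fv, (2 ^ 64 : ℝ≥0∞)⁻¹ := by
        refine Finset.sum_le_sum fun g _ => ?_
        rw [Finset.sum_congr rfl (hcond g), ← Finset.mul_sum]
        exact mul_le_of_le_one_right' (hone g)
    _ = _ := by simp

/-! ### The bound -/

/-- Without forgery, a voter with many disclosers is safe, so a violation exhibits a voter with few,
whose accepted receipt was a guess. -/
theorem safetyBroken_cases (S : SignatureScheme) (k : ℕ) (hfv : 3 * P.fv < P.Nv) (hht : 1 ≤ P.ht)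
    (su : Setup P) (C : Corruption P) (hC : C.vc.card ≤ P.fv) (keys : Fin P.Nv → Bits × Bits)
    (act : InitView P → List (Obs P) → Action P) (tape : List (SigQuery P.Nv → Bits))
    {l0 : List (SigQuery P.Nv)} (hl0 : ∀ q ∈ l0, ∃ i, q = .pubKey i ∨ (i ∈ C.vc ∧ q = .secKey i))
    {st : State P} {L : List (SigQuery P.Nv)}
    (hst : playWith ⟨su, C, fun i => (keys i).1, S.verify k⟩ (act (initView su C keys)) tape
      (State.init P) [] = (st, L))
    (h : SafetyBroken su C st) :
    IsForgery S k keys (candidates st) (l0 ++ L) ∨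
      ∃ v, Guessed C keys (S.verify k) act tape v su := by
  by_contra hcon
  rw [not_or] at hcon
  obtain ⟨hF, hG⟩ := hcon
  let I : Instance P := ⟨su, C, fun i => (keys i).1, S.verify k⟩
  obtain ⟨-, hI, hQ⟩ := playWith_spec (act (initView su C keys)) tape (inv_init I) []
  rw [hst] at hI hQ
  -- Secret keys were requested only for corrupted nodes, and every signing request left a permanent
  -- endorsement. A valid candidate of an honest signer without a matching endorsement is therefore
  -- a fresh forgery.
  have hN : NoForgery I st := by
    intro x hx hxC hver
    by_contra hno
    refine hF ⟨x, hx, fun hs => ?_, fun hs => ?_, hver⟩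
    · rcases List.mem_append.1 hs with hs | hs
      · obtain ⟨i, hi | ⟨hi, hi'⟩⟩ := hl0 _ hs
        · cases hi
        · cases hi'; exact hxC hi
      · obtain ⟨i, ℓ, c, -, h1, -⟩ := hQ _ hs
        cases h1
    · rcases List.mem_append.1 hs with hs | hs
      · obtain ⟨i, hi | ⟨hi, hi'⟩⟩ := hl0 _ hs
        · cases hi
        · cases hi'
      · obtain ⟨i, ℓ, c, -, h1, h2⟩ := hQ _ hs
        simp only [SigQuery.sign.injEq] at h1
        obtain ⟨rfl, h1⟩ := h1
        exact hno ⟨ℓ, c, h1, h2⟩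
  refine not_safetyBroken_of_disclosed hI hfv hht hC hN (fun ℓ o hc ho hr => ?_) h
  by_contra hD
  rw [not_le] at hD
  obtain ⟨T, hT, hmem⟩ := mem_guesses (I := I) hC (v := ℓ) (o := o) (act (initView su C keys)) tape
    (inv_init I) rfl [] (by rw [hst]; exact hc) (by rw [hst]; exact ho) (by rw [hst]; exact hr)
    (by rw [hst]; exact hD)
  exact hG ⟨ℓ, o, T, hT, hmem⟩

end

section
open scoped ENNReal

variable {P : ℕ → Params}

/-- The probability of excluding a vote is at most that of a forgery and of a correct guess. -/
theorem exclusionProb_le (S : SignatureScheme) (A : Adversary P) (k : ℕ)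
    (hfv : 3 * (P k).fv < (P k).Nv) (hht : 1 ≤ (P k).ht)
    (hAvc : ∀ ω, (A.corruption k ω).vc.card ≤ (P k).fv) :
    exclusionProb A S k ≤ forgeProb S (A.toForger S) k + (P k).n * ((P k).fv / 2 ^ 64) := by
  classical
  choose l0 hl0 hrun using fun (x : Setup (P k) × A.Coins k × (Fin (P k).Nv → Bits × Bits)) =>
    run_experiment S k x.2.2 x.1 (A.corruption k x.2.1) (A.act k x.2.1) (A.moves k)
  let coins := draws (PMF.uniformOfFintype (Fin (S.signLen k) → Bool)) (A.moves k)
  let M : PMF (A.Coins k × (Fin (P k).Nv → Bits × Bits) × List (Fin (S.signLen k) → Bool)) :=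
    (A.dist k).bind fun ω => (S.keyDist k (P k).Nv).bind fun keys =>
      coins.map fun l => (ω, keys, l)
  -- A joint space on which violation, forgery and guesses are events of the same execution `fin`.
  let J := (setupDist (P k)).bind fun su => M.map fun y => (su, y)
  let fin := fun x : Setup (P k) × A.Coins k × (Fin (P k).Nv → Bits × Bits) ×
      List (Fin (S.signLen k) → Bool) =>
    playWith ⟨x.1, A.corruption k x.2.1, fun i => (x.2.2.1 i).1, S.verify k⟩
      (A.act k x.2.1 (initView x.1 (A.corruption k x.2.1) x.2.2.1))
      (x.2.2.2.map (SigComp.reply S k x.2.2.1)) (State.init (P k)) []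
  let Forged : Set (Setup (P k) × A.Coins k × (Fin (P k).Nv → Bits × Bits) ×
      List (Fin (S.signLen k) → Bool)) :=
    {x | IsForgery S k x.2.2.1 (candidates (fin x).1) (l0 (x.1, x.2.1, x.2.2.1) ++ (fin x).2)}
  let Guess : Fin (P k).n → Set (Setup (P k) × A.Coins k × (Fin (P k).Nv → Bits × Bits) ×
      List (Fin (S.signLen k) → Bool)) := fun v =>
    {x | Guessed (A.corruption k x.2.1) x.2.2.1 (S.verify k) (A.act k x.2.1)
      (x.2.2.2.map (SigComp.reply S k x.2.2.1)) v x.1}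
  have hexcl : exclusionProb A S k =
      (J.toOuterMeasure {x | SafetyBroken x.1 (A.corruption k x.2.1) (fin x).1}).toReal := by
    have h : (do
          let su ← setupDist (P k)
          let ω ← A.dist k
          let keys ← S.keyDist k (P k).Nv
          let r ← (A.play S k su ω).run S k keys
          return (su, A.corruption k ω, r.1) :
            PMF (Setup (P k) × Corruption (P k) × State (P k))) =
        J.map fun x => (x.1, A.corruption k x.2.1, (fin x).1) := by
      simp only [J, M, PMF.map_bind, PMF.map_comp]
      refine congrArg _ (funext fun su => congrArg _ (funext fun ω => congrArg _
        (funext fun keys => ?_)))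
      change ((A.play S k su ω).run S k keys).bind _ = _
      rw [Adversary.play, hrun (su, ω, keys)]
      exact PMF.map_comp _ _ _
    rw [exclusionProb, h, PMF.toOuterMeasure_map_apply]
    rfl
  have hforge : forgeProb S (A.toForger S) k = (J.toOuterMeasure Forged).toReal := by
    let D : PMF ((Fin (P k).Nv → Bits × Bits) ×
        List (Fin (P k).Nv × Bits × Bits) × List (SigQuery (P k).Nv)) :=
      ((setupDist (P k)).bind fun su => (A.dist k).bind fun ω => PMF.pure (su, ω)).bind fun x =>
        (S.keyDist k (P k).Nv).bind fun keys =>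
          ((A.play S k x.1 x.2 >>= fun st => pure (candidates st)).run S k keys).map
            fun r => (keys, r)
    have h : D = J.map fun x =>
        (x.2.2.1, candidates (fin x).1, l0 (x.1, x.2.1, x.2.2.1) ++ (fin x).2) := by
      simp only [D, J, M, PMF.map_bind, PMF.map_comp, PMF.bind_bind, PMF.pure_bind]
      refine congrArg _ (funext fun su => congrArg _ (funext fun ω => congrArg _
        (funext fun keys => ?_)))
      rw [SigComp.run_bind, Adversary.play, hrun (su, ω, keys)]
      simp only [SigComp.run_pure, PMF.map_bind, PMF.bind_map, PMF.pure_map, Function.comp_def,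
        List.append_nil]
      rfl
    change (D.toOuterMeasure {x | IsForgery S k x.1 x.2.1 x.2.2}).toReal = _
    rw [h, PMF.toOuterMeasure_map_apply]
    rfl
  have hguess : ∀ v, J.toOuterMeasure (Guess v) ≤ (P k).fv * (2 ^ 64 : ℝ≥0∞)⁻¹ := by
    intro v
    -- The setup is independent of keys and coins, so it may be drawn last and the bound applied for
    -- each fixed value of the others.
    have : J = M.bind fun y => (setupDist (P k)).map fun su => (su, y) := by
      simp only [J, PMF.map]
      exact PMF.bind_comm _ _ _
    rw [this, PMF.toOuterMeasure_bind_apply]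
    calc _ ≤ ∑' y, M y * ((P k).fv * (2 ^ 64 : ℝ≥0∞)⁻¹) := by
          refine ENNReal.tsum_le_tsum fun y => mul_le_mul_right ?_ _
          rw [PMF.toOuterMeasure_map_apply]
          exact measure_guessed_le (A.corruption k y.1) (hAvc y.1) y.2.1 (S.verify k) (A.act k y.1)
            (y.2.2.map (SigComp.reply S k y.2.1)) v
      _ = _ := by rw [ENNReal.tsum_mul_right, PMF.tsum_coe, one_mul]
  have hle : J.toOuterMeasure {x | SafetyBroken x.1 (A.corruption k x.2.1) (fin x).1} ≤
      J.toOuterMeasure Forged + (P k).n * ((P k).fv * (2 ^ 64 : ℝ≥0∞)⁻¹) := by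
    calc _ ≤ J.toOuterMeasure (Forged ∪ ⋃ v, Guess v) := by
          refine J.toOuterMeasure.mono fun x hx => ?_
          rcases safetyBroken_cases S k hfv hht x.1 (A.corruption k x.2.1) (hAvc x.2.1) x.2.2.1
            (A.act k x.2.1) (x.2.2.2.map (SigComp.reply S k x.2.2.1))
            (hl0 (x.1, x.2.1, x.2.2.1)) rfl hx with h | ⟨v, h⟩
          · exact .inl h
          · exact .inr (Set.mem_iUnion.2 ⟨v, h⟩)
      _ ≤ J.toOuterMeasure Forged + J.toOuterMeasure (⋃ v, Guess v) :=
          MeasureTheory.measure_union_le _ _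
      _ ≤ J.toOuterMeasure Forged + ∑ v, J.toOuterMeasure (Guess v) := by
          gcongr
          exact MeasureTheory.measure_iUnion_fintype_le _ _
      _ ≤ J.toOuterMeasure Forged + ∑ v : Fin (P k).n, (P k).fv * (2 ^ 64 : ℝ≥0∞)⁻¹ := by
          gcongr with v
          exact hguess v
      _ = _ := by simp
  have hfin : J.toOuterMeasure Forged ≠ ∞ := by
    refine ne_top_of_le_ne_top ENNReal.one_ne_top ?_
    exact (J.toOuterMeasure.mono (Set.subset_univ _)).trans_eq
      ((J.toOuterMeasure_apply_eq_one_iff _).2 (Set.subset_univ _))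
  have hfin' : (P k).n * ((P k).fv * (2 ^ 64 : ℝ≥0∞)⁻¹) ≠ ∞ := by
    finiteness
  rw [hexcl, hforge]
  refine (ENNReal.toReal_mono (ENNReal.add_ne_top.2 ⟨hfin, hfin'⟩) hle).trans_eq ?_
  rw [ENNReal.toReal_add hfin hfin']
  simp [div_eq_mul_inv]

end
end DDemos

theorem corollary1 (S : DDemos.SignatureScheme) (hS : S.Unforgeable) (P : ℕ → DDemos.Params)
    (hfv : ∀ k, 3 * (P k).fv < (P k).Nv) (hfv64 : ∀ k, (P k).fv < 2 ^ 64)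
    (hfb : ∀ k, 2 * (P k).fb < (P k).Nb) (hht : ∀ k, 1 ≤ (P k).ht ∧ (P k).ht ≤ (P k).Nt)
    (A : DDemos.Adversary P) (hA : A.PolyTime S)
    (hAvc : ∀ k ω, (A.corruption k ω).vc.card ≤ (P k).fv)
    (hAbb : ∀ k ω, (A.corruption k ω).bb.card ≤ (P k).fb)
    (hAt : ∀ k ω, (A.corruption k ω).trustee.card ≤ (P k).Nt - (P k).ht) :
    ∃ ν : ℕ → ℝ, DDemos.Negligible ν ∧ ∀ k,
      DDemos.exclusionProb A S k ≤
        ((P k).n : ℝ) * (P k).fv / ((2 : ℝ) ^ 64 - (P k).fv) + ν k := by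
  refine ⟨DDemos.forgeProb S (A.toForger S), hS _ hA, fun k => ?_⟩
  refine (DDemos.exclusionProb_le S A k (hfv k) (hht k).1 (hAvc k)).trans ?_
  have h1 : ((P k).fv : ℝ) < 2 ^ 64 := by exact_mod_cast hfv64 k
  rw [add_comm, mul_div_assoc]
  -- What remains is to compare denominators: `2 ^ 64 - fv ≤ 2 ^ 64`, the smaller one being positive
  -- by `h1`.
  gcongr
  linarith [(Nat.cast_nonneg (P k).fv : (0 : ℝ) ≤ (P k).fv)]
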